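/- Let $m$ be Lebesgue measure on $(0,1)$; measurable functions are real-valued and identified when equal a.e. For a measurable function $x$ on $(0,1)$ let $x^*(t)=\inf\{s\ge 0: m(\{|x|>s\})\le t\}$ be its non-increasing right-continuous rearrangement, and write $y\prec\prec x$ if $\int_0^t y^*(s)\,ds\le\int_0^t x^*(s)\,ds$ for all $t\ge 0$. A Banach space $E$ of measurable functions on $(0,1)$ is called symmetric if (a) $x\in E$ and $|y|\le|x|$ imply $y\in E$ and $\|y\|_E\le\|x\|_E$, and (b) $x\in E$ and $y^*=x^*$ imply $y\in E$ and $\|y\|_E=\|x\|_E$; it is called fully symmetric if, moreover, $x\in E$, $y\in L_1(0,1)$ and $y\prec\prec x$ imply $y\in E$ and $\|y\|_E\le\|x\|_E$. The norm of $E$ is a Fatou norm if $0\le x_n\uparrow x\in E$ a.e. (with $x_n\in E$) implies $\|x_n\|_E\uparrow\|x\|_E$. For $\tau>0$ let $(\sigma_\tau x)(s)=x(s/\tau)$ for $0<s\le\min\{1,\tau\}$ and $(\sigma_\tau x)(s)=0$ for $\tau<s\leq 1$, and set $$\varphi(x)=\lim_{s\to\infty}\frac1s\,\|\sigma_s(x^*)\|_E,\qquad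 x\in E.$$ For $0\le x\in L_1(0,1)$ let $\Omega_+(x)$ be the set of all $Tx$, where $T$ runs over the substochastic operators, i.e. the positive linear operators $T:L_1(0,1)\to L_1(0,1)$ with $\|T\|_{L_1\to L_1}\le1$ and $\|T\|_{L_\infty\to L_\infty}\le 1$. For $0\le x\in E$ let $Q_+(x)$ be the closure, in the norm of $E$, of the convex hull of the set of extreme points of $\Omega_+(x)$. **Theorem.** Let $E$ be a fully symmetric space on $(0,1)$ and let $0\le x\in E$. If $\varphi(x)=0$, then $\Omega_+(x)=Q_+(x)$. If, in addition, the norm of $E$ is a Fatou norm, then the converse also holds: $\Omega_+(x)=Q_+(x)$ implies $\varphi(x)=0$. -/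

import Mathlib

open MeasureTheory Filter Topology
open scoped ENNReal

noncomputable section

/-- Lebesgue measure on the interval `(0, 1)`. -/
abbrev lebUnit : Measure ℝ := volume.restrict (Set.Ioo 0 1)

/-- Real-valued Lebesgue measurable functions on `(0, 1)`, identified when equal a.e. -/
abbrev L0Unit : Type := ℝ →ₘ[lebUnit] ℝ

/-- The non-increasing right-continuous rearrangement
`x^*(t) = inf {s ≥ 0 : m(|x| > s) ≤ t}`. It is finite for `t > 0`, and `x^*(0)` is the essential
supremum of `|x|`, which may be `∞`. -/
def rearrangement (x : L0Unit) (t : ℝ) : ℝ≥0∞ :=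
  sInf {s : ℝ≥0∞ | lebUnit {u | s < ‖x u‖ₑ} ≤ ENNReal.ofReal t}

theorem rearrangement_antitone (x : L0Unit) : Antitone (rearrangement x) := by
  intro a b hab
  exact sInf_le_sInf fun s hs => le_trans hs (ENNReal.ofReal_le_ofReal hab)

/-- Hardy-Littlewood-Polya submajorization `y ≺≺ x`. -/
def Submajorized (y x : L0Unit) : Prop :=
  ∀ t : ℝ, 0 ≤ t →
    ∫⁻ s in Set.Ioc 0 t, rearrangement y s ≤ ∫⁻ s in Set.Ioc 0 t, rearrangement x s

/-- The function `σ_τ(x^*)` on `(0, 1)`: its value at `s` is `x^*(s / τ)` if `s ≤ τ`, and `0`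
if `s > τ`. -/
def dilatedRearrangementFun (τ : ℝ) (x : L0Unit) (s : ℝ) : ℝ :=
  if s ≤ τ then (rearrangement x (s / τ)).toReal else 0

theorem dilatedRearrangementFun_measurable (τ : ℝ) (x : L0Unit) :
    Measurable (dilatedRearrangementFun τ x) :=
  Measurable.ite measurableSet_Iic
    ((rearrangement_antitone x).measurable.comp (measurable_id.div_const τ)).ennreal_toReal
    measurable_const

/-- The class of `σ_τ(x^*)`. -/
def dilatedRearrangement (τ : ℝ) (x : L0Unit) : L0Unit :=
  AEEqFun.mk (dilatedRearrangementFun τ x)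
    (dilatedRearrangementFun_measurable τ x).aestronglyMeasurable

/-- A normed space of (classes of) measurable functions on `(0, 1)`: a linear subspace of
`L0Unit` with a norm on it. -/
structure NormedFunctionSpace where
  /-- the underlying linear space of functions -/
  toSubmodule : Submodule ℝ L0Unit
  /-- the norm -/
  norm : toSubmodule → ℝ
  norm_nonneg : ∀ x, 0 ≤ norm x
  norm_smul : ∀ (c : ℝ) x, norm (c • x) = |c| * norm x
  norm_triangle : ∀ x y, norm (x + y) ≤ norm x + norm y
  norm_eq_zero_iff : ∀ x, norm x = 0 ↔ x = 0

namespace NormedFunctionSpace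

/-- The type of elements of the space. -/
def Elem (E : NormedFunctionSpace) : Type := E.toSubmodule

instance : CoeSort NormedFunctionSpace Type := ⟨Elem⟩

instance (E : NormedFunctionSpace) : AddCommGroup E :=
  inferInstanceAs (AddCommGroup E.toSubmodule)

instance (E : NormedFunctionSpace) : Module ℝ E :=
  inferInstanceAs (Module ℝ E.toSubmodule)

instance (E : NormedFunctionSpace) : Norm E := ⟨E.norm⟩

theorem core (E : NormedFunctionSpace) : NormedSpace.Core ℝ E where
  norm_nonneg := E.norm_nonneg
  norm_smul := E.norm_smul
  norm_triangle := E.norm_triangle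
  norm_eq_zero_iff := E.norm_eq_zero_iff

instance (E : NormedFunctionSpace) : NormedAddCommGroup E := NormedAddCommGroup.ofCore E.core

instance (E : NormedFunctionSpace) : NormedSpace ℝ E := NormedSpace.ofCore E.core

/-- The measurable function (class) underlying an element of `E`. -/
def toL0 {E : NormedFunctionSpace} (x : E) : L0Unit := Subtype.val x

/-- The element of `E` given by a function that lies in `E`. -/
def elem (E : NormedFunctionSpace) (y : L0Unit) (hy : y ∈ E.toSubmodule) : E := Subtype.mk y hy

/-- The norm of `E` extended by `∞` to functions outside `E`. -/
def extNorm (E : NormedFunctionSpace) (y : L0Unit) : ℝ≥0∞ :=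
  ⨅ hy : y ∈ E.toSubmodule, ENNReal.ofReal ‖E.elem y hy‖

/-- `E` is a symmetric Banach space of functions on `(0, 1)`. -/
structure IsSymmetric (E : NormedFunctionSpace) : Prop where
  complete : CompleteSpace E
  ideal : ∀ (x : E) (y : L0Unit), |y| ≤ |toL0 x| →
    ∃ hy : y ∈ E.toSubmodule, ‖E.elem y hy‖ ≤ ‖x‖
  rearrangement_invariant : ∀ (x : E) (y : L0Unit),
    (∀ t ∈ Set.Ioo (0 : ℝ) 1, rearrangement y t = rearrangement (toL0 x) t) →
    ∃ hy : y ∈ E.toSubmodule, ‖E.elem y hy‖ = ‖x‖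

/-- `E` is a fully symmetric space on `(0, 1)`. Note that `L₁ + L∞ = L₁` on `(0, 1)`. -/
structure IsFullySymmetric (E : NormedFunctionSpace) : Prop extends E.IsSymmetric where
  submajorization : ∀ (x : E) (y : L0Unit), Integrable y lebUnit → Submajorized y (toL0 x) →
    ∃ hy : y ∈ E.toSubmodule, ‖E.elem y hy‖ ≤ ‖x‖

/-- The norm of `E` is a Fatou norm: `0 ≤ xₙ ↑ x ∈ E` a.e. implies `‖xₙ‖ ↑ ‖x‖`
(`‖xₙ‖` is then non-decreasing because `E` is an ideal lattice). -/
def IsFatou (E : NormedFunctionSpace) : Prop :=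
  ∀ (x : ℕ → E) (x' : E), (∀ n, 0 ≤ toL0 (x n)) → Monotone (fun n => toL0 (x n)) →
    (∀ᵐ t ∂lebUnit, Tendsto (fun n => toL0 (x n) t) atTop (𝓝 (toL0 x' t))) →
    Tendsto (fun n => ‖x n‖) atTop (𝓝 ‖x'‖)

/-- `φ(x) = l`, where `φ(x) = lim_{s → ∞} ‖σ_s(x^*)‖ / s`. -/
def HasDilationLimit (E : NormedFunctionSpace) (x : L0Unit) (l : ℝ≥0∞) : Prop :=
  Tendsto (fun s : ℝ => E.extNorm (dilatedRearrangement s x) / ENNReal.ofReal s) atTop (𝓝 l)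

end NormedFunctionSpace

/-- Substochastic operators on `(0, 1)`: positive linear operators on `L₁ + L∞ = L₁` that are
contractions in `L₁` and in `L∞`. -/
structure IsSubstochastic (T : Lp ℝ 1 lebUnit →L[ℝ] Lp ℝ 1 lebUnit) : Prop where
  norm_le_one : ‖T‖ ≤ 1
  eLpNorm_top_le : ∀ f : Lp ℝ 1 lebUnit, eLpNorm (T f) ⊤ lebUnit ≤ eLpNorm f ⊤ lebUnit
  map_nonneg : ∀ f : Lp ℝ 1 lebUnit, 0 ≤ f → 0 ≤ T f

/-- The orbit `Ω₊(x)` of `0 ≤ x ∈ L₁(0, 1)` under the semigroup of substochastic operators. -/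
def substochasticOrbit (x : L0Unit) : Set L0Unit :=
  {y | ∃ T : Lp ℝ 1 lebUnit →L[ℝ] Lp ℝ 1 lebUnit, IsSubstochastic T ∧
    ∃ f : Lp ℝ 1 lebUnit, (f : L0Unit) = x ∧ (T f : L0Unit) = y}

/-- `Q₊(x)`: the closure in the norm of `E` of the convex hull of the extreme points
of `Ω₊(x)`. -/
def closedHullExtremePoints (E : NormedFunctionSpace) (x : L0Unit) : Set E :=
  closure (convexHull ℝ
    {y : E | NormedFunctionSpace.toL0 y ∈ (substochasticOrbit x).extremePoints ℝ})

end

/-! Write X for the rearrangement of x. Everything is phrased through the excess, the integral of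
the part of a function above a level c. Since the integral of g* over (0, t) is the minimum over c
of ct plus the excess of g above c, smaller excesses at all levels give submajorization.

The orbit consists of the nonnegative y whose excesses are at most those of x
(`mem_substochasticOrbit_iff`). Operators shrink excesses because they contract L1 and L∞.
Conversely, truncate X to (0, β) so that its integral equals that of y. The excess of truncated X
over y* and the excess of y* over truncated X then have equal masses, the former lying further left,
so quantile functions match their points. Exchanging suitable amounts of mass between matched points
gives a coupling that turns truncated X into y*; Ryff's theorem carries y* to y.

The exchange always has slack: one can transfer slightly more or slightly less, so y is a proper
midpoint unless y* equals truncated X (`IsMajorizedPair.exists_midpoint`). Conversely, functions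
distributed like a truncation of X are extreme, because they exhaust the excess of x at every level
at or above their smallest nonzero values and t ↦ (t - c)⁺ is convex. The extreme points are
therefore the functions equimeasurable with a truncation of X.

If φ(x) = 0, round y in the orbit down to a countably valued p. Over each level set of p, the
coupling gives a decreasing function with the correct mean. Its n cyclic shifts, placed on n equal
pieces of the level set, average to a Riemann sum for that mean, whose error is 1/n times a boundary
term. These terms glue to a function e with m{e > c} ≤ n m{X > c}, hence e is controlled by the
n-fold dilation of X (`IsMajorizedPair.exists_shuffles`). The average of the shuffles is a convex
combination of extreme points, within (2/n)‖σ_n X‖ of p.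

For the converse, the constant M = ∫x belongs to the orbit, so some convex combination z of extreme
points is close to M. For small t such a z carries a proportion Λ of the integral of X over (0, t)
on a set of measure at most nt (`Concentrates`). Apart from the small error M - z, the mass of z
there is at most Mnt. Evaluating at t/s shows that (Λ/s) σ_s X is submajorized by |M - z| + nM/s, so
the upper limit of ‖σ_s X‖/s is at most ‖M - z‖/Λ. The mean of z keeps Λ away from 0, which forces
the limit to be 0. -/

/-! ### Decreasing rearrangements -/

/-- The decreasing rearrangement of `g` with respect to `μ`. -/
noncomputable def decRearr {α : Type*} [MeasurableSpace α] (μ : Measure α) (g : α → ℝ≥0∞)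
    (t : ℝ) : ℝ≥0∞ :=
  sInf {s : ℝ≥0∞ | μ {u | s < g u} ≤ ENNReal.ofReal t}

/-- The part of `g` above the level `c`, integrated over `(0, 1)`. -/
noncomputable def excess (g : ℝ → ℝ≥0∞) (c : ℝ≥0∞) : ℝ≥0∞ := ∫⁻ u, (g u - c) ∂lebUnit

instance lebUnit_isProbabilityMeasure : IsProbabilityMeasure lebUnit := ⟨by simp [lebUnit]⟩

theorem lebUnit_Iic (t : ℝ) (h0 : 0 ≤ t) (h1 : t ≤ 1) : lebUnit (Set.Iic t) = ENNReal.ofReal t := by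
  rw [lebUnit, Measure.restrict_apply measurableSet_Iic]
  rcases h1.lt_or_eq with h | rfl
  · have : Set.Iic t ∩ Set.Ioo (0:ℝ) 1 = Set.Ioc 0 t := by
      ext s; simp only [Set.mem_inter_iff, Set.mem_Iic, Set.mem_Ioo, Set.mem_Ioc]
      constructor
      · rintro ⟨a, b, c⟩; exact ⟨b, a⟩
      · rintro ⟨a, b⟩; exact ⟨b, a, by linarith⟩
    rw [this, Real.volume_Ioc, sub_zero]
  · have : Set.Iic (1:ℝ) ∩ Set.Ioo (0:ℝ) 1 = Set.Ioo 0 1 := by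
      ext s; simp only [Set.mem_inter_iff, Set.mem_Iic, Set.mem_Ioo]
      constructor
      · rintro ⟨a, b, c⟩; exact ⟨b, c⟩
      · rintro ⟨a, b⟩; exact ⟨by linarith, a, b⟩
    rw [this, Real.volume_Ioo, sub_zero]

section decRearr

variable {α : Type*} [MeasurableSpace α] {μ : Measure α} {g : α → ℝ≥0∞}

theorem decRearr_antitone (μ : Measure α) (g : α → ℝ≥0∞) : Antitone (decRearr μ g) :=
  fun _ _ hab => sInf_le_sInf fun _ hs => le_trans hs (ENNReal.ofReal_le_ofReal hab)

theorem measurable_decRearr (μ : Measure α) (g : α → ℝ≥0∞) : Measurable (decRearr μ g) :=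
  (decRearr_antitone μ g).measurable

/-- The distribution function is right-continuous, so the infimum defining the rearrangement is
attained. This equivalence replaces the definition from here on. -/
theorem decRearr_le_iff (μ : Measure α) (g : α → ℝ≥0∞) (t : ℝ) (s : ℝ≥0∞) :
    decRearr μ g t ≤ s ↔ μ {u | s < g u} ≤ ENNReal.ofReal t := by
  constructor
  · intro h
    rcases eq_or_ne s ⊤ with rfl | hs
    · simp
    obtain ⟨v, hv, hvs, hvt⟩ := exists_seq_strictAnti_tendsto' (lt_top_iff_ne_top.2 hs)
    have hU : {u | s < g u} = ⋃ n, {u | v n < g u} := by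
      ext u
      simp only [Set.mem_ofPred_eq, Set.mem_iUnion]
      constructor
      · intro hu
        exact (hvt.eventually (gt_mem_nhds hu)).exists
      · rintro ⟨n, hn⟩
        exact (hvs n).1.trans hn
    have hm : Monotone fun n => {u | v n < g u} := by
      intro a b hab u hu
      exact lt_of_le_of_lt (hv.antitone hab) hu
    rw [hU, hm.measure_iUnion]
    refine iSup_le fun n => ?_
    obtain ⟨w, hw, hwn⟩ := sInf_lt_iff.1 (lt_of_le_of_lt h (hvs n).1)
    exact (measure_mono fun u hu => lt_trans hwn hu).trans hw
  · intro h
    exact sInf_le h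

theorem lt_decRearr_iff (μ : Measure α) (g : α → ℝ≥0∞) (t : ℝ) (s : ℝ≥0∞) :
    s < decRearr μ g t ↔ ENNReal.ofReal t < μ {u | s < g u} := by
  rw [← not_le, decRearr_le_iff, not_le]

theorem decRearr_le_of_measure_le {β : Type*} [MeasurableSpace β] {ν : Measure β}
    {f : β → ℝ≥0∞} (t t' : ℝ)
    (h : ∀ s, μ {u | s < g u} ≤ ENNReal.ofReal t' → ν {u | s < f u} ≤ ENNReal.ofReal t) :
    decRearr ν f t ≤ decRearr μ g t' :=
  (decRearr_le_iff _ _ _ _).2 (h _ ((decRearr_le_iff _ _ _ _).1 le_rfl))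

theorem measure_lt_decRearr_le (μ : Measure α) (g : α → ℝ≥0∞) (t : ℝ) :
    μ {u | decRearr μ g t < g u} ≤ ENNReal.ofReal t :=
  (decRearr_le_iff _ _ _ _).1 le_rfl

theorem decRearr_eq_zero [IsFiniteMeasure μ] {t : ℝ} (ht : μ Set.univ ≤ ENNReal.ofReal t) :
    decRearr μ g t = 0 :=
  le_antisymm ((decRearr_le_iff _ _ _ _).2 ((measure_mono (Set.subset_univ _)).trans ht)) bot_le

theorem decRearr_lt_top [IsFiniteMeasure μ] (hg : Measurable g) (hfin : ∀ᵐ u ∂μ, g u < ⊤) {t : ℝ}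
    (ht : 0 < t) : decRearr μ g t < ⊤ := by
  have h0 : μ (⋂ n : ℕ, {u | (n : ℝ≥0∞) < g u}) = 0 := by
    refine measure_mono_null (fun u hu => ?_) (ae_iff.1 hfin)
    simp only [Set.mem_iInter, Set.mem_ofPred_eq] at hu ⊢
    intro hlt
    obtain ⟨n, hn⟩ := ENNReal.exists_nat_gt hlt.ne
    exact lt_asymm hn (hu n)
  have hlim := tendsto_measure_iInter_atTop (μ := μ) (s := fun n : ℕ => {u | (n : ℝ≥0∞) < g u})
    (fun n => (measurableSet_lt measurable_const hg).nullMeasurableSet)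
    (by
      intro a b hab u hu
      exact lt_of_le_of_lt (show (a : ℝ≥0∞) ≤ b by exact_mod_cast hab) hu) ⟨0, measure_ne_top _ _⟩
  rw [h0] at hlim
  obtain ⟨n, hn⟩ := (hlim.eventually (gt_mem_nhds (ENNReal.ofReal_pos.2 ht))).exists
  exact lt_of_le_of_lt ((decRearr_le_iff _ _ _ _).2 hn.le) (ENNReal.natCast_lt_top n)

theorem volume_restrict_ofReal_lt {M : ℝ} {b : ℝ≥0∞} (hb : b ≤ ENNReal.ofReal M) :
    (volume.restrict (Set.Ioo 0 M)) {t | ENNReal.ofReal t < b} = b := by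
  have hbt : b ≠ ⊤ := ne_top_of_le_ne_top ENNReal.ofReal_ne_top hb
  have hm : MeasurableSet {t : ℝ | ENNReal.ofReal t < b} :=
    measurableSet_lt ENNReal.measurable_ofReal measurable_const
  have hbM : b.toReal ≤ M ∨ b = 0 := by
    by_cases hM : 0 ≤ M
    · left; exact ENNReal.toReal_le_of_le_ofReal hM hb
    · right
      rw [ENNReal.ofReal_of_nonpos (not_le.1 hM).le] at hb
      exact le_antisymm hb bot_le
  rw [Measure.restrict_apply hm]
  rcases hbM with hbM | rfl
  · have : {t : ℝ | ENNReal.ofReal t < b} ∩ Set.Ioo 0 M = Set.Ioo 0 b.toReal := by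
      ext t
      simp only [Set.mem_inter_iff, Set.mem_ofPred_eq, Set.mem_Ioo]
      constructor
      · rintro ⟨h1, h2, h3⟩
        exact ⟨h2, (ENNReal.ofReal_lt_iff_lt_toReal h2.le hbt).1 h1⟩
      · rintro ⟨h1, h2⟩
        exact ⟨(ENNReal.ofReal_lt_iff_lt_toReal h1.le hbt).2 h2, h1, h2.trans_le hbM⟩
    rw [this, Real.volume_Ioo, sub_zero, ENNReal.ofReal_toReal hbt]
  · simp

theorem volume_lt_decRearr [IsFiniteMeasure μ] {M : ℝ} (hM : μ Set.univ ≤ ENNReal.ofReal M)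
    (s : ℝ≥0∞) :
    (volume.restrict (Set.Ioo 0 M)) {t | s < decRearr μ g t} = μ {u | s < g u} := by
  simp only [lt_decRearr_iff]
  exact volume_restrict_ofReal_lt ((measure_mono (Set.subset_univ _)).trans hM)

theorem ext_of_Ioi_finite {μ ν : Measure ℝ≥0∞} [IsFiniteMeasure μ] (h : μ Set.univ = ν Set.univ)
    (hI : ∀ s, μ (Set.Ioi s) = ν (Set.Ioi s)) : μ = ν := by
  have : IsFiniteMeasure ν := ⟨h ▸ measure_lt_top μ _⟩
  refine Measure.ext_of_Iic _ _ fun s => ?_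
  rw [← Set.compl_Ioi, measure_compl measurableSet_Ioi (measure_ne_top _ _),
    measure_compl measurableSet_Ioi (measure_ne_top _ _), h, hI]

/-- Equimeasurability: the two laws agree on all rays (s, ∞]. A general source measure is allowed
because the shuffles later rearrange over pieces of the interval. -/
theorem map_decRearr [IsFiniteMeasure μ] (hg : Measurable g) {M : ℝ}
    (hM : μ Set.univ = ENNReal.ofReal M) :
    (volume.restrict (Set.Ioo 0 M)).map (decRearr μ g) = μ.map g := by
  have : IsFiniteMeasure (volume.restrict (Set.Ioo (0:ℝ) M)) := ⟨by simp⟩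
  refine ext_of_Ioi_finite ?_ fun s => ?_
  · rw [Measure.map_apply (measurable_decRearr _ _) .univ, Measure.map_apply hg .univ]
    simp [hM]
  · rw [Measure.map_apply (measurable_decRearr _ _) measurableSet_Ioi,
      Measure.map_apply hg measurableSet_Ioi]
    exact volume_lt_decRearr hM.le s

theorem lintegral_comp_decRearr [IsFiniteMeasure μ] (hg : Measurable g) {M : ℝ}
    (hM : μ Set.univ = ENNReal.ofReal M) {Φ : ℝ≥0∞ → ℝ≥0∞} (hΦ : Measurable Φ) :
    ∫⁻ t in Set.Ioo 0 M, Φ (decRearr μ g t) = ∫⁻ u, Φ (g u) ∂μ := by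
  rw [← lintegral_map hΦ hg, ← map_decRearr hg hM, lintegral_map hΦ (measurable_decRearr _ _)]

end decRearr

/-! ### Excess above a level and submajorization -/

theorem lebUnit_univ_eq : lebUnit Set.univ = ENNReal.ofReal 1 := by simp

theorem excess_decRearr {g : ℝ → ℝ≥0∞} (hg : Measurable g) (c : ℝ≥0∞) :
    excess (decRearr lebUnit g) c = excess g c :=
  lintegral_comp_decRearr hg lebUnit_univ_eq (measurable_id.sub_const c)

theorem lintegral_decRearr {g : ℝ → ℝ≥0∞} (hg : Measurable g) :
    ∫⁻ u, decRearr lebUnit g u ∂lebUnit = ∫⁻ u, g u ∂lebUnit :=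
  lintegral_comp_decRearr hg lebUnit_univ_eq measurable_id

theorem excess_le_of_measure_le {f g : ℝ → ℝ≥0∞} (hf : Measurable f) (hg : Measurable g)
    (h : ∀ s, lebUnit {u | s < f u} ≤ lebUnit {u | s < g u}) (c : ℝ≥0∞) :
    excess f c ≤ excess g c := by
  rw [← excess_decRearr hf, ← excess_decRearr hg]
  refine lintegral_mono fun t => tsub_le_tsub_right ?_ c
  exact decRearr_le_of_measure_le _ _ fun s hs => (h s).trans hs

/-- One half of the duality between partial integrals of the rearrangement and excesses, from g* ≤ c
+ (g* - c)⁺. -/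
theorem setLIntegral_decRearr_le {g : ℝ → ℝ≥0∞} (hg : Measurable g) (t : ℝ) (c : ℝ≥0∞) :
    ∫⁻ s in Set.Ioc 0 t, decRearr lebUnit g s ≤ c * ENNReal.ofReal t + excess g c := by
  have h1 : ∫⁻ s in Set.Ioc 0 t, decRearr lebUnit g s
      ≤ ∫⁻ s in Set.Ioc 0 t, (c + (decRearr lebUnit g s - c)) :=
    lintegral_mono fun s => le_add_tsub
  refine h1.trans ?_
  rw [lintegral_add_left measurable_const]
  refine add_le_add (by simp) ?_
  rw [← excess_decRearr hg, excess]
  calc ∫⁻ s in Set.Ioc 0 t, (decRearr lebUnit g s - c)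
      ≤ ∫⁻ s in Set.Ioi 0, (decRearr lebUnit g s - c) :=
        lintegral_mono_set Set.Ioc_subset_Ioi_self
    _ = ∫⁻ s in Set.Ioo 0 1 ∪ Set.Ici 1, (decRearr lebUnit g s - c) := by
        congr 2
        exact (Set.Ioo_union_Ici_eq_Ioi one_pos).symm
    _ ≤ _ := (lintegral_union_le _ _ _)
    _ = _ := by
        rw [setLIntegral_congr_fun (g := fun _ => 0) measurableSet_Ici]
        · simp
        · intro s hs
          have : decRearr lebUnit g s = 0 := decRearr_eq_zero (by
            rw [lebUnit_univ_eq]; exact ENNReal.ofReal_le_ofReal hs)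
          simp [this]

/-- The other half: the level c = g*(t) is optimal, since g* is at least c before t and at most c
after it. -/
theorem exists_le_setLIntegral_decRearr {g : ℝ → ℝ≥0∞} (hg : Measurable g) {t : ℝ} :
    decRearr lebUnit g t * ENNReal.ofReal t + excess g (decRearr lebUnit g t) ≤
      ∫⁻ s in Set.Ioc 0 t, decRearr lebUnit g s := by
  set c := decRearr lebUnit g t with hc
  have h1 : ∫⁻ s in Set.Ioc 0 t, decRearr lebUnit g s
      = ∫⁻ s in Set.Ioc 0 t, (c + (decRearr lebUnit g s - c)) := by
    refine setLIntegral_congr_fun measurableSet_Ioc fun s hs => ?_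
    exact (add_tsub_cancel_of_le (decRearr_antitone _ _ hs.2)).symm
  rw [h1, lintegral_add_left measurable_const]
  refine add_le_add (by simp) ?_
  rw [← excess_decRearr hg, excess]
  have h2 : Set.Ioo (0:ℝ) 1 ⊆ Set.Ioc 0 t ∪ (Set.Ioi t) := by
    intro s hs
    rcases le_or_gt s t with h | h
    · exact Or.inl ⟨hs.1, h⟩
    · exact Or.inr h
  calc _ ≤ ∫⁻ s in Set.Ioc 0 t ∪ (Set.Ioi t), (decRearr lebUnit g s - c) :=
        lintegral_mono_set h2
    _ ≤ _ := lintegral_union_le _ _ _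
    _ = _ := by
        rw [setLIntegral_congr_fun (s := Set.Ioi t) (g := fun _ => 0) measurableSet_Ioi]
        · simp
        · intro s hs
          simp only [tsub_eq_zero_iff_le]
          exact decRearr_antitone _ _ (le_of_lt hs)

theorem setLIntegral_decRearr_mono {f g : ℝ → ℝ≥0∞} (hf : Measurable f) (hg : Measurable g)
    (h : ∀ c, excess f c ≤ excess g c) (t : ℝ) :
    ∫⁻ s in Set.Ioc 0 t, decRearr lebUnit f s ≤ ∫⁻ s in Set.Ioc 0 t, decRearr lebUnit g s :=
  (setLIntegral_decRearr_le hf t (decRearr lebUnit g t)).trans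
    ((add_le_add le_rfl (h _)).trans (exists_le_setLIntegral_decRearr hg))

theorem measurable_enorm_coe (x : L0Unit) : Measurable fun u => ‖x u‖ₑ :=
  x.measurable.enorm

theorem submajorized_of_excess_le {y x : L0Unit}
    (h : ∀ c, excess (fun u => ‖y u‖ₑ) c ≤ excess (fun u => ‖x u‖ₑ) c) : Submajorized y x :=
  fun t _ => setLIntegral_decRearr_mono (measurable_enorm_coe y) (measurable_enorm_coe x) h t

/-! ### Quantile functions and measure preserving parametrizations -/

/-- The quantile function of a finite measure carried by `(0, 1)`. -/
noncomputable def quantile (μ : Measure ℝ) (w : ℝ) : ℝ :=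
  sInf {t : ℝ | 0 ≤ t ∧ (ENNReal.ofReal w ≤ μ (Set.Iic t) ∨ 1 ≤ t)}

section quantile

variable {μ ν : Measure ℝ}

theorem quantile_set_nonempty (μ : Measure ℝ) (w : ℝ) :
    {t : ℝ | 0 ≤ t ∧ (ENNReal.ofReal w ≤ μ (Set.Iic t) ∨ 1 ≤ t)}.Nonempty :=
  ⟨1, zero_le_one, Or.inr le_rfl⟩

theorem quantile_set_bddBelow (μ : Measure ℝ) (w : ℝ) :
    BddBelow {t : ℝ | 0 ≤ t ∧ (ENNReal.ofReal w ≤ μ (Set.Iic t) ∨ 1 ≤ t)} :=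
  ⟨0, fun _ h => h.1⟩

theorem quantile_monotone (μ : Measure ℝ) : Monotone (quantile μ) := fun _ b hab =>
  csInf_le_csInf (quantile_set_bddBelow _ _) (quantile_set_nonempty μ b)
    fun _ ht => ⟨ht.1, ht.2.imp (le_trans (ENNReal.ofReal_le_ofReal hab)) id⟩

theorem measurable_quantile (μ : Measure ℝ) : Measurable (quantile μ) :=
  (quantile_monotone μ).measurable

theorem quantile_le_quantile (h : ∀ t, ν (Set.Iic t) ≤ μ (Set.Iic t)) (w : ℝ) :
    quantile μ w ≤ quantile ν w :=
  csInf_le_csInf (quantile_set_bddBelow _ _) (quantile_set_nonempty _ _)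
    fun t ht => ⟨ht.1, ht.2.imp (fun h' => h'.trans (h t)) id⟩

theorem measure_Iic_of_one_le (hμ : μ (Set.Ioo 0 1)ᶜ = 0) {t : ℝ} (ht : 1 ≤ t) :
    μ (Set.Iic t) = μ Set.univ := by
  refine measure_congr ?_
  rw [ae_eq_univ]
  refine measure_mono_null (fun s hs => ?_) hμ
  simp only [Set.mem_compl_iff, Set.mem_Iic, not_le, Set.mem_Ioo, not_and, not_lt] at hs ⊢
  intro _; linarith

theorem measure_Iic_of_nonpos (hμ : μ (Set.Ioo 0 1)ᶜ = 0) {t : ℝ} (ht : t ≤ 0) :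
    μ (Set.Iic t) = 0 := by
  refine measure_mono_null (fun s hs => ?_) hμ
  simp only [Set.mem_compl_iff, Set.mem_Iic, Set.mem_Ioo, not_and, not_lt] at hs ⊢
  intro _; linarith

/-- Right-continuity of the distribution function. The alternative `1 ≤ t` in `quantile` only keeps
the defining set nonempty; for w up to the total mass it adds no new points. -/
theorem quantile_le_iff [IsFiniteMeasure μ] (hμ : μ (Set.Ioo 0 1)ᶜ = 0) {w : ℝ} (hw : 0 < w)
    (hw' : ENNReal.ofReal w ≤ μ Set.univ) (t : ℝ) :
    quantile μ w ≤ t ↔ ENNReal.ofReal w ≤ μ (Set.Iic t) := by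
  constructor
  · intro h
    have key : ∀ t' > t, ENNReal.ofReal w ≤ μ (Set.Iic t') := by
      intro t' ht'
      obtain ⟨t'', h1, h2⟩ := exists_lt_of_csInf_lt (quantile_set_nonempty μ w)
        (lt_of_le_of_lt h ht')
      rcases h1.2 with h3 | h3
      · exact h3.trans (measure_mono (Set.Iic_subset_Iic.2 h2.le))
      · exact hw'.trans_eq (measure_Iic_of_one_le hμ (h3.trans h2.le)).symm
    have hlim := tendsto_measure_biInter_gt (μ := μ) (s := fun r => Set.Iic r) (a := t)
      (fun r _ => measurableSet_Iic.nullMeasurableSet)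
      (fun i j _ hij => Set.Iic_subset_Iic.2 hij) ⟨t + 1, by simp, measure_ne_top _ _⟩
    have hI : ⋂ r, ⋂ (_ : r > t), Set.Iic r = Set.Iic t := by
      ext s
      simp only [Set.mem_iInter, Set.mem_Iic]
      exact ⟨fun h => le_of_forall_gt_imp_ge_of_dense h, fun h r hr => h.trans hr.le⟩
    rw [hI] at hlim
    exact ge_of_tendsto hlim (eventually_mem_nhdsWithin.mono fun r hr => key r hr)
  · intro h
    refine csInf_le (quantile_set_bddBelow _ _) ⟨?_, Or.inl h⟩
    by_contra! h0
    rw [measure_Iic_of_nonpos hμ h0.le] at h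
    simp at h
    linarith

theorem ofReal_le_univ_of_mem {μ : Measure ℝ} {w : ℝ} (hw : w ∈ Set.Ioo 0 (μ Set.univ).toReal) :
    ENNReal.ofReal w ≤ μ Set.univ :=
  ENNReal.ofReal_le_of_le_toReal hw.2.le

theorem map_quantile [IsFiniteMeasure μ] (hμ : μ (Set.Ioo 0 1)ᶜ = 0) :
    (volume.restrict (Set.Ioo 0 (μ Set.univ).toReal)).map (quantile μ) = μ := by
  have : IsFiniteMeasure (volume.restrict (Set.Ioo (0:ℝ) (μ Set.univ).toReal)) := ⟨by simp⟩
  refine Measure.ext_of_Iic _ _ fun t => ?_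
  rw [Measure.map_apply (measurable_quantile μ) measurableSet_Iic,
    Measure.restrict_apply (measurable_quantile μ measurableSet_Iic)]
  set M := (μ Set.univ).toReal with hM
  have ht : (μ (Set.Iic t)).toReal ≤ M :=
    ENNReal.toReal_mono (measure_ne_top _ _) (measure_mono (Set.subset_univ _))
  have hset : Set.Ioo 0 (μ (Set.Iic t)).toReal ⊆ quantile μ ⁻¹' Set.Iic t ∩ Set.Ioo 0 M := by
    intro w hw
    have hw2 : w ∈ Set.Ioo 0 M := ⟨hw.1, hw.2.trans_le ht⟩
    exact ⟨(quantile_le_iff hμ hw.1 (ofReal_le_univ_of_mem hw2) t).2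
      (ENNReal.ofReal_le_of_le_toReal hw.2.le), hw2⟩
  have hset' : quantile μ ⁻¹' Set.Iic t ∩ Set.Ioo 0 M ⊆ Set.Ioc 0 (μ (Set.Iic t)).toReal := by
    rintro w ⟨h1, h2⟩
    refine ⟨h2.1, ?_⟩
    exact (ENNReal.ofReal_le_iff_le_toReal (measure_ne_top _ _)).1
      ((quantile_le_iff hμ h2.1 (ofReal_le_univ_of_mem h2) t).1 h1)
  apply le_antisymm
  · refine (measure_mono hset').trans_eq ?_
    rw [Real.volume_Ioc, sub_zero, ENNReal.ofReal_toReal (measure_ne_top _ _)]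
  · refine le_of_eq_of_le ?_ (measure_mono hset)
    rw [Real.volume_Ioo, sub_zero, ENNReal.ofReal_toReal (measure_ne_top _ _)]

/-- The cumulative distribution function of a finite measure. -/
noncomputable def cumul (μ : Measure ℝ) (s : ℝ) : ℝ := (μ (Set.Iic s)).toReal

theorem cumul_monotone (μ : Measure ℝ) [IsFiniteMeasure μ] : Monotone (cumul μ) := fun _ _ hab =>
  ENNReal.toReal_mono (measure_ne_top _ _) (measure_mono (Set.Iic_subset_Iic.2 hab))

theorem measurable_cumul (μ : Measure ℝ) [IsFiniteMeasure μ] : Measurable (cumul μ) :=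
  (cumul_monotone μ).measurable

/-- Without atoms the distribution function does not jump, so approaching the quantile from the left
gives the upper bound. -/
theorem cumul_quantile [IsFiniteMeasure μ] [NullSingletonClass μ] (hμ : μ (Set.Ioo 0 1)ᶜ = 0) {w : ℝ}
    (hw : w ∈ Set.Ioo 0 (μ Set.univ).toReal) : cumul μ (quantile μ w) = w := by
  have hG := quantile_le_iff hμ hw.1 (ofReal_le_univ_of_mem hw)
  apply le_antisymm
  · have hlim := tendsto_measure_iUnion_atTop (μ := μ)
      (s := fun n : ℕ => Set.Iic (quantile μ w - 1 / ((n : ℝ) + 1))) (by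
        intro a b hab
        exact Set.Iic_subset_Iic.2 (sub_le_sub_left (Nat.one_div_le_one_div hab) _))
    have hU : ⋃ n : ℕ, Set.Iic (quantile μ w - 1 / ((n : ℝ) + 1)) = Set.Iio (quantile μ w) := by
      ext s
      simp only [Set.mem_iUnion, Set.mem_Iic, Set.mem_Iio]
      constructor
      · rintro ⟨n, hn⟩
        exact hn.trans_lt (sub_lt_self _ Nat.one_div_pos_of_nat)
      · intro hs
        obtain ⟨n, hn⟩ := exists_nat_one_div_lt (sub_pos.2 hs)
        exact ⟨n, by linarith⟩
    rw [hU, measure_congr Iio_ae_eq_Iic] at hlim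
    refine ENNReal.toReal_le_of_le_ofReal hw.1.le (le_of_tendsto hlim (Eventually.of_forall
      fun n => ?_))
    have : ¬ quantile μ w ≤ quantile μ w - 1 / ((n : ℝ) + 1) := by
      rw [not_le]; exact sub_lt_self _ Nat.one_div_pos_of_nat
    rw [hG, not_le] at this
    exact this.le
  · exact (ENNReal.ofReal_le_iff_le_toReal (measure_ne_top _ _)).1 ((hG _).1 le_rfl)

/-- This is how a measurable set A is parametrized by the interval (0, |A|): take the cumulative
function of Lebesgue measure restricted to A. -/
theorem map_cumul [IsFiniteMeasure μ] [NullSingletonClass μ] (hμ : μ (Set.Ioo 0 1)ᶜ = 0) :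
    μ.map (cumul μ) = volume.restrict (Set.Ioo 0 (μ Set.univ).toReal) := by
  have h := Measure.map_map (μ := volume.restrict (Set.Ioo 0 (μ Set.univ).toReal))
    (measurable_cumul μ) (measurable_quantile μ)
  rw [map_quantile hμ] at h
  rw [h]
  conv_rhs => rw [← Measure.map_id (μ := volume.restrict (Set.Ioo 0 (μ Set.univ).toReal))]
  refine Measure.map_congr ?_
  filter_upwards [ae_restrict_mem measurableSet_Ioo] with w hw
  exact cumul_quantile hμ hw

end quantile

theorem lebUnit_restrict_compl (A : Set ℝ) : (lebUnit.restrict A) (Set.Ioo 0 1)ᶜ = 0 := by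
  refine le_antisymm ((Measure.restrict_apply_le _ _).trans_eq ?_) bot_le
  rw [lebUnit, Measure.restrict_apply measurableSet_Ioo.compl]
  simp

theorem setLIntegral_comp_cumul (A : Set ℝ) {Φ : ℝ → ℝ≥0∞}
    (hΦ : Measurable Φ) :
    ∫⁻ s in A, Φ (cumul (lebUnit.restrict A) s) ∂lebUnit =
      ∫⁻ v in Set.Ioo 0 (lebUnit A).toReal, Φ v := by
  have h := map_cumul (μ := lebUnit.restrict A) (lebUnit_restrict_compl A)
  rw [Measure.restrict_apply_univ] at h
  rw [← h, lintegral_map hΦ (measurable_cumul _)]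

/-! ### Ryff's theorem: a function is its rearrangement composed with a measure preserving map -/

/-- Ryff's map, which sorts the points of `(0, 1)` by decreasing values of `g`. -/
noncomputable def ryffMap (g : ℝ → ℝ≥0∞) (s : ℝ) : ℝ :=
  (lebUnit {u | g s < g u}).toReal + (lebUnit {u | g u = g s ∧ u ≤ s}).toReal

theorem measurable_ryffMap {g : ℝ → ℝ≥0∞} (hg : Measurable g) : Measurable (ryffMap g) := by
  have h1 : Measurable fun s => lebUnit {u | g s < g u} :=
    measurable_measure_prodMk_left (ν := lebUnit) (s := {p : ℝ × ℝ | g p.1 < g p.2})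
      (measurableSet_lt (hg.comp measurable_fst) (hg.comp measurable_snd))
  have h2 : Measurable fun s => lebUnit {u | g u = g s ∧ u ≤ s} :=
    measurable_measure_prodMk_left (ν := lebUnit)
      (s := {p : ℝ × ℝ | g p.2 = g p.1 ∧ p.2 ≤ p.1})
      ((measurableSet_eq_fun (hg.comp measurable_snd) (hg.comp measurable_fst)).inter
        (measurableSet_le measurable_snd measurable_fst))
  exact h1.ennreal_toReal.add h2.ennreal_toReal

theorem ryffMap_eq_cumul (g : ℝ → ℝ≥0∞) {v : ℝ≥0∞} {s : ℝ} (hs : g s = v) :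
    ryffMap g s = (lebUnit {u | v < g u}).toReal + cumul (lebUnit.restrict {u | g u = v}) s := by
  subst hs
  rw [ryffMap, cumul, Measure.restrict_apply measurableSet_Iic]
  congr 3
  ext u
  simp [and_comm]

theorem measure_level_cumul_lt (A : Set ℝ) (r : ℝ)
    (hr : r ≤ (lebUnit A).toReal) :
    lebUnit {s | s ∈ A ∧ cumul (lebUnit.restrict A) s ≤ r} = ENNReal.ofReal r ∧
      lebUnit {s | s ∈ A ∧ cumul (lebUnit.restrict A) s < r} = ENNReal.ofReal r := by
  have h := map_cumul (μ := lebUnit.restrict A) (lebUnit_restrict_compl A)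
  rw [Measure.restrict_apply_univ] at h
  have hm := measurable_cumul (lebUnit.restrict A)
  have key : ∀ S : Set ℝ, MeasurableSet S → lebUnit {s | s ∈ A ∧ cumul (lebUnit.restrict A) s ∈ S}
      = volume (S ∩ Set.Ioo 0 (lebUnit A).toReal) := by
    intro S hS
    rw [← Measure.restrict_apply hS, ← h, Measure.map_apply hm hS,
      Measure.restrict_apply (hm hS)]
    congr 1
    ext s; simp [and_comm]
  have hle : ∀ S : Set ℝ, Set.Ioo 0 r ⊆ S → S ⊆ Set.Iic r →
      volume (S ∩ Set.Ioo 0 (lebUnit A).toReal) = ENNReal.ofReal r := by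
    intro S h1 h2
    apply le_antisymm
    · refine (measure_mono (t := Set.Ioc 0 r) ?_).trans_eq (by simp)
      rintro s ⟨a, b⟩
      exact ⟨b.1, h2 a⟩
    · refine le_of_eq_of_le (b := volume (Set.Ioo 0 r)) (by simp) (measure_mono ?_)
      intro s hs
      exact ⟨h1 hs, hs.1, hs.2.trans_le hr⟩
  constructor
  · exact (key (Set.Iic r) measurableSet_Iic).trans
      (hle _ (fun s hs => hs.2.le) (fun s hs => hs))
  · exact (key (Set.Iio r) measurableSet_Iio).trans
      (hle _ (fun s hs => hs.2) (fun s hs => (show s < r from hs).le))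

/-- Every level strictly below g*(t) is exceeded on measure more than t; let the levels increase to
g*(t). -/
theorem le_measure_decRearr_le {g : ℝ → ℝ≥0∞} (hg : Measurable g) {t : ℝ} (ht : t ≤ 1) :
    ENNReal.ofReal t ≤ lebUnit {u | decRearr lebUnit g t ≤ g u} := by
  set v := decRearr lebUnit g t with hv
  rcases eq_or_ne v 0 with h0 | h0
  · simp only [h0, zero_le, Set.ofPred_true]
    rw [lebUnit_univ_eq]
    exact ENNReal.ofReal_le_ofReal ht
  · obtain ⟨w, hw, hwv, hwt⟩ := exists_seq_strictMono_tendsto' (pos_iff_ne_zero.2 h0)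
    have hlim := tendsto_measure_iInter_atTop (μ := lebUnit) (s := fun n => {u | w n < g u})
      (fun n => (measurableSet_lt measurable_const hg).nullMeasurableSet)
      (fun a b hab u hu => lt_of_le_of_lt (hw.monotone hab) hu) ⟨0, measure_ne_top _ _⟩
    have hI : ⋂ n, {u | w n < g u} = {u | v ≤ g u} := by
      ext u
      simp only [Set.mem_iInter, Set.mem_ofPred_eq]
      exact ⟨fun h => le_of_tendsto' hwt fun n => (h n).le, fun h n => (hwv n).2.trans_le h⟩
    rw [hI] at hlim
    refine ge_of_tendsto' hlim fun n => ?_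
    exact ((lt_decRearr_iff _ _ _ _).1 (hwv n).2).le

/-- The points sorted before t are those with g > v = g*(t), of measure a, and an initial part of
the level set g = v of measure t - a. Ties are broken by position, which is uniform on the level
set. -/
theorem measure_ryffMap {g : ℝ → ℝ≥0∞} (hg : Measurable g) {t : ℝ} (ht : t ∈ Set.Ioo (0:ℝ) 1) :
    ENNReal.ofReal t ≤ lebUnit {s | ryffMap g s ≤ t} ∧
      lebUnit {s | ryffMap g s < t} ≤ ENNReal.ofReal t := by
  set v := decRearr lebUnit g t with hv
  set a := (lebUnit {u | v < g u}).toReal with ha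
  set A := {u | g u = v} with hA
  have hAm : MeasurableSet A := hg (measurableSet_singleton v)
  have hBm : MeasurableSet {u | v < g u} := measurableSet_lt measurable_const hg
  have hat : a ≤ t := ENNReal.toReal_le_of_le_ofReal ht.1.le (measure_lt_decRearr_le _ _ _)
  have hge : {u | v ≤ g u} = {u | v < g u} ∪ A := by
    ext u; simp only [hA, Set.mem_union, Set.mem_ofPred_eq, le_iff_lt_or_eq, eq_comm]
  have hdis : ∀ S : Set ℝ, S ⊆ A → Disjoint {u | v < g u} S := by
    intro S hS
    refine Set.disjoint_left.2 fun u hu hu' => ?_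
    have : g u = v := hS hu'
    simp only [Set.mem_ofPred_eq, this, lt_self_iff_false] at hu
  have hta : t - a ≤ (lebUnit A).toReal := by
    have h1 := le_measure_decRearr_le hg ht.2.le
    rw [← hv, hge, measure_union (hdis A subset_rfl) hAm] at h1
    have h2 := (ENNReal.ofReal_le_iff_le_toReal (ENNReal.add_ne_top.2 ⟨measure_ne_top _ _, measure_ne_top _ _⟩)).1 h1
    rw [ENNReal.toReal_add (measure_ne_top _ _) (measure_ne_top _ _)] at h2
    linarith
  have hadd : ENNReal.ofReal a + ENNReal.ofReal (t - a) = ENNReal.ofReal t := by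
    rw [← ENNReal.ofReal_add ENNReal.toReal_nonneg (by linarith)]
    congr 1; ring
  have haa : lebUnit {u | v < g u} = ENNReal.ofReal a :=
    (ENNReal.ofReal_toReal (measure_ne_top _ _)).symm
  have hlev := measure_level_cumul_lt A (t - a) hta
  have hcm := measurable_cumul (lebUnit.restrict A)
  constructor
  · rw [← hadd, ← haa, ← hlev.1, ← measure_union (hdis {s | s ∈ A ∧ cumul (lebUnit.restrict A) s ≤ t - a} fun s hs => hs.1)
      (hAm.inter (measurableSet_le hcm measurable_const))]
    refine measure_mono ?_
    rintro s (hs | ⟨hs, hs'⟩)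
    · have h1 : ryffMap g s ≤ a := by
        rw [ryffMap, ha, ← ENNReal.toReal_add (measure_ne_top _ _) (measure_ne_top _ _)]
        refine ENNReal.toReal_mono (measure_ne_top _ _) ?_
        rw [← measure_union]
        · refine measure_mono ?_
          rintro u (hu | hu)
          · exact lt_trans (show v < g s from hs) (show g s < g u from hu)
          · exact lt_of_lt_of_eq (show v < g s from hs) hu.1.symm
        · refine Set.disjoint_left.2 fun u hu hu' => ?_
          exact absurd hu'.1 (ne_of_gt hu)
        · exact (measurableSet_eq_fun hg measurable_const).inter measurableSet_Iic
      exact h1.trans hat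
    · have : ryffMap g s = _ := ryffMap_eq_cumul g hs
      simp only [Set.mem_ofPred_eq, this]
      linarith
  · rw [← hadd, ← haa, ← hlev.2, ← measure_union (hdis {s | s ∈ A ∧ cumul (lebUnit.restrict A) s < t - a} fun s hs => hs.1)
      (hAm.inter (measurableSet_lt hcm measurable_const))]
    refine measure_mono ?_
    intro s hs
    rcases lt_trichotomy (g s) v with h | h | h
    · exfalso
      have h1 : t ≤ (lebUnit {u | g s < g u}).toReal := by
        refine (ENNReal.ofReal_le_iff_le_toReal (measure_ne_top _ _)).1
          ((le_measure_decRearr_le hg ht.2.le).trans (measure_mono fun u hu => ?_))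
        exact lt_of_lt_of_le h hu
      have h2 : ryffMap g s < t := hs
      have h3 : 0 ≤ (lebUnit {u | g u = g s ∧ u ≤ s}).toReal := ENNReal.toReal_nonneg
      rw [ryffMap] at h2
      linarith
    · right
      refine ⟨h, ?_⟩
      have h2 : ryffMap g s < t := hs
      rw [ryffMap_eq_cumul g h] at h2
      linarith
    · left; exact h

theorem measurePreserving_ryffMap {g : ℝ → ℝ≥0∞} (hg : Measurable g) :
    MeasurePreserving (ryffMap g) lebUnit lebUnit := by
  have hm := measurable_ryffMap hg
  refine ⟨hm, ?_⟩
  have : IsProbabilityMeasure (lebUnit.map (ryffMap g)) :=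
    Measure.isProbabilityMeasure_map hm.aemeasurable
  have hup : ∀ t ∈ Set.Ioo (0:ℝ) 1, lebUnit.map (ryffMap g) (Set.Iic t) ≤ ENNReal.ofReal t := by
    intro t ht
    have hlim : Tendsto (fun r : ℝ => ENNReal.ofReal r) (𝓝[>] t) (𝓝 (ENNReal.ofReal t)) :=
      (ENNReal.continuous_ofReal.tendsto t).mono_left nhdsWithin_le_nhds
    refine ge_of_tendsto hlim ?_
    filter_upwards [Ioo_mem_nhdsGT ht.2] with r hr
    rw [Measure.map_apply hm measurableSet_Iic]
    refine le_trans (measure_mono fun s hs => ?_)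
      (measure_ryffMap hg ⟨ht.1.trans hr.1, hr.2⟩).2
    exact lt_of_le_of_lt hs hr.1
  have hlo : ∀ t ∈ Set.Ioo (0:ℝ) 1, ENNReal.ofReal t ≤ lebUnit.map (ryffMap g) (Set.Iic t) := by
    intro t ht
    rw [Measure.map_apply hm measurableSet_Iic]
    exact (measure_ryffMap hg ht).1
  refine Measure.ext_of_Iic _ _ fun t => ?_
  rcases le_or_gt t 0 with h0 | h0
  · have : lebUnit (Set.Iic t) = 0 := by
      refine le_antisymm ((measure_mono (Set.Iic_subset_Iic.2 h0)).trans ?_) bot_le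
      rw [lebUnit_Iic 0 le_rfl zero_le_one]; simp
    rw [this]
    have hlim : Tendsto (fun r : ℝ => ENNReal.ofReal r) (𝓝[>] 0) (𝓝 0) := by
      simpa using (ENNReal.continuous_ofReal.tendsto 0).mono_left
        (nhdsWithin_le_nhds (s := Set.Ioi 0))
    refine le_antisymm (ge_of_tendsto hlim ?_) bot_le
    filter_upwards [Ioo_mem_nhdsGT (zero_lt_one (α := ℝ))] with r hr
    exact (measure_mono (Set.Iic_subset_Iic.2 (h0.trans hr.1.le))).trans (hup r hr)
  · rcases lt_or_ge t 1 with h1 | h1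
    · rw [lebUnit_Iic t h0.le h1.le]
      exact le_antisymm (hup t ⟨h0, h1⟩) (hlo t ⟨h0, h1⟩)
    · have : lebUnit (Set.Iic t) = 1 := by
        refine le_antisymm prob_le_one ?_
        refine le_of_eq_of_le ?_ (measure_mono (Set.Iic_subset_Iic.2 h1))
        rw [lebUnit_Iic 1 zero_le_one le_rfl]; simp
      rw [this]
      refine le_antisymm prob_le_one ?_
      have hlim : Tendsto (fun r : ℝ => ENNReal.ofReal r) (𝓝[<] 1) (𝓝 1) := by
        simpa using (ENNReal.continuous_ofReal.tendsto 1).mono_left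
          (nhdsWithin_le_nhds (s := Set.Iio 1))
      refine le_of_tendsto hlim ?_
      filter_upwards [Ioo_mem_nhdsLT (zero_lt_one (α := ℝ))] with r hr
      exact (hlo r hr).trans (measure_mono (Set.Iic_subset_Iic.2 (hr.2.le.trans h1)))

/-- The inequality g*(ρ(s)) ≤ g(s) is pointwise, because ρ(s) is at least the measure of {g > g(s)}.
The integrals agree and are finite, so it is an equality a.e. -/
theorem decRearr_ryffMap {g : ℝ → ℝ≥0∞} (hg : Measurable g) (hfin : ∫⁻ u, g u ∂lebUnit ≠ ⊤) :
    (fun s => decRearr lebUnit g (ryffMap g s)) =ᵐ[lebUnit] g := by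
  have hmp := measurePreserving_ryffMap hg
  have hle : (fun s => decRearr lebUnit g (ryffMap g s)) ≤ g := by
    intro s
    refine (decRearr_le_iff _ _ _ _).2 ?_
    rw [← ENNReal.ofReal_toReal (measure_ne_top lebUnit {u | g s < g u})]
    refine ENNReal.ofReal_le_ofReal ?_
    rw [ryffMap]
    linarith [ENNReal.toReal_nonneg (a := lebUnit {u | g u = g s ∧ u ≤ s})]
  have hint : ∫⁻ s, decRearr lebUnit g (ryffMap g s) ∂lebUnit = ∫⁻ u, g u ∂lebUnit := by
    rw [hmp.lintegral_comp (measurable_decRearr _ _), lintegral_decRearr hg]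
  exact ae_eq_of_ae_le_of_lintegral_le (Eventually.of_forall hle) (hint ▸ hfin)
    hg.aemeasurable hint.ge

/-! ### Substochastic operators given by couplings -/

/-- A measure on the square whose marginals are dominated by Lebesgue measure on `(0, 1)`. -/
structure IsSubcoupling (π : Measure (ℝ × ℝ)) : Prop where
  map_fst_le : π.map Prod.fst ≤ lebUnit
  map_snd_le : π.map Prod.snd ≤ lebUnit

namespace IsSubcoupling

variable {π : Measure (ℝ × ℝ)}

theorem isFiniteMeasure (h : IsSubcoupling π) : IsFiniteMeasure π := by
  refine ⟨?_⟩
  have := h.map_fst_le Set.univ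
  rw [Measure.map_apply measurable_fst .univ, Set.preimage_univ] at this
  exact this.trans_lt (measure_lt_top _ _)

theorem measure_snd_preimage_le (h : IsSubcoupling π) {A : Set ℝ} (hA : MeasurableSet A) :
    π (Prod.snd ⁻¹' A) ≤ lebUnit A := by
  rw [← Measure.map_apply measurable_snd hA]; exact h.map_snd_le A

theorem quasiMeasurePreserving_fst (h : IsSubcoupling π) :
    Measure.QuasiMeasurePreserving Prod.fst π lebUnit :=
  ⟨measurable_fst, Measure.absolutelyContinuous_of_le h.map_fst_le⟩

theorem integrable_comp_fst (h : IsSubcoupling π) {f : ℝ → ℝ} (hf : Integrable f lebUnit) :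
    Integrable (fun p => f p.1) π :=
  (hf.mono_measure h.map_fst_le).comp_measurable measurable_fst

theorem integral_norm_comp_fst_le (h : IsSubcoupling π) {f : ℝ → ℝ} (hf : Integrable f lebUnit) :
    ∫ p, ‖f p.1‖ ∂π ≤ ∫ u, ‖f u‖ ∂lebUnit := by
  have hf' := hf.mono_measure h.map_fst_le
  rw [← integral_map (φ := Prod.fst) (f := fun u => ‖f u‖) measurable_fst.aemeasurable
    hf'.norm.aestronglyMeasurable]
  exact integral_mono_measure h.map_fst_le (Eventually.of_forall fun _ => norm_nonneg _) hf.norm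

/-- Radon–Nikodym: weight π by a function of the first coordinate and project to the second, where
the result is absolutely continuous. -/
theorem exists_lintegral_density (h : IsSubcoupling π) {F : ℝ → ℝ≥0∞}
    (hF : ∫⁻ p, F p.1 ∂π ≠ ⊤) :
    ∃ g : ℝ → ℝ≥0∞, Measurable g ∧ ∀ A, MeasurableSet A →
      ∫⁻ p in Prod.snd ⁻¹' A, F p.1 ∂π = ∫⁻ v in A, g v ∂lebUnit := by
  set κ := (π.withDensity fun p => F p.1).map Prod.snd with hκ
  have hfin : IsFiniteMeasure (π.withDensity fun p => F p.1) := isFiniteMeasure_withDensity hF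
  have hac : κ ≪ lebUnit := by
    refine Measure.AbsolutelyContinuous.mk fun A hA h0 => ?_
    rw [hκ, Measure.map_apply measurable_snd hA]
    exact withDensity_absolutelyContinuous _ _
      (le_antisymm ((h.measure_snd_preimage_le hA).trans h0.le) bot_le)
  refine ⟨κ.rnDeriv lebUnit, Measure.measurable_rnDeriv _ _, fun A hA => ?_⟩
  rw [Measure.setLIntegral_rnDeriv hac, hκ, Measure.map_apply measurable_snd hA,
    withDensity_apply _ (measurable_snd hA)]

theorem exists_density_of_nonneg (h : IsSubcoupling π) {F : ℝ → ℝ≥0∞}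
    (hF : ∫⁻ p, F p.1 ∂π ≠ ⊤) :
    ∃ g : ℝ → ℝ, Integrable g lebUnit ∧ ∀ A, MeasurableSet A →
      ∫ v in A, g v ∂lebUnit = (∫⁻ p in Prod.snd ⁻¹' A, F p.1 ∂π).toReal := by
  obtain ⟨g, hg, hgA⟩ := h.exists_lintegral_density hF
  have hfin : ∫⁻ v, g v ∂lebUnit ≠ ⊤ := by
    have := hgA Set.univ .univ
    simp only [Set.preimage_univ, Measure.restrict_univ] at this
    rwa [← this]
  refine ⟨fun v => (g v).toReal, integrable_toReal_of_lintegral_ne_top hg.aemeasurable hfin,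
    fun A hA => ?_⟩
  rw [integral_toReal hg.aemeasurable (ae_restrict_of_ae (ae_lt_top hg hfin)), hgA A hA]

theorem exists_density (h : IsSubcoupling π) {f : ℝ → ℝ} (hf : Integrable f lebUnit) :
    ∃ g : ℝ → ℝ, Integrable g lebUnit ∧ ∀ A, MeasurableSet A →
      ∫ v in A, g v ∂lebUnit = ∫ p in Prod.snd ⁻¹' A, f p.1 ∂π := by
  have hfi := h.integrable_comp_fst hf
  obtain ⟨g₁, hg₁, h₁⟩ := h.exists_density_of_nonneg (F := fun u => ENNReal.ofReal (f u))
    hfi.lintegral_lt_top.ne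
  obtain ⟨g₂, hg₂, h₂⟩ := h.exists_density_of_nonneg (F := fun u => ENNReal.ofReal (-f u))
    hfi.neg.lintegral_lt_top.ne
  refine ⟨g₁ - g₂, hg₁.sub hg₂, fun A hA => ?_⟩
  rw [integral_eq_lintegral_pos_part_sub_lintegral_neg_part hfi.integrableOn, ← h₁ A hA,
    ← h₂ A hA]
  exact integral_sub hg₁.integrableOn hg₂.integrableOn

/-- The operator sends f to the density of the second marginal of f(p.1) dπ. The first marginal
bound gives the L1 contraction, the second gives the L∞ contraction. -/
theorem exists_substochastic (h : IsSubcoupling π) :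
    ∃ T : Lp ℝ 1 lebUnit →L[ℝ] Lp ℝ 1 lebUnit, IsSubstochastic T ∧
      ∀ (f : Lp ℝ 1 lebUnit) (A : Set ℝ), MeasurableSet A →
        ∫ v in A, T f v ∂lebUnit = ∫ p in Prod.snd ⁻¹' A, f p.1 ∂π := by
  have hπ := h.isFiniteMeasure
  have hex : ∀ f : Lp ℝ 1 lebUnit, ∃ g : Lp ℝ 1 lebUnit, ∀ A : Set ℝ, MeasurableSet A →
      ∫ v in A, g v ∂lebUnit = ∫ p in Prod.snd ⁻¹' A, f p.1 ∂π := by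
    intro f
    obtain ⟨g, hg, hgA⟩ := h.exists_density (L1.integrable_coeFn f)
    refine ⟨hg.toL1, fun A hA => ?_⟩
    rw [← hgA A hA]
    exact integral_congr_ae (ae_restrict_of_ae hg.coeFn_toL1)
  choose S hS using hex
  have huniq : ∀ g₁ g₂ : Lp ℝ 1 lebUnit, (∀ A : Set ℝ, MeasurableSet A →
      ∫ v in A, g₁ v ∂lebUnit = ∫ v in A, g₂ v ∂lebUnit) → g₁ = g₂ := fun g₁ g₂ H =>
    Lp.ext ((L1.integrable_coeFn g₁).ae_eq_of_forall_setIntegral_eq _ _ (L1.integrable_coeFn g₂)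
      fun A hA _ => H A hA)
  have hcomp : ∀ {f g : ℝ → ℝ}, f =ᵐ[lebUnit] g → (fun p : ℝ × ℝ => f p.1) =ᵐ[π] fun p => g p.1 :=
    fun hfg => h.quasiMeasurePreserving_fst.ae_eq_comp hfg
  have hadd : ∀ f g, S (f + g) = S f + S g := by
    intro f g
    refine huniq _ _ fun A hA => ?_
    rw [hS _ A hA, integral_congr_ae (ae_restrict_of_ae (Lp.coeFn_add (S f) (S g))),
      integral_congr_ae (ae_restrict_of_ae (hcomp (Lp.coeFn_add f g)))]
    simp only [Pi.add_apply]
    rw [integral_add (h.integrable_comp_fst (L1.integrable_coeFn f)).integrableOn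
      (h.integrable_comp_fst (L1.integrable_coeFn g)).integrableOn,
      integral_add (L1.integrable_coeFn _).integrableOn (L1.integrable_coeFn _).integrableOn,
      hS f A hA, hS g A hA]
  have hsmul : ∀ (c : ℝ) f, S (c • f) = c • S f := by
    intro c f
    refine huniq _ _ fun A hA => ?_
    rw [hS _ A hA, integral_congr_ae (ae_restrict_of_ae (Lp.coeFn_smul c (S f))),
      integral_congr_ae (ae_restrict_of_ae (hcomp (Lp.coeFn_smul c f)))]
    simp only [Pi.smul_apply]
    rw [integral_smul, integral_smul, hS f A hA]
  have hnorm : ∀ f, ‖S f‖ ≤ 1 * ‖f‖ := by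
    intro f
    rw [one_mul, L1.norm_eq_integral_norm, L1.norm_eq_integral_norm]
    refine le_trans ?_ (h.integral_norm_comp_fst_le (L1.integrable_coeFn f))
    have hfi := h.integrable_comp_fst (L1.integrable_coeFn f)
    -- On P and on its complement the modulus of Sf is ±Sf, so its integral can be computed through
    -- π.
    set P : Set ℝ := {v | 0 ≤ S f v} with hP
    have hPm : MeasurableSet P :=
      measurableSet_le measurable_const (Lp.stronglyMeasurable (S f)).measurable
    rw [← integral_add_compl hPm (L1.integrable_coeFn (S f)).norm,
      ← integral_add_compl (measurable_snd hPm : MeasurableSet (Prod.snd ⁻¹' P)) hfi.norm,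
      ← Set.preimage_compl]
    refine add_le_add ?_ ?_
    · rw [setIntegral_congr_fun (g := fun v => S f v) hPm
        fun v hv => Real.norm_of_nonneg hv, hS f P hPm]
      exact integral_mono hfi.integrableOn hfi.norm.integrableOn fun p => Real.le_norm_self _
    · rw [setIntegral_congr_fun (g := fun v => - S f v) hPm.compl
        fun v hv => Real.norm_of_nonpos (le_of_not_ge (show ¬ 0 ≤ S f v from hv)), integral_neg, hS f Pᶜ hPm.compl,
        ← integral_neg]
      exact integral_mono hfi.neg.integrableOn hfi.norm.integrableOn fun p => neg_le_abs _
  let T : Lp ℝ 1 lebUnit →L[ℝ] Lp ℝ 1 lebUnit :=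
    LinearMap.mkContinuous ⟨⟨S, hadd⟩, hsmul⟩ 1 hnorm
  -- This one-sided bound serves twice: applied to f and -f it gives the L∞ contraction, and applied
  -- to -f with C = 0 it gives positivity.
  have hle : ∀ (f : Lp ℝ 1 lebUnit) (C : ℝ), 0 ≤ C → (∀ᵐ u ∂lebUnit, f u ≤ C) →
      ∀ᵐ v ∂lebUnit, S f v ≤ C := by
    intro f C hC hf
    refine ae_le_of_forall_setIntegral_le (L1.integrable_coeFn _) (integrable_const C)
      fun A hA _ => ?_
    rw [hS f A hA]
    have h1 : ∫ p in Prod.snd ⁻¹' A, f p.1 ∂π ≤ ∫ p in Prod.snd ⁻¹' A, C ∂π :=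
      integral_mono_ae (h.integrable_comp_fst (L1.integrable_coeFn f)).integrableOn
        (integrable_const C) (ae_restrict_of_ae (h.quasiMeasurePreserving_fst.ae hf))
    refine h1.trans ?_
    rw [setIntegral_const, setIntegral_const, smul_eq_mul, smul_eq_mul]
    exact mul_le_mul_of_nonneg_right
      (ENNReal.toReal_mono (measure_ne_top _ _) (h.measure_snd_preimage_le hA)) hC
  have hneg : ∀ f, S (-f) = - S f := by
    intro f
    have := hsmul (-1) f
    simpa using this
  refine ⟨T, ⟨LinearMap.mkContinuous_norm_le _ zero_le_one _, fun f => ?_, fun f hf => ?_⟩, hS⟩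
  · rcases eq_or_ne (eLpNorm f ⊤ lebUnit) ⊤ with htop | htop
    · rw [htop]; exact le_top
    set C := (eLpNorm f ⊤ lebUnit).toReal with hC
    have hfC : ∀ᵐ u ∂lebUnit, ‖f u‖ ≤ C := by
      filter_upwards [ae_le_eLpNormEssSup (f := f) (μ := lebUnit)] with u hu
      rw [← toReal_enorm]
      refine ENNReal.toReal_mono htop ?_
      rwa [eLpNorm_exponent_top]
    have h1 := hle f C ENNReal.toReal_nonneg
      (hfC.mono fun u hu => (Real.le_norm_self _).trans hu)
    have h2 := hle (-f) C ENNReal.toReal_nonneg (by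
      filter_upwards [hfC, Lp.coeFn_neg f] with u hu hn
      rw [hn]; exact (neg_le_abs _).trans hu)
    rw [hneg] at h2
    rw [eLpNorm_exponent_top, ← ENNReal.ofReal_toReal htop, ← hC]
    refine eLpNormEssSup_le_of_ae_bound ?_
    filter_upwards [h1, h2, Lp.coeFn_neg (S f)] with v hv1 hv2 hv3
    rw [hv3] at hv2
    exact abs_le.2 ⟨neg_le.1 hv2, hv1⟩
  · have h2 := hle (-f) 0 le_rfl (by
      filter_upwards [(Lp.coeFn_nonneg f).2 hf, Lp.coeFn_neg f] with u hu hn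
      rw [hn]; simpa using hu)
    rw [hneg] at h2
    refine (Lp.coeFn_nonneg (S f)).1 ?_
    filter_upwards [h2, Lp.coeFn_neg (S f)] with v hv2 hv3
    rw [hv3] at hv2
    simpa using hv2

end IsSubcoupling

/-! ### Images under substochastic operators -/

/-- Some substochastic operator maps `X` to `Y`. -/
def SubstochasticImage (X Y : ℝ → ℝ≥0∞) : Prop :=
  ∃ T : Lp ℝ 1 lebUnit →L[ℝ] Lp ℝ 1 lebUnit, IsSubstochastic T ∧
    ∀ f g : Lp ℝ 1 lebUnit, f =ᵐ[lebUnit] (fun u => (X u).toReal) →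
      g =ᵐ[lebUnit] (fun u => (Y u).toReal) → T f = g

theorem IsSubstochastic.comp {T S : Lp ℝ 1 lebUnit →L[ℝ] Lp ℝ 1 lebUnit}
    (hT : IsSubstochastic T) (hS : IsSubstochastic S) : IsSubstochastic (T.comp S) where
  norm_le_one := (T.opNorm_comp_le S).trans
    (mul_le_one₀ hT.norm_le_one (norm_nonneg _) hS.norm_le_one)
  eLpNorm_top_le f := (hT.eLpNorm_top_le _).trans (hS.eLpNorm_top_le f)
  map_nonneg f hf := hT.map_nonneg _ (hS.map_nonneg f hf)

theorem SubstochasticImage.trans {X Y Z : ℝ → ℝ≥0∞} (hYm : Measurable Y)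
    (hY : ∫⁻ u, Y u ∂lebUnit ≠ ⊤) (h₁ : SubstochasticImage X Y) (h₂ : SubstochasticImage Y Z) :
    SubstochasticImage X Z := by
  obtain ⟨T, hT, hTXY⟩ := h₁
  obtain ⟨S, hS, hSYZ⟩ := h₂
  refine ⟨S.comp T, hS.comp hT, fun f g hf hg => ?_⟩
  have hi := integrable_toReal_of_lintegral_ne_top hYm.aemeasurable hY
  rw [ContinuousLinearMap.comp_apply, hTXY f hi.toL1 hf hi.coeFn_toL1]
  exact hSYZ _ _ hi.coeFn_toL1 hg

theorem IsSubcoupling.substochasticImage {π : Measure (ℝ × ℝ)} (h : IsSubcoupling π)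
    {X Y : ℝ → ℝ≥0∞} (hXm : Measurable X) (hX : ∫⁻ u, X u ∂lebUnit ≠ ⊤)
    (hYm : Measurable Y) (hY : ∫⁻ u, Y u ∂lebUnit ≠ ⊤)
    (hXY : ∀ A, MeasurableSet A →
      ∫⁻ p in Prod.snd ⁻¹' A, X p.1 ∂π = ∫⁻ v in A, Y v ∂lebUnit) :
    SubstochasticImage X Y := by
  obtain ⟨T, hT, hTA⟩ := h.exists_substochastic
  refine ⟨T, hT, fun f g hf hg => ?_⟩
  refine Lp.ext ((L1.integrable_coeFn _).ae_eq_of_forall_setIntegral_eq _ _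
    (L1.integrable_coeFn _) fun A hA _ => ?_)
  rw [hTA f A hA, integral_congr_ae (ae_restrict_of_ae hg),
    integral_congr_ae (f := fun p : ℝ × ℝ => f p.1)
      (ae_restrict_of_ae (h.quasiMeasurePreserving_fst.ae_eq_comp hf))]
  have hYfin : ∀ᵐ v ∂lebUnit, Y v < ⊤ := ae_lt_top hYm hY
  have hXfin : ∀ᵐ v ∂lebUnit, X v < ⊤ := ae_lt_top hXm hX
  rw [integral_toReal hYm.aemeasurable (ae_restrict_of_ae hYfin), ← hXY A hA]
  exact integral_toReal (hXm.comp measurable_fst).aemeasurable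
    (ae_restrict_of_ae (h.quasiMeasurePreserving_fst.ae hXfin))

/-! ### The coupling of two decreasing functions, one of which majorizes the other -/

/-- The measure with density the positive part of `X - Y`. -/
noncomputable def gapMeasure (X Y : ℝ → ℝ≥0∞) : Measure ℝ := lebUnit.withDensity (X - Y)

/-- Two decreasing integrable functions on `(0, 1)` with `Y` majorized by `X`. -/
structure IsMajorizedPair (X Y : ℝ → ℝ≥0∞) : Prop where
  antitone_left : Antitone X
  antitone_right : Antitone Y
  lintegral_eq : ∫⁻ u, X u ∂lebUnit = ∫⁻ u, Y u ∂lebUnit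
  lintegral_ne_top : ∫⁻ u, X u ∂lebUnit ≠ ⊤
  lintegral_Iic_le : ∀ t, ∫⁻ u in Set.Iic t, Y u ∂lebUnit ≤ ∫⁻ u in Set.Iic t, X u ∂lebUnit

/-- Both sides integrate max(X, Y); the additive form avoids subtraction in `ℝ≥0∞`. -/
theorem gapMeasure_add {X Y : ℝ → ℝ≥0∞} (hX : Measurable X) (hY : Measurable Y) {A : Set ℝ}
    (hA : MeasurableSet A) :
    gapMeasure X Y A + ∫⁻ u in A, Y u ∂lebUnit = gapMeasure Y X A + ∫⁻ u in A, X u ∂lebUnit := by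
  rw [gapMeasure, gapMeasure, withDensity_apply _ hA, withDensity_apply _ hA,
    ← lintegral_add_right _ hY, ← lintegral_add_right _ hX]
  refine lintegral_congr fun u => ?_
  simp only [Pi.sub_apply]
  rw [tsub_add_eq_max, tsub_add_eq_max, max_comm]

theorem gapMeasure_compl (X Y : ℝ → ℝ≥0∞) : gapMeasure X Y (Set.Ioo 0 1)ᶜ = 0 := by
  refine withDensity_absolutelyContinuous _ _ ?_
  rw [lebUnit, Measure.restrict_apply measurableSet_Ioo.compl]
  simp

theorem isFiniteMeasure_gapMeasure {X Y : ℝ → ℝ≥0∞} (h : ∫⁻ u, X u ∂lebUnit ≠ ⊤) :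
    IsFiniteMeasure (gapMeasure X Y) :=
  isFiniteMeasure_withDensity
    (ne_top_of_le_ne_top h (lintegral_mono fun _ => tsub_le_self))

theorem ae_gapMeasure_lt {X Y : ℝ → ℝ≥0∞} (hX : Measurable X) (hY : Measurable Y) :
    ∀ᵐ u ∂gapMeasure X Y, Y u < X u := by
  rw [gapMeasure, ae_withDensity_iff (hX.sub hY)]
  refine Eventually.of_forall fun u hu => ?_
  by_contra! h
  exact hu (tsub_eq_zero_of_le h)

namespace IsMajorizedPair

variable {X Y : ℝ → ℝ≥0∞}

theorem gapMeasure_Iic_le (h : IsMajorizedPair X Y) (t : ℝ) :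
    gapMeasure Y X (Set.Iic t) ≤ gapMeasure X Y (Set.Iic t) := by
  have h1 := gapMeasure_add h.antitone_left.measurable h.antitone_right.measurable
    (measurableSet_Iic (a := t))
  have hfin : ∫⁻ u in Set.Iic t, X u ∂lebUnit ≠ ⊤ :=
    ne_top_of_le_ne_top h.lintegral_ne_top (setLIntegral_le_lintegral _ _)
  refine (ENNReal.add_le_add_iff_right hfin).1 ?_
  rw [← h1]
  exact add_le_add le_rfl (h.lintegral_Iic_le t)

theorem gapMeasure_univ_eq (h : IsMajorizedPair X Y) :
    gapMeasure Y X Set.univ = gapMeasure X Y Set.univ := by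
  have h1 := gapMeasure_add h.antitone_left.measurable h.antitone_right.measurable
    MeasurableSet.univ
  simp only [Measure.restrict_univ] at h1
  rw [← h.lintegral_eq] at h1
  exact ((ENNReal.add_left_inj h.lintegral_ne_top).1 h1).symm

/-- The index space of the matching between the two gaps. -/
noncomputable def indexMeasure (X Y : ℝ → ℝ≥0∞) : Measure ℝ :=
  volume.restrict (Set.Ioo 0 (gapMeasure X Y Set.univ).toReal)

theorem map_left (h : IsMajorizedPair X Y) :
    (indexMeasure X Y).map (quantile (gapMeasure X Y)) = gapMeasure X Y := by
  have := isFiniteMeasure_gapMeasure (Y := Y) h.lintegral_ne_top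
  exact map_quantile (gapMeasure_compl X Y)

theorem map_right (h : IsMajorizedPair X Y) :
    (indexMeasure X Y).map (quantile (gapMeasure Y X)) = gapMeasure Y X := by
  have := isFiniteMeasure_gapMeasure (Y := X) (h.lintegral_eq ▸ h.lintegral_ne_top)
  rw [indexMeasure, ← h.gapMeasure_univ_eq]
  exact map_quantile (gapMeasure_compl Y X)

theorem ae_left (h : IsMajorizedPair X Y) {p : ℝ → Prop} (hp : ∀ᵐ u ∂gapMeasure X Y, p u) :
    ∀ᵐ w ∂indexMeasure X Y, p (quantile (gapMeasure X Y) w) := by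
  rw [← h.map_left] at hp
  exact ae_of_ae_map (measurable_quantile _).aemeasurable hp

theorem ae_right (h : IsMajorizedPair X Y) {p : ℝ → Prop} (hp : ∀ᵐ u ∂gapMeasure Y X, p u) :
    ∀ᵐ w ∂indexMeasure X Y, p (quantile (gapMeasure Y X) w) := by
  rw [← h.map_right] at hp
  exact ae_of_ae_map (measurable_quantile _).aemeasurable hp

theorem ae_lt_top_left (h : IsMajorizedPair X Y) :
    ∀ᵐ w ∂indexMeasure X Y, X (quantile (gapMeasure X Y) w) < ⊤ :=
  h.ae_left ((withDensity_absolutelyContinuous _ _).ae_le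
    (ae_lt_top h.antitone_left.measurable h.lintegral_ne_top))

/-- Write a(w) for the matched point where X exceeds Y and b(w) for the one where Y exceeds X.
Majorization puts a(w) to the left of b(w), so Y(b) ≤ Y(a) by monotonicity. The strict outer
inequalities are the slack behind the midpoint argument. -/
theorem ae_chain (h : IsMajorizedPair X Y) : ∀ᵐ w ∂indexMeasure X Y,
    X (quantile (gapMeasure Y X) w) < Y (quantile (gapMeasure Y X) w) ∧
    Y (quantile (gapMeasure Y X) w) ≤ Y (quantile (gapMeasure X Y) w) ∧
    Y (quantile (gapMeasure X Y) w) < X (quantile (gapMeasure X Y) w) := by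
  filter_upwards [h.ae_left (ae_gapMeasure_lt h.antitone_left.measurable
      h.antitone_right.measurable), h.ae_right (ae_gapMeasure_lt h.antitone_right.measurable
      h.antitone_left.measurable)] with w h1 h2
  exact ⟨h2, h.antitone_right (quantile_le_quantile h.gapMeasure_Iic_le w), h1⟩

/-- The difference of the values of `X` at two matched points. -/
noncomputable def drop (X Y : ℝ → ℝ≥0∞) (w : ℝ) : ℝ≥0∞ :=
  X (quantile (gapMeasure X Y) w) - X (quantile (gapMeasure Y X) w)

theorem ae_drop (h : IsMajorizedPair X Y) :
    ∀ᵐ w ∂indexMeasure X Y, drop X Y w ≠ 0 ∧ drop X Y w ≠ ⊤ := by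
  filter_upwards [h.ae_chain, h.ae_lt_top_left] with w h1 h2
  refine ⟨?_, ne_top_of_le_ne_top h2.ne tsub_le_self⟩
  rw [drop]
  exact (tsub_pos_of_lt (h1.1.trans_le (h1.2.1.trans h1.2.2.le))).ne'

theorem measurable_drop (h : IsMajorizedPair X Y) : Measurable (drop X Y) :=
  (h.antitone_left.measurable.comp (measurable_quantile _)).sub
    (h.antitone_left.measurable.comp (measurable_quantile _))

/-- The image of ω under a has density (X - Y)⁺, so weighting by c/δ yields density at most 1 as
soon as c(X - Y) ≤ δ. Thus an exchange of this size never uses more mass than is available. -/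
theorem map_withDensity_le {X Y : ℝ → ℝ≥0∞} (hX : Measurable X) (hY : Measurable Y)
    {ω : Measure ℝ} {a : ℝ → ℝ} (ha : Measurable a) (hω : ω.map a = gapMeasure X Y)
    {c δ : ℝ → ℝ≥0∞} (hcδ : ∀ᵐ w ∂ω, c w * (X (a w) - Y (a w)) ≤ δ w) :
    (ω.withDensity fun w => c w * (δ w)⁻¹).map a ≤ lebUnit.restrict {u | Y u < X u} := by
  refine Measure.le_iff.2 fun A hA => ?_
  rw [Measure.map_apply ha hA, withDensity_apply _ (ha hA), Measure.restrict_apply hA]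
  have hinv : Measurable fun u => (X u - Y u)⁻¹ := (hX.sub hY).inv
  calc ∫⁻ w in a ⁻¹' A, c w * (δ w)⁻¹ ∂ω ≤ ∫⁻ w in a ⁻¹' A, (X (a w) - Y (a w))⁻¹ ∂ω := by
        refine lintegral_mono_ae (ae_restrict_of_ae ?_)
        filter_upwards [hcδ] with w h2
        rw [ENNReal.le_inv_iff_mul_le, mul_right_comm]
        exact (mul_le_mul_left h2 _).trans (ENNReal.mul_inv_le_one _)
    _ = ∫⁻ u in A, (X u - Y u)⁻¹ ∂gapMeasure X Y := by
        rw [← hω, setLIntegral_map hA hinv ha]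
    _ ≤ _ := by
        rw [gapMeasure, setLIntegral_withDensity_eq_setLIntegral_mul _ (f := X - Y) (hX.sub hY) hinv hA]
        have hm : MeasurableSet {u | Y u < X u} := measurableSet_lt hY hX
        calc _ ≤ ∫⁻ u in A, Set.indicator {u | Y u < X u} 1 u ∂lebUnit := by
              refine lintegral_mono fun u => ?_
              simp only [Pi.mul_apply, Pi.sub_apply]
              by_cases hu : Y u < X u
              · simp only [Set.indicator, Set.mem_ofPred_eq, hu, if_true, Pi.one_apply]
                exact ENNReal.mul_inv_le_one _
              · rw [tsub_eq_zero_of_le (not_lt.1 hu), zero_mul]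
                exact zero_le
          _ = _ := by
              rw [lintegral_indicator_one hm, Measure.restrict_apply hm, Set.inter_comm]

/-- Exchange mass c(w)/δ(w) between the matched points a(w) and b(w), with δ = X(a) - X(b). Each
exchange transfers an amount c(w) of the integral of X from a(w) to b(w). The identity is written
additively, with the loss at a on the left and the gain at b on the right. -/
theorem exists_coupling (h : IsMajorizedPair X Y) {c : ℝ → ℝ≥0∞} (hc : Measurable c)
    (h₁ : ∀ᵐ w ∂indexMeasure X Y, c w * (X (quantile (gapMeasure X Y) w) -
      Y (quantile (gapMeasure X Y) w)) ≤ drop X Y w)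
    (h₂ : ∀ᵐ w ∂indexMeasure X Y, c w * (Y (quantile (gapMeasure Y X) w) -
      X (quantile (gapMeasure Y X) w)) ≤ drop X Y w) :
    ∃ π : Measure (ℝ × ℝ), π.map Prod.fst = lebUnit ∧ π.map Prod.snd = lebUnit ∧
      ∀ A, MeasurableSet A → ∫⁻ p in Prod.snd ⁻¹' A, X p.1 ∂π +
          ∫⁻ w in quantile (gapMeasure X Y) ⁻¹' A, c w ∂indexMeasure X Y =
        ∫⁻ u in A, X u ∂lebUnit +
          ∫⁻ w in quantile (gapMeasure Y X) ⁻¹' A, c w ∂indexMeasure X Y := by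
  have hX := h.antitone_left.measurable
  have hY := h.antitone_right.measurable
  have hle1 := map_withDensity_le hX hY (measurable_quantile _) h.map_left h₁
  have hle2 := map_withDensity_le hY hX (measurable_quantile _) h.map_right h₂
  set ω := indexMeasure X Y with hω
  set a := quantile (gapMeasure X Y) with ha
  set b := quantile (gapMeasure Y X) with hb
  have ham : Measurable a := measurable_quantile _
  have hbm : Measurable b := measurable_quantile _
  set δ := drop X Y with hδ
  have hδm : Measurable δ := h.measurable_drop
  set η := ω.withDensity fun w => c w * (δ w)⁻¹ with hη
  have hcδm : Measurable fun w => c w * (δ w)⁻¹ := hc.mul hδm.inv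
  have hsum : η.map a + η.map b ≤ lebUnit := by
    refine (add_le_add hle1 hle2).trans ?_
    rw [← Measure.restrict_union _ (measurableSet_lt hX hY)]
    · exact Measure.restrict_le_self
    · exact Set.disjoint_left.2 fun u hu hu' => lt_asymm (α := ℝ≥0∞) hu hu'
  have hfin : IsFiniteMeasure (η.map a + η.map b) := isFiniteMeasure_of_le _ hsum
  -- The mass that takes no part in the exchange stays on the diagonal.
  set D := lebUnit - (η.map a + η.map b) with hD
  have hDadd : D + (η.map a + η.map b) = lebUnit := Measure.sub_add_cancel_of_le hsum
  have hdiag : Measurable fun u : ℝ => (u, u) := measurable_id.prodMk measurable_id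
  have hba : Measurable fun w => (b w, a w) := hbm.prodMk ham
  have hab : Measurable fun w => (a w, b w) := ham.prodMk hbm
  refine ⟨D.map (fun u => (u, u)) + (η.map (fun w => (b w, a w)) + η.map (fun w => (a w, b w))),
    ?_, ?_, fun A hA => ?_⟩
  · rw [Measure.map_add _ _ measurable_fst, Measure.map_add _ _ measurable_fst,
      Measure.map_map measurable_fst hdiag, Measure.map_map measurable_fst hba,
      Measure.map_map measurable_fst hab]
    conv_rhs => rw [← hDadd, add_comm (η.map a)]
    congr 1
    exact Measure.map_id
  · rw [Measure.map_add _ _ measurable_snd, Measure.map_add _ _ measurable_snd,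
      Measure.map_map measurable_snd hdiag, Measure.map_map measurable_snd hba,
      Measure.map_map measurable_snd hab]
    conv_rhs => rw [← hDadd]
    congr 1
    exact Measure.map_id
  · have hs : MeasurableSet (Prod.snd ⁻¹' A : Set (ℝ × ℝ)) := measurable_snd hA
    have hXf : Measurable fun p : ℝ × ℝ => X p.1 := hX.comp measurable_fst
    -- Replacing X(b) by X(a) gains δ per unit of η, and η has density c/δ, so the gain is c.
    have hsplit : ∀ S : Set ℝ, MeasurableSet S →
        ∫⁻ w in S, X (a w) ∂η = ∫⁻ w in S, X (b w) ∂η + ∫⁻ w in S, c w ∂ω := by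
      intro S hS
      have h3 : ∀ᵐ w ∂ω, X (a w) = X (b w) + δ w := by
        filter_upwards [h.ae_chain] with w hw
        exact (add_tsub_cancel_of_le (hw.1.le.trans (hw.2.1.trans hw.2.2.le))).symm
      have h4 : ∫⁻ w in S, X (a w) ∂η = ∫⁻ w in S, (X (b w) + δ w) ∂η :=
        lintegral_congr_ae (ae_restrict_of_ae ((withDensity_absolutelyContinuous _ _).ae_le h3))
      rw [h4, lintegral_add_right _ hδm]
      congr 1
      rw [hη, setLIntegral_withDensity_eq_setLIntegral_mul _ hcδm hδm hS]
      refine lintegral_congr_ae (ae_restrict_of_ae ?_)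
      filter_upwards [h.ae_drop] with w hw
      simp only [Pi.mul_apply]
      rw [mul_assoc, ENNReal.inv_mul_cancel hw.1 hw.2, mul_one]
    have e1 : ∫⁻ p in Prod.snd ⁻¹' A, X p.1 ∂(D.map (fun u => (u, u)) +
        (η.map (fun w => (b w, a w)) + η.map (fun w => (a w, b w)))) =
        ∫⁻ u in A, X u ∂D + (∫⁻ w in a ⁻¹' A, X (b w) ∂η + ∫⁻ w in b ⁻¹' A, X (a w) ∂η) := by
      rw [Measure.restrict_add, Measure.restrict_add, lintegral_add_measure,
        lintegral_add_measure, setLIntegral_map hs hXf hdiag, setLIntegral_map hs hXf hba,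
        setLIntegral_map hs hXf hab]
      rfl
    have e2 : ∫⁻ u in A, X u ∂lebUnit =
        ∫⁻ u in A, X u ∂D + (∫⁻ w in a ⁻¹' A, X (a w) ∂η + ∫⁻ w in b ⁻¹' A, X (b w) ∂η) := by
      conv_lhs => rw [← hDadd]
      rw [Measure.restrict_add, Measure.restrict_add, lintegral_add_measure,
        lintegral_add_measure, setLIntegral_map hA hX ham, setLIntegral_map hA hX hbm]
    rw [e1, e2, hsplit _ (ham hA), hsplit _ (hbm hA)]
    ring

end IsMajorizedPair

theorem ennreal_div_mul_le (a b : ℝ≥0∞) : a / b * b ≤ a := by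
  rw [div_eq_mul_inv, mul_assoc, mul_comm b⁻¹]
  exact mul_le_of_le_one_right' (ENNReal.mul_inv_le_one b)

theorem isSubcoupling_of_map_eq {π : Measure (ℝ × ℝ)} (h₁ : π.map Prod.fst = lebUnit)
    (h₂ : π.map Prod.snd = lebUnit) : IsSubcoupling π := ⟨h₁.le, h₂.le⟩

namespace IsMajorizedPair

variable {X Y : ℝ → ℝ≥0∞}

theorem gapMeasure_ne_top (h : IsMajorizedPair X Y) (A : Set ℝ) : gapMeasure X Y A ≠ ⊤ := by
  have := isFiniteMeasure_gapMeasure (Y := Y) h.lintegral_ne_top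
  exact measure_ne_top _ _

theorem indexMeasure_preimage_left (h : IsMajorizedPair X Y) {A : Set ℝ} (hA : MeasurableSet A) :
    indexMeasure X Y (quantile (gapMeasure X Y) ⁻¹' A) = gapMeasure X Y A := by
  rw [← Measure.map_apply (measurable_quantile _) hA, h.map_left]

theorem indexMeasure_preimage_right (h : IsMajorizedPair X Y) {A : Set ℝ} (hA : MeasurableSet A) :
    indexMeasure X Y (quantile (gapMeasure Y X) ⁻¹' A) = gapMeasure Y X A := by
  rw [← Measure.map_apply (measurable_quantile _) hA, h.map_right]

/-- `Y` is the image of `X` under a doubly stochastic coupling. -/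
theorem exists_coupling_eq (h : IsMajorizedPair X Y) :
    ∃ π : Measure (ℝ × ℝ), π.map Prod.fst = lebUnit ∧ π.map Prod.snd = lebUnit ∧
      ∀ A, MeasurableSet A → ∫⁻ p in Prod.snd ⁻¹' A, X p.1 ∂π = ∫⁻ u in A, Y u ∂lebUnit := by
  -- With c = 1 the transfer is exactly the gap between X and Y; it is admissible because X(b) ≤
  -- Y(a) and Y(b) ≤ X(a).
  obtain ⟨π, h1, h2, h3⟩ := h.exists_coupling (c := fun _ => 1) measurable_const
    (by
      filter_upwards [h.ae_chain] with w hw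
      rw [one_mul]
      exact tsub_le_tsub_left (hw.1.le.trans hw.2.1) _)
    (by
      filter_upwards [h.ae_chain] with w hw
      rw [one_mul]
      exact tsub_le_tsub_right (hw.2.1.trans hw.2.2.le) _)
  refine ⟨π, h1, h2, fun A hA => ?_⟩
  have h4 := h3 A hA
  simp only [lintegral_const, one_mul, Measure.restrict_apply_univ] at h4
  rw [h.indexMeasure_preimage_left hA, h.indexMeasure_preimage_right hA, add_comm (∫⁻ u in A, _ ∂_),
    ← gapMeasure_add h.antitone_left.measurable h.antitone_right.measurable hA,
    add_comm (gapMeasure X Y A)] at h4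
  exact (ENNReal.add_left_inj (h.gapMeasure_ne_top A)).1 h4

theorem substochasticImage (h : IsMajorizedPair X Y) : SubstochasticImage X Y := by
  obtain ⟨π, h1, h2, h3⟩ := h.exists_coupling_eq
  exact (isSubcoupling_of_map_eq h1 h2).substochasticImage h.antitone_left.measurable
    h.lintegral_ne_top h.antitone_right.measurable (h.lintegral_eq ▸ h.lintegral_ne_top) h3

theorem ae_eq_of_indexMeasure_eq_zero (h : IsMajorizedPair X Y) (h0 : indexMeasure X Y = 0) :
    X =ᵐ[lebUnit] Y := by
  have hX := h.antitone_left.measurable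
  have hY := h.antitone_right.measurable
  have key : ∀ {U V : ℝ → ℝ≥0∞}, Measurable U → Measurable V → gapMeasure U V = 0 →
      ∀ᵐ u ∂lebUnit, U u ≤ V u := by
    intro U V hU hV hUV
    have h1 := withDensity_eq_zero (hU.sub hV).aemeasurable hUV
    filter_upwards [h1] with u hu
    exact tsub_eq_zero_iff_le.1 hu
  have h1 : gapMeasure X Y = 0 := by rw [← h.map_left, h0, Measure.map_zero]
  have h2 : gapMeasure Y X = 0 := by rw [← h.map_right, h0, Measure.map_zero]
  filter_upwards [key hX hY h1, key hY hX h2] with u h3 h4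
  exact le_antisymm h3 h4

/-- Unless `X = Y`, the function `Y` is a proper midpoint of two images of `X`. -/
theorem exists_midpoint (h : IsMajorizedPair X Y) (hne : ¬ X =ᵐ[lebUnit] Y) :
    ∃ Z₁ Z₂ : ℝ → ℝ≥0∞, Measurable Z₁ ∧ Measurable Z₂ ∧
      ∫⁻ u, Z₁ u ∂lebUnit ≠ ⊤ ∧ ∫⁻ u, Z₂ u ∂lebUnit ≠ ⊤ ∧
      SubstochasticImage X Z₁ ∧ SubstochasticImage X Z₂ ∧
      (∀ᵐ u ∂lebUnit, Z₁ u + Z₂ u = Y u + Y u) ∧ ¬ Z₁ =ᵐ[lebUnit] Y := by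
  have hX := h.antitone_left.measurable
  have hY := h.antitone_right.measurable
  set ω := indexMeasure X Y with hω
  set a := quantile (gapMeasure X Y) with ha
  set b := quantile (gapMeasure Y X) with hb
  have ham : Measurable a := measurable_quantile _
  have hbm : Measurable b := measurable_quantile _
  set δ := drop X Y with hδ
  have hδm : Measurable δ := h.measurable_drop
  -- The two quotients are the largest transfers allowed by `exists_coupling`. The cap 2 ensures
  -- that c and 2 - c add up to 2, so the two resulting images average to Y.
  let c : ℝ → ℝ≥0∞ := fun w => min 2 (min (δ w / (X (a w) - Y (a w))) (δ w / (Y (b w) - X (b w))))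
  have hc : Measurable c := measurable_const.min ((hδm.div ((hX.comp ham).sub (hY.comp ham))).min
    (hδm.div ((hY.comp hbm).sub (hX.comp hbm))))
  have hc2 : ∀ w, c w ≤ 2 := fun w => min_le_left _ _
  have hδ1 : ∀ᵐ w ∂ω, X (a w) - Y (a w) < δ w ∧ Y (b w) - X (b w) < δ w := by
    filter_upwards [h.ae_chain, h.ae_lt_top_left] with w hw ht
    have hYa : Y (a w) ≠ ⊤ := (hw.2.2.trans ht).ne
    have hXb : X (b w) ≠ ⊤ := (hw.1.trans_le (hw.2.1.trans hw.2.2.le)).trans ht |>.ne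
    constructor
    · exact ENNReal.sub_lt_of_sub_lt (hw.2.2.le) (Or.inl ht.ne) (by
        rw [hδ, drop, ENNReal.sub_sub_cancel ht.ne
          (hw.1.le.trans (hw.2.1.trans hw.2.2.le))]
        exact hw.1.trans_le hw.2.1)
    · exact ((ENNReal.cancel_of_ne hXb).tsub_lt_tsub_iff_right hw.1.le).2 (hw.2.1.trans_lt hw.2.2)
  -- Strictness of the chain leaves room for transferring more than the gap.
  have hc1 : ∀ᵐ w ∂ω, 1 < c w := by
    filter_upwards [hδ1, h.ae_chain] with w hw hw'
    have e1 : X (a w) - Y (a w) ≠ 0 := (tsub_pos_of_lt hw'.2.2).ne'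
    have e2 : Y (b w) - X (b w) ≠ 0 := (tsub_pos_of_lt hw'.1).ne'
    refine lt_min ENNReal.one_lt_two (lt_min ?_ ?_)
    · rw [ENNReal.lt_div_iff_mul_lt (Or.inl e1) (Or.inr one_ne_zero), one_mul]; exact hw.1
    · rw [ENNReal.lt_div_iff_mul_lt (Or.inl e2) (Or.inr one_ne_zero), one_mul]; exact hw.2
  obtain ⟨π₁, hf₁, hs₁, h₁⟩ := h.exists_coupling hc
    (Eventually.of_forall fun w => (mul_le_mul_left
      ((min_le_right _ _).trans (min_le_left _ _)) _).trans (ennreal_div_mul_le _ _))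
    (Eventually.of_forall fun w => (mul_le_mul_left
      ((min_le_right _ _).trans (min_le_right _ _)) _).trans (ennreal_div_mul_le _ _))
  have hc21 : ∀ᵐ w ∂ω, 2 - c w ≤ 1 := by
    filter_upwards [hc1] with w hw
    rw [tsub_le_iff_left, ← one_add_one_eq_two]
    exact add_le_add hw.le le_rfl
  obtain ⟨π₂, hf₂, hs₂, h₂⟩ := h.exists_coupling (c := fun w => 2 - c w) (measurable_const.sub hc)
    (by
      filter_upwards [hc21, hδ1] with w hw hw'
      exact (mul_le_mul_left hw _).trans ((one_mul _).trans_le hw'.1.le))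
    (by
      filter_upwards [hc21, hδ1] with w hw hw'
      exact (mul_le_mul_left hw _).trans ((one_mul _).trans_le hw'.2.le))
  have hπ₁ := isSubcoupling_of_map_eq hf₁ hs₁
  have hπ₂ := isSubcoupling_of_map_eq hf₂ hs₂
  have hfin : ∀ π : Measure (ℝ × ℝ), π.map Prod.fst = lebUnit → ∫⁻ p, X p.1 ∂π ≠ ⊤ := by
    intro π hπ
    rw [← lintegral_map hX measurable_fst, hπ]
    exact h.lintegral_ne_top
  obtain ⟨Z₁, hZ₁, hA₁⟩ := hπ₁.exists_lintegral_density (hfin π₁ hf₁)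
  obtain ⟨Z₂, hZ₂, hA₂⟩ := hπ₂.exists_lintegral_density (hfin π₂ hf₂)
  have hZfin : ∀ (π : Measure (ℝ × ℝ)) (Z : ℝ → ℝ≥0∞), π.map Prod.fst = lebUnit →
      (∀ A, MeasurableSet A → ∫⁻ p in Prod.snd ⁻¹' A, X p.1 ∂π = ∫⁻ v in A, Z v ∂lebUnit) →
      ∫⁻ u, Z u ∂lebUnit ≠ ⊤ := by
    intro π Z hπ hZ
    have := hZ Set.univ .univ
    simp only [Set.preimage_univ, Measure.restrict_univ] at this
    rw [← this]
    exact hfin π hπ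
  have hZf₁ := hZfin π₁ Z₁ hf₁ hA₁
  have hZf₂ := hZfin π₂ Z₂ hf₂ hA₂
  refine ⟨Z₁, Z₂, hZ₁, hZ₂, hZf₁, hZf₂,
    hπ₁.substochasticImage hX h.lintegral_ne_top hZ₁ hZf₁ hA₁,
    hπ₂.substochasticImage hX h.lintegral_ne_top hZ₂ hZf₂ hA₂, ?_, ?_⟩
  · refine ae_eq_of_forall_setLIntegral_eq_of_sigmaFinite (hZ₁.add hZ₂) (hY.add hY)
      fun A hA _ => ?_
    rw [lintegral_add_left hZ₁, lintegral_add_left hY, ← hA₁ A hA, ← hA₂ A hA]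
    have key : ∀ S : Set ℝ, MeasurableSet S →
        ∫⁻ w in S, c w ∂ω + ∫⁻ w in S, (2 - c w) ∂ω = ω S + ω S := by
      intro S hS
      rw [← lintegral_add_left hc, lintegral_congr fun w => add_tsub_cancel_of_le (hc2 w),
        lintegral_const, Measure.restrict_apply_univ, two_mul]
    have e1 := key _ (ham hA)
    have e2 := key _ (hbm hA)
    rw [h.indexMeasure_preimage_left hA] at e1
    rw [h.indexMeasure_preimage_right hA] at e2
    have e3 := gapMeasure_add hX hY hA
    have e4 := h₁ A hA
    have e5 := h₂ A hA
    have hgf : gapMeasure X Y A + gapMeasure X Y A ≠ ⊤ :=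
      ENNReal.add_ne_top.2 ⟨h.gapMeasure_ne_top A, h.gapMeasure_ne_top A⟩
    refine (ENNReal.add_left_inj hgf).1 ?_
    calc _ = (∫⁻ p in Prod.snd ⁻¹' A, X p.1 ∂π₁ + ∫⁻ w in a ⁻¹' A, c w ∂ω) +
          (∫⁻ p in Prod.snd ⁻¹' A, X p.1 ∂π₂ + ∫⁻ w in a ⁻¹' A, (2 - c w) ∂ω) := by
          rw [← e1]; ring
      _ = (∫⁻ u in A, X u ∂lebUnit + ∫⁻ u in A, X u ∂lebUnit) +
          (∫⁻ w in b ⁻¹' A, c w ∂ω + ∫⁻ w in b ⁻¹' A, (2 - c w) ∂ω) := by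
          rw [e4, e5]; ring
      _ = (gapMeasure Y X A + ∫⁻ u in A, X u ∂lebUnit) +
          (gapMeasure Y X A + ∫⁻ u in A, X u ∂lebUnit) := by rw [e2]; ring
      _ = _ := by rw [← e3]; ring
  · intro hZY
    apply hne
    apply h.ae_eq_of_indexMeasure_eq_zero
    -- Almost every a(w) lies in A and almost no b(w) does. If Z₁ = Y, comparing integrals over A
    -- makes the total transfer ∫c equal to the total mass of ω; as c > 1 a.e., ω must vanish.
    set A := {u | Y u < X u} with hA
    have hAm : MeasurableSet A := measurableSet_lt hY hX
    have hbA : ω (b ⁻¹' A) = 0 := by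
      rw [h.indexMeasure_preimage_right hAm]
      have := ae_gapMeasure_lt hY hX
      refine measure_mono_null (fun u hu => ?_) (ae_iff.1 this)
      exact not_lt.2 (le_of_lt hu)
    have haA : ∀ᵐ w ∂ω, w ∈ a ⁻¹' A := by
      filter_upwards [h.ae_chain] with w hw
      exact hw.2.2
    have hau : ω (a ⁻¹' A) = ω Set.univ := measure_congr (eventuallyEq_univ.2 haA)
    have e4 := h₁ A hAm
    have e3 := gapMeasure_add hX hY hAm
    rw [← h.indexMeasure_preimage_right hAm, ← h.indexMeasure_preimage_left hAm, hbA, zero_add]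
      at e3
    rw [setLIntegral_measure_zero _ _ hbA, add_zero, hA₁ A hAm,
      lintegral_congr_ae (ae_restrict_of_ae hZY), ← e3, add_comm] at e4
    have hYf : ∫⁻ u in A, Y u ∂lebUnit ≠ ⊤ := ne_top_of_le_ne_top
      (h.lintegral_eq ▸ h.lintegral_ne_top) (setLIntegral_le_lintegral _ _)
    have e5 := (ENNReal.add_left_inj hYf).1 e4
    rw [Measure.restrict_eq_self_of_ae_mem haA, ← hω, ← ha, hau] at e5
    have hωf : ω Set.univ ≠ ⊤ := by
      rw [← hau, h.indexMeasure_preimage_left hAm]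
      exact h.gapMeasure_ne_top A
    have e6 : (fun _ => (1 : ℝ≥0∞)) =ᵐ[ω] c :=
      ae_eq_of_ae_le_of_lintegral_le (hc1.mono fun w hw => hw.le) (by simpa using hωf)
        hc.aemeasurable (by simp [e5])
    have e7 : ∀ᵐ w ∂ω, False := by
      filter_upwards [e6, hc1] with w hw hw'
      exact absurd hw hw'.ne
    exact ae_eq_bot.1 (eventually_false_iff_eq_bot.1 e7)

end IsMajorizedPair

/-- The coupling is carried by the graph of τ. -/
theorem substochasticImage_comp {τ : ℝ → ℝ} (hτ : MeasurePreserving τ lebUnit lebUnit)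
    {Z : ℝ → ℝ≥0∞} (hZm : Measurable Z) (hZ : ∫⁻ u, Z u ∂lebUnit ≠ ⊤) :
    SubstochasticImage Z (Z ∘ τ) := by
  have hm : Measurable fun u => (τ u, u) := hτ.measurable.prodMk measurable_id
  have hπ : IsSubcoupling (lebUnit.map fun u => (τ u, u)) := by
    refine isSubcoupling_of_map_eq ?_ ?_
    · rw [Measure.map_map measurable_fst hm]
      exact hτ.map_eq
    · rw [Measure.map_map measurable_snd hm]
      exact Measure.map_id
  refine hπ.substochasticImage hZm hZ (hZm.comp hτ.measurable) ?_ fun A hA => ?_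
  · simp only [Function.comp_apply]
    rwa [hτ.lintegral_comp hZm]
  · rw [setLIntegral_map (f := fun p : ℝ × ℝ => Z p.1) (measurable_snd hA)
      (hZm.comp measurable_fst) hm]
    rfl

/-- By Ryff's theorem, pushing g forward along its sorting map recovers g*. Keeping only the
preimage of B truncates g* to B, at the price of marginals smaller than Lebesgue measure. -/
theorem substochasticImage_indicator_decRearr {g : ℝ → ℝ≥0∞} (hg : Measurable g)
    (hfin : ∫⁻ u, g u ∂lebUnit ≠ ⊤) {B : Set ℝ} (hB : MeasurableSet B) :
    SubstochasticImage g (B.indicator (decRearr lebUnit g)) := by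
  have hτ := measurePreserving_ryffMap hg
  set τ := ryffMap g
  have hm : Measurable fun u => (u, τ u) := measurable_id.prodMk hτ.measurable
  have hX := measurable_decRearr lebUnit g
  have hπ : IsSubcoupling ((lebUnit.restrict (τ ⁻¹' B)).map fun u => (u, τ u)) := by
    refine ⟨?_, ?_⟩
    · rw [Measure.map_map measurable_fst hm]
      exact (Measure.map_id (μ := lebUnit.restrict (τ ⁻¹' B))).trans_le Measure.restrict_le_self
    · rw [Measure.map_map measurable_snd hm]
      exact (Measure.map_mono Measure.restrict_le_self hτ.measurable).trans hτ.map_eq.le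
  refine hπ.substochasticImage hg hfin (hX.indicator hB) ?_ fun A hA => ?_
  · refine ne_top_of_le_ne_top hfin ?_
    rw [← lintegral_decRearr hg]
    exact lintegral_mono fun u => Set.indicator_le_self _ _ _
  · rw [setLIntegral_map (f := fun p : ℝ × ℝ => g p.1) (measurable_snd hA)
      (hg.comp measurable_fst) hm,
      Measure.restrict_restrict (hm (measurable_snd hA)), setLIntegral_indicator hB,
      ← hτ.setLIntegral_comp_preimage (hB.inter hA) hX]
    have : (fun u => (u, τ u)) ⁻¹' (Prod.snd ⁻¹' A) ∩ τ ⁻¹' B = τ ⁻¹' (B ∩ A) := by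
      ext u; simp [and_comm]
    rw [this]
    exact lintegral_congr_ae (ae_restrict_of_ae (decRearr_ryffMap hg hfin).symm)

/-! ### The orbit of a function and its extreme points -/

/-- The absolute value of a class of functions, with values in `[0, ∞]`. -/
noncomputable def eabs (x : L0Unit) (u : ℝ) : ℝ≥0∞ := ‖x u‖ₑ

theorem measurable_eabs (x : L0Unit) : Measurable (eabs x) := x.measurable.enorm

theorem eabs_lt_top (x : L0Unit) (u : ℝ) : eabs x u < ⊤ := enorm_lt_top

theorem excess_congr {f g : ℝ → ℝ≥0∞} (h : f =ᵐ[lebUnit] g) (c : ℝ≥0∞) :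
    excess f c = excess g c :=
  lintegral_congr_ae (h.mono fun u hu => by simp only [hu])

theorem excess_zero (g : ℝ → ℝ≥0∞) : excess g 0 = ∫⁻ u, g u ∂lebUnit := by simp [excess]

theorem excess_top (g : ℝ → ℝ≥0∞) : excess g ⊤ = 0 := by simp [excess]

/-- The class of a measurable function with values in `[0, ∞]`. -/
noncomputable def ofFun (Z : ℝ → ℝ≥0∞) (hZ : Measurable Z) : L0Unit :=
  AEEqFun.mk (fun u => (Z u).toReal) hZ.ennreal_toReal.aestronglyMeasurable

theorem coeFn_ofFun (Z : ℝ → ℝ≥0∞) (hZ : Measurable Z) :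
    ofFun Z hZ =ᵐ[lebUnit] fun u => (Z u).toReal := AEEqFun.coeFn_mk _ _

theorem ofFun_nonneg (Z : ℝ → ℝ≥0∞) (hZ : Measurable Z) : 0 ≤ ofFun Z hZ := by
  rw [← AEEqFun.coeFn_le]
  filter_upwards [coeFn_ofFun Z hZ, AEEqFun.coeFn_zero (μ := lebUnit) (β := ℝ)] with u h1 h2
  rw [h1, h2]
  exact ENNReal.toReal_nonneg

theorem eabs_ofFun {Z : ℝ → ℝ≥0∞} (hZ : Measurable Z) (hfin : ∀ᵐ u ∂lebUnit, Z u < ⊤) :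
    eabs (ofFun Z hZ) =ᵐ[lebUnit] Z := by
  filter_upwards [coeFn_ofFun Z hZ, hfin] with u h1 h2
  rw [eabs, h1, Real.enorm_of_nonneg ENNReal.toReal_nonneg, ENNReal.ofReal_toReal h2.ne]

theorem ae_nonneg {x : L0Unit} (hx : 0 ≤ x) : ∀ᵐ u ∂lebUnit, 0 ≤ x u := by
  filter_upwards [AEEqFun.coeFn_le.2 hx, AEEqFun.coeFn_zero (μ := lebUnit) (β := ℝ)] with u h1 h2
  rwa [h2] at h1

theorem coeFn_eq_toReal_eabs {x : L0Unit} (hx : 0 ≤ x) :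
    x =ᵐ[lebUnit] fun u => (eabs x u).toReal := by
  filter_upwards [ae_nonneg hx] with u hu
  rw [eabs, toReal_enorm, Real.norm_of_nonneg hu]

theorem mem_Lp_of_lintegral_ne_top {x : L0Unit} (h : ∫⁻ u, eabs x u ∂lebUnit ≠ ⊤) :
    x ∈ Lp ℝ 1 lebUnit := by
  rw [Lp.mem_Lp_iff_eLpNorm_lt_top, eLpNorm_one_eq_lintegral_enorm]
  exact lt_top_iff_ne_top.2 h

theorem mem_substochasticOrbit_of_image {x y : L0Unit} (hx : 0 ≤ x)
    (hxi : ∫⁻ u, eabs x u ∂lebUnit ≠ ⊤) (hyi : ∫⁻ u, eabs y u ∂lebUnit ≠ ⊤) {Z : ℝ → ℝ≥0∞}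
    (hyZ : y =ᵐ[lebUnit] fun u => (Z u).toReal) (h : SubstochasticImage (eabs x) Z) :
    y ∈ substochasticOrbit x := by
  obtain ⟨T, hT, hTxy⟩ := h
  refine ⟨T, hT, ⟨x, mem_Lp_of_lintegral_ne_top hxi⟩, rfl, ?_⟩
  rw [hTxy ⟨x, mem_Lp_of_lintegral_ne_top hxi⟩ ⟨y, mem_Lp_of_lintegral_ne_top hyi⟩
    (coeFn_eq_toReal_eabs hx) hyZ]

theorem nonneg_of_mem_substochasticOrbit {x y : L0Unit} (hx : 0 ≤ x)
    (h : y ∈ substochasticOrbit x) : 0 ≤ y := by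
  obtain ⟨T, hT, f, rfl, rfl⟩ := h
  exact hT.map_nonneg f hx

/-- Split f = (f - c)⁺ + min(f, c). The operator keeps the second part below c in L∞ and does not
increase the L1 norm of the first, which is the excess of f. -/
theorem excess_le_of_mem_substochasticOrbit {x y : L0Unit} (hx : 0 ≤ x)
    (h : y ∈ substochasticOrbit x) (c : ℝ≥0∞) : excess (eabs y) c ≤ excess (eabs x) c := by
  obtain ⟨T, hT, f, rfl, rfl⟩ := h
  rcases eq_or_ne c ⊤ with rfl | hc
  · rw [excess_top]; exact zero_le
  obtain ⟨r, hr⟩ : ∃ r : ℝ, r = c.toReal := ⟨_, rfl⟩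
  have hr0 : 0 ≤ r := hr ▸ ENNReal.toReal_nonneg
  have hrc : ENNReal.ofReal r = c := by rw [hr, ENNReal.ofReal_toReal hc]
  have hfi := L1.integrable_coeFn f
  have hpi : Integrable (fun u => max (f u - r) 0) lebUnit :=
    (hfi.sub (integrable_const r)).sup (integrable_zero _ _ _)
  have hqi : Integrable (fun u => min (f u) r) lebUnit := hfi.inf (integrable_const r)
  have hf0 : ∀ᵐ u ∂lebUnit, 0 ≤ f u := ae_nonneg hx
  have hsum : f = hpi.toL1 + hqi.toL1 := by
    refine Lp.ext ?_
    filter_upwards [Lp.coeFn_add hpi.toL1 hqi.toL1, hpi.coeFn_toL1, hqi.coeFn_toL1] with u h1 h2 h3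
    rw [h1, Pi.add_apply, h2, h3]
    rcases le_total (f u) r with h | h
    · rw [max_eq_right (by linarith), min_eq_left h, zero_add]
    · rw [max_eq_left (by linarith), min_eq_right h, sub_add_cancel]
  have hq : ∀ᵐ v ∂lebUnit, ‖T hqi.toL1 v‖ₑ ≤ c := by
    have h1 : eLpNorm (T hqi.toL1) ⊤ lebUnit ≤ c := by
      refine (hT.eLpNorm_top_le _).trans ?_
      rw [eLpNorm_exponent_top, ← hrc]
      refine eLpNormEssSup_le_of_ae_bound ?_
      filter_upwards [hf0, hqi.coeFn_toL1] with u h1 h2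
      rw [h2, Real.norm_of_nonneg (le_min h1 hr0)]
      exact min_le_right _ _
    rw [eLpNorm_exponent_top] at h1
    exact ae_le_eLpNormEssSup.mono fun v hv => hv.trans h1
  have hT' : T f = T hpi.toL1 + T hqi.toL1 := by
    conv_lhs => rw [hsum]
    exact map_add T _ _
  calc excess (eabs (T f : L0Unit)) c ≤ ∫⁻ v, ‖T hpi.toL1 v‖ₑ ∂lebUnit := by
        refine lintegral_mono_ae ?_
        filter_upwards [hq, Lp.coeFn_add (T hpi.toL1) (T hqi.toL1)] with v h1 h2
        rw [tsub_le_iff_right, eabs, hT', h2]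
        exact (enorm_add_le _ _).trans (add_le_add le_rfl h1)
    _ = ENNReal.ofReal ‖T hpi.toL1‖ := (L1.ofReal_norm_eq_lintegral _).symm
    _ ≤ ENNReal.ofReal ‖hpi.toL1‖ := by
        refine ENNReal.ofReal_le_ofReal ((T.le_opNorm _).trans ?_)
        exact mul_le_of_le_one_left (norm_nonneg _) hT.norm_le_one
    _ = ∫⁻ u, ‖(hpi.toL1 : Lp ℝ 1 lebUnit) u‖ₑ ∂lebUnit := L1.ofReal_norm_eq_lintegral _
    _ = excess (eabs (f : L0Unit)) c := by
        refine lintegral_congr_ae ?_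
        filter_upwards [hf0, hpi.coeFn_toL1] with u h1 h2
        rw [h2, eabs, Real.enorm_of_nonneg (le_max_right _ _), Real.enorm_of_nonneg h1, ← hrc,
          ← ENNReal.ofReal_sub _ hr0, ENNReal.ofReal_max, ENNReal.ofReal_zero]
        exact max_eq_left zero_le

theorem setLIntegral_Iic_decRearr (g : ℝ → ℝ≥0∞) (t : ℝ) :
    ∫⁻ u in Set.Iic t, decRearr lebUnit g u ∂lebUnit =
      ∫⁻ s in Set.Ioc 0 t, decRearr lebUnit g s := by
  rw [lebUnit, Measure.restrict_restrict measurableSet_Iic, ← lintegral_indicator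
    (measurableSet_Iic.inter measurableSet_Ioo), ← lintegral_indicator measurableSet_Ioc]
  refine lintegral_congr fun s => ?_
  simp only [Set.indicator, Set.mem_inter_iff, Set.mem_Iic, Set.mem_Ioo, Set.mem_Ioc]
  rcases lt_or_ge s 1 with h | h
  · simp only [h, and_true, and_comm (a := s ≤ t) (b := 0 < s)]
  · have : decRearr (volume.restrict (Set.Ioo 0 1)) g s = 0 :=
      decRearr_eq_zero (lebUnit_univ_eq.trans_le (ENNReal.ofReal_le_ofReal h))
    simp [this]

theorem antitone_indicator_Iio {X : ℝ → ℝ≥0∞} (hX : Antitone X) (β : ℝ) :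
    Antitone ((Set.Iio β).indicator X) := by
  intro s t hst
  by_cases ht : t < β
  · rw [Set.indicator_of_mem (show t ∈ Set.Iio β from ht),
      Set.indicator_of_mem (show s ∈ Set.Iio β from hst.trans_lt ht)]
    exact hX hst
  · rw [Set.indicator_of_notMem (show t ∉ Set.Iio β from ht)]
    exact zero_le

/-- Truncating the rearrangement of `g` makes it majorize the rearrangement of `f`. -/
theorem exists_majorizedPair {f g : ℝ → ℝ≥0∞} (hf : Measurable f) (hg : Measurable g)
    (hgi : ∫⁻ u, g u ∂lebUnit ≠ ⊤) (h : ∀ c, excess f c ≤ excess g c) :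
    ∃ β ∈ Set.Icc (0 : ℝ) 1,
      IsMajorizedPair ((Set.Iio β).indicator (decRearr lebUnit g)) (decRearr lebUnit f) := by
  set X := decRearr lebUnit g with hX
  set Y := decRearr lebUnit f with hY
  have hXm : Measurable X := measurable_decRearr _ _
  have hXi : ∫⁻ u, X u ∂lebUnit ≠ ⊤ := by rwa [hX, lintegral_decRearr hg]
  have hle : ∫⁻ u, Y u ∂lebUnit ≤ ∫⁻ u, X u ∂lebUnit := by
    rw [hX, hY, lintegral_decRearr hf, lintegral_decRearr hg, ← excess_zero, ← excess_zero]
    exact h 0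
  have hβ : ∃ β ∈ Set.Icc (0 : ℝ) 1,
      ∫⁻ u in Set.Iio β, X u ∂lebUnit = ∫⁻ u, Y u ∂lebUnit := by
    set κ := lebUnit.withDensity X with hκ
    have hfin : IsFiniteMeasure κ := isFiniteMeasure_withDensity hXi
    have hκc : κ (Set.Ioo 0 1)ᶜ = 0 := by
      refine withDensity_absolutelyContinuous _ _ ?_
      rw [lebUnit, Measure.restrict_apply measurableSet_Ioo.compl]
      simp
    have hκI : ∀ t, ∫⁻ u in Set.Iio t, X u ∂lebUnit = κ (Set.Iic t) := by
      intro t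
      rw [← measure_congr (Iio_ae_eq_Iic (μ := κ)), hκ, withDensity_apply _ measurableSet_Iio]
    have hκu : κ Set.univ = ∫⁻ u, X u ∂lebUnit := by
      rw [hκ, withDensity_apply _ .univ, Measure.restrict_univ]
    have hYi : ∫⁻ u, Y u ∂lebUnit ≠ ⊤ := ne_top_of_le_ne_top hXi hle
    -- The cutoff β is the quantile of the measure X(u) du at level ∫Y. The extreme values 0 and ∫X
    -- fall outside the range of `cumul_quantile` and are met by β = 0 and β = 1.
    rcases eq_or_ne (∫⁻ u, Y u ∂lebUnit) 0 with h0 | h0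
    · refine ⟨0, ⟨le_rfl, zero_le_one⟩, ?_⟩
      rw [hκI, h0, measure_Iic_of_nonpos hκc le_rfl]
    rcases hle.eq_or_lt with h1 | h1
    · refine ⟨1, ⟨zero_le_one, le_rfl⟩, ?_⟩
      rw [hκI, h1, measure_Iic_of_one_le hκc le_rfl, hκu]
    · have hw : (∫⁻ u, Y u ∂lebUnit).toReal ∈ Set.Ioo 0 (κ Set.univ).toReal := by
        rw [hκu]
        exact ⟨ENNReal.toReal_pos h0 hYi, (ENNReal.toReal_lt_toReal hYi hXi).2 h1⟩
      refine ⟨quantile κ (∫⁻ u, Y u ∂lebUnit).toReal, ⟨?_, ?_⟩, ?_⟩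
      · exact le_csInf (quantile_set_nonempty _ _) fun t ht => ht.1
      · exact csInf_le (quantile_set_bddBelow _ _) ⟨zero_le_one, Or.inr le_rfl⟩
      · rw [hκI, ← ENNReal.toReal_eq_toReal_iff' (measure_ne_top _ _) hYi]
        exact cumul_quantile hκc hw
  obtain ⟨β, hβ01, hβ⟩ := hβ
  have hind : ∫⁻ u, (Set.Iio β).indicator X u ∂lebUnit = ∫⁻ u, Y u ∂lebUnit := by
    rw [lintegral_indicator measurableSet_Iio, hβ]
  refine ⟨β, hβ01, antitone_indicator_Iio (decRearr_antitone _ _) β, decRearr_antitone _ _, hind,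
    hind ▸ ne_top_of_le_ne_top hXi hle, fun t => ?_⟩
  -- Before β the truncation is invisible and submajorization applies; from β on, truncated X has
  -- its whole integral, which is that of Y.
  rcases lt_or_ge t β with ht | ht
  · rw [setLIntegral_indicator measurableSet_Iio,
      Set.inter_eq_right.2 (show Set.Iic t ⊆ Set.Iio β from fun s hs => lt_of_le_of_lt hs ht), setLIntegral_Iic_decRearr,
      setLIntegral_Iic_decRearr]
    exact setLIntegral_decRearr_mono hf hg h t
  · rw [setLIntegral_indicator measurableSet_Iio,
      Set.inter_eq_left.2
      (show Set.Iio β ⊆ Set.Iic t from fun s hs => (lt_of_lt_of_le hs ht).le), hβ]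
    exact setLIntegral_le_lintegral _ _

/-- Composes three steps: from x to its truncated rearrangement, from there to Z, and from Z to Z ∘
τ. -/
theorem ofFun_mem_substochasticOrbit_of_image {x : L0Unit} (hx : 0 ≤ x)
    (hxi : ∫⁻ u, eabs x u ∂lebUnit ≠ ⊤) {β : ℝ} {Z : ℝ → ℝ≥0∞} (hZm : Measurable Z)
    (hZ : ∫⁻ u, Z u ∂lebUnit ≠ ⊤)
    (h : SubstochasticImage ((Set.Iio β).indicator (decRearr lebUnit (eabs x))) Z)
    {τ : ℝ → ℝ} (hτ : MeasurePreserving τ lebUnit lebUnit) {y : L0Unit}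
    (hy : y =ᵐ[lebUnit] fun u => (Z (τ u)).toReal) : y ∈ substochasticOrbit x := by
  have hX := measurable_decRearr lebUnit (eabs x)
  have h1 := substochasticImage_indicator_decRearr (measurable_eabs x) hxi
    (measurableSet_Iio (a := β))
  have h2 : ∫⁻ u, (Set.Iio β).indicator (decRearr lebUnit (eabs x)) u ∂lebUnit ≠ ⊤ := by
    refine ne_top_of_le_ne_top hxi ?_
    rw [← lintegral_decRearr (measurable_eabs x)]
    exact lintegral_mono fun u => Set.indicator_le_self _ _ _
  have h3 : ∫⁻ u, Z (τ u) ∂lebUnit ≠ ⊤ := by rwa [hτ.lintegral_comp hZm]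
  refine mem_substochasticOrbit_of_image hx hxi ?_ hy ((h1.trans (hX.indicator measurableSet_Iio)
    h2 h).trans hZm hZ (substochasticImage_comp hτ hZm hZ))
  refine ne_top_of_le_ne_top h3 (lintegral_mono_ae ?_)
  filter_upwards [hy] with u hu
  rw [eabs, hu, Real.enorm_of_nonneg ENNReal.toReal_nonneg]
  exact ENNReal.ofReal_toReal_le

/-- The Calderon-Ryff description of the orbit. -/
theorem mem_substochasticOrbit_iff {x : L0Unit} (hx : 0 ≤ x)
    (hxi : ∫⁻ u, eabs x u ∂lebUnit ≠ ⊤) (y : L0Unit) :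
    y ∈ substochasticOrbit x ↔ 0 ≤ y ∧ ∀ c, excess (eabs y) c ≤ excess (eabs x) c := by
  refine ⟨fun h => ⟨nonneg_of_mem_substochasticOrbit hx h,
    excess_le_of_mem_substochasticOrbit hx h⟩, fun ⟨hy, h⟩ => ?_⟩
  obtain ⟨β, -, hβ⟩ := exists_majorizedPair (measurable_eabs y) (measurable_eabs x) hxi h
  have hyi : ∫⁻ u, eabs y u ∂lebUnit ≠ ⊤ := by
    have := h 0
    rw [excess_zero, excess_zero] at this
    exact ne_top_of_le_ne_top hxi this
  refine ofFun_mem_substochasticOrbit_of_image hx hxi (measurable_decRearr _ _)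
    (by rwa [lintegral_decRearr (measurable_eabs y)]) hβ.substochasticImage
    (measurePreserving_ryffMap (measurable_eabs y)) ?_
  filter_upwards [coeFn_eq_toReal_eabs hy, decRearr_ryffMap (measurable_eabs y) hyi] with u h1 h2
  rw [h1, h2]

/-- Otherwise y* is the midpoint of two distinct images of truncated X; composing with the sorting
map of y exhibits y itself as a midpoint inside the orbit. -/
theorem decRearr_eq_of_mem_extremePoints {x y : L0Unit} (hx : 0 ≤ x)
    (hxi : ∫⁻ u, eabs x u ∂lebUnit ≠ ⊤) (hy : y ∈ (substochasticOrbit x).extremePoints ℝ) :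
    ∃ β ∈ Set.Icc (0 : ℝ) 1, (Set.Iio β).indicator (decRearr lebUnit (eabs x)) =ᵐ[lebUnit]
      decRearr lebUnit (eabs y) := by
  rw [mem_extremePoints_iff_left] at hy
  obtain ⟨hyx, hext⟩ := hy
  obtain ⟨hy0, hyc⟩ := (mem_substochasticOrbit_iff hx hxi y).1 hyx
  have hyi : ∫⁻ u, eabs y u ∂lebUnit ≠ ⊤ := by
    have := hyc 0
    rw [excess_zero, excess_zero] at this
    exact ne_top_of_le_ne_top hxi this
  obtain ⟨β, hβ01, hβ⟩ := exists_majorizedPair (measurable_eabs y) (measurable_eabs x) hxi hyc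
  refine ⟨β, hβ01, ?_⟩
  by_contra hne
  obtain ⟨Z₁, Z₂, hm₁, hm₂, hi₁, hi₂, hI₁, hI₂, hsum, hZ⟩ := hβ.exists_midpoint hne
  have hτ := measurePreserving_ryffMap (measurable_eabs y)
  have hry := decRearr_ryffMap (measurable_eabs y) hyi
  set τ := ryffMap (eabs y) with hτdef
  set Y := decRearr lebUnit (eabs y) with hY
  have hYm : Measurable Y := measurable_decRearr _ _
  have hz₁ : ofFun (Z₁ ∘ τ) (hm₁.comp hτ.measurable) ∈ substochasticOrbit x :=
    ofFun_mem_substochasticOrbit_of_image hx hxi hm₁ hi₁ hI₁ hτ (coeFn_ofFun _ _)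
  have hz₂ : ofFun (Z₂ ∘ τ) (hm₂.comp hτ.measurable) ∈ substochasticOrbit x :=
    ofFun_mem_substochasticOrbit_of_image hx hxi hm₂ hi₂ hI₂ hτ (coeFn_ofFun _ _)
  have hf₁ := hτ.quasiMeasurePreserving.ae (ae_lt_top hm₁ hi₁)
  have hf₂ := hτ.quasiMeasurePreserving.ae (ae_lt_top hm₂ hi₂)
  have hseg : y ∈ openSegment ℝ (ofFun (Z₁ ∘ τ) (hm₁.comp hτ.measurable))
      (ofFun (Z₂ ∘ τ) (hm₂.comp hτ.measurable)) := by
    refine ⟨1 / 2, 1 / 2, by norm_num, by norm_num, by norm_num, ?_⟩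
    refine AEEqFun.ext ?_
    filter_upwards [AEEqFun.coeFn_add ((1 / 2 : ℝ) • ofFun (Z₁ ∘ τ) (hm₁.comp hτ.measurable))
        ((1 / 2 : ℝ) • ofFun (Z₂ ∘ τ) (hm₂.comp hτ.measurable)),
      AEEqFun.coeFn_smul (1 / 2 : ℝ) (ofFun (Z₁ ∘ τ) (hm₁.comp hτ.measurable)),
      AEEqFun.coeFn_smul (1 / 2 : ℝ) (ofFun (Z₂ ∘ τ) (hm₂.comp hτ.measurable)),
      coeFn_ofFun (Z₁ ∘ τ) (hm₁.comp hτ.measurable), coeFn_ofFun (Z₂ ∘ τ) (hm₂.comp hτ.measurable),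
      hτ.quasiMeasurePreserving.ae hsum, hry, coeFn_eq_toReal_eabs hy0, hf₁, hf₂]
      with u h1 h2 h3 h4 h5 h6 h7 h8 h9 h10
    have h11 : (Z₁ (τ u)).toReal + (Z₂ (τ u)).toReal = (eabs y u).toReal + (eabs y u).toReal := by
      rw [← ENNReal.toReal_add h9.ne h10.ne, h6, h7,
        ENNReal.toReal_add (eabs_lt_top y u).ne (eabs_lt_top y u).ne]
    rw [h1, Pi.add_apply, h2, h3, Pi.smul_apply, Pi.smul_apply, h4, h5, h8, smul_eq_mul, smul_eq_mul]
    simp only [Function.comp_apply]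
    linarith
  have hzy := hext _ hz₁ _ hz₂ hseg
  apply hZ
  -- Equality after composition with τ descends to equality a.e., because τ preserves measure.
  have hpre : ∀ᵐ u ∂lebUnit, Z₁ (τ u) = Y (τ u) := by
    have h1 := coeFn_ofFun (Z₁ ∘ τ) (hm₁.comp hτ.measurable)
    rw [hzy] at h1
    filter_upwards [h1, coeFn_eq_toReal_eabs hy0, hry, hf₁] with u h2 h3 h4 h5
    rw [h3] at h2
    rw [h4]
    exact ((ENNReal.toReal_eq_toReal_iff' (eabs_lt_top y u).ne h5.ne).1 h2).symm
  have hms : MeasurableSet {u | Z₁ u = Y u}ᶜ := (measurableSet_eq_fun hm₁ hYm).compl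
  rw [ae_iff] at hpre
  have := hτ.measure_preimage hms.nullMeasurableSet
  exact this.symm.trans hpre

/-- If G₁ < G₂ and v < G₂, then at a level strictly between max(v, G₁) and G₂ the convexity
inequality for (t - c)⁺ is strict. If G₂ ≤ v, the combination lies strictly below v, hence is 0, and
G₂ > G₁ is impossible. Rational levels suffice, which later allows a single null set. -/
theorem not_lt_of_convex_levels {a b G₁ G₂ v : ℝ≥0∞} (ha : a ≠ 0) (hb : b ≠ 0) (hab : a + b = 1)
    (h2 : G₂ < ⊤) (hv : a * G₁ + b * G₂ = 0 ∨ v ≤ a * G₁ + b * G₂)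
    (hc : ∀ q : ℚ, v ≤ (Real.toNNReal q : ℝ≥0∞) → (a * G₁ + b * G₂) - (Real.toNNReal q : ℝ≥0∞) =
      a * (G₁ - (Real.toNNReal q : ℝ≥0∞)) + b * (G₂ - (Real.toNNReal q : ℝ≥0∞))) :
    ¬ G₁ < G₂ := by
  intro hlt
  have hat : a ≠ ⊤ := ne_top_of_le_ne_top ENNReal.one_ne_top (hab ▸ le_self_add)
  have hbt : b ≠ ⊤ := ne_top_of_le_ne_top ENNReal.one_ne_top (hab ▸ le_add_self)
  rcases lt_or_ge v G₂ with hvG | hvG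
  · obtain ⟨q, -, hq1, hq2⟩ := ENNReal.lt_iff_exists_rat_btwn.1 (max_lt hvG hlt)
    have h3 := hc q ((le_max_left _ _).trans hq1.le)
    set c : ℝ≥0∞ := (Real.toNNReal q : ℝ≥0∞) with hcdef
    have hct : c ≠ ⊤ := ENNReal.coe_ne_top
    have hG₁c : G₁ < c := (le_max_right _ _).trans_lt hq1
    rw [tsub_eq_zero_of_le hG₁c.le, mul_zero, zero_add] at h3
    have hK : b * (G₂ - c) ≠ 0 := mul_ne_zero hb (tsub_pos_of_lt hq2).ne'
    have hcG : c < a * G₁ + b * G₂ := tsub_pos_iff_lt.1 (h3 ▸ pos_iff_ne_zero.2 hK)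
    have h4 : a * G₁ + b * G₂ < a * c + b * G₂ :=
      ENNReal.add_lt_add_right (ENNReal.mul_ne_top hbt h2.ne)
        ((ENNReal.mul_lt_mul_iff_right ha hat).2 hG₁c)
    have h5 : a * c + b * G₂ = c + b * (G₂ - c) := by
      conv_lhs => rw [← add_tsub_cancel_of_le hq2.le]
      rw [mul_add, ← add_assoc, ← add_mul, hab, one_mul]
    rw [h5, ← h3, add_tsub_cancel_of_le hcG.le] at h4
    exact lt_irrefl _ h4
  · rcases hv with hv | hv
    · have h3 : b * G₂ = 0 := (add_eq_zero.1 hv).2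
      rcases mul_eq_zero.1 h3 with h | h
      · exact hb h
      · rw [h] at hlt; exact not_lt_zero hlt
    · have h4 : a * G₁ + b * G₂ < a * G₂ + b * G₂ :=
        ENNReal.add_lt_add_right (ENNReal.mul_ne_top hbt h2.ne)
          ((ENNReal.mul_lt_mul_iff_right ha hat).2 hlt)
      rw [← add_mul, hab, one_mul] at h4
      exact absurd (hv.trans_lt h4) (not_lt.2 hvG)

/-- If y = a z₁ + b z₂ in the orbit, the excesses of z₁ and z₂ are at most those of x, which y
attains at levels c ≥ v. The convexity inequality for (t - c)⁺ is then an equality a.e. at each such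
level, and `not_lt_of_convex_levels` gives z₁ = z₂. -/
theorem mem_extremePoints_of_levels {x y : L0Unit} (hx : 0 ≤ x)
    (hxi : ∫⁻ u, eabs x u ∂lebUnit ≠ ⊤) (hy : 0 ≤ y)
    (hyx : ∀ c, excess (eabs y) c ≤ excess (eabs x) c) (v : ℝ≥0∞)
    (hv : ∀ᵐ u ∂lebUnit, eabs y u = 0 ∨ v ≤ eabs y u)
    (hc : ∀ c, v ≤ c → excess (eabs y) c = excess (eabs x) c) :
    y ∈ (substochasticOrbit x).extremePoints ℝ := by
  rw [mem_extremePoints_iff_left]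
  refine ⟨(mem_substochasticOrbit_iff hx hxi y).2 ⟨hy, hyx⟩, fun z₁ hz₁ z₂ hz₂ hseg => ?_⟩
  obtain ⟨h10, h1c⟩ := (mem_substochasticOrbit_iff hx hxi z₁).1 hz₁
  obtain ⟨h20, h2c⟩ := (mem_substochasticOrbit_iff hx hxi z₂).1 hz₂
  obtain ⟨a', b', ha', hb', hab', hyz⟩ := hseg
  set a := ENNReal.ofReal a' with ha
  set b := ENNReal.ofReal b' with hb
  have ha0 : a ≠ 0 := (ENNReal.ofReal_pos.2 ha').ne'
  have hb0 : b ≠ 0 := (ENNReal.ofReal_pos.2 hb').ne'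
  have hab : a + b = 1 := by
    rw [ha, hb, ← ENNReal.ofReal_add ha'.le hb'.le, hab', ENNReal.ofReal_one]
  have hyG : ∀ᵐ u ∂lebUnit, eabs y u = a * eabs z₁ u + b * eabs z₂ u := by
    rw [← hyz]
    filter_upwards [AEEqFun.coeFn_add (a' • z₁) (b' • z₂), AEEqFun.coeFn_smul a' z₁,
      AEEqFun.coeFn_smul b' z₂, ae_nonneg h10, ae_nonneg h20] with u e1 e2 e3 e4 e5
    rw [eabs, e1, Pi.add_apply, e2, e3, Pi.smul_apply, Pi.smul_apply, smul_eq_mul, smul_eq_mul,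
      Real.enorm_of_nonneg (by positivity), ENNReal.ofReal_add (by positivity) (by positivity),
      ENNReal.ofReal_mul ha'.le, ENNReal.ofReal_mul hb'.le, eabs, eabs, Real.enorm_of_nonneg e4,
      Real.enorm_of_nonneg e5]
  have hlev : ∀ᵐ u ∂lebUnit, ∀ q : ℚ, v ≤ (Real.toNNReal q : ℝ≥0∞) →
      eabs y u - (Real.toNNReal q : ℝ≥0∞) = a * (eabs z₁ u - (Real.toNNReal q : ℝ≥0∞)) +
        b * (eabs z₂ u - (Real.toNNReal q : ℝ≥0∞)) := by
    rw [ae_all_iff]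
    intro q
    by_cases hq : v ≤ (Real.toNNReal q : ℝ≥0∞)
    swap
    · exact Eventually.of_forall fun u hu => absurd hu hq
    set c : ℝ≥0∞ := (Real.toNNReal q : ℝ≥0∞)
    have hm₁ : Measurable fun u => eabs z₁ u - c := (measurable_eabs z₁).sub_const c
    have hm₂ : Measurable fun u => eabs z₂ u - c := (measurable_eabs z₂).sub_const c
    have hfin : excess (eabs y) c ≠ ⊤ := by
      refine ne_top_of_le_ne_top hxi ((hyx c).trans ?_)
      exact lintegral_mono fun u => tsub_le_self
    have hle : ∀ᵐ u ∂lebUnit, eabs y u - c ≤ a * (eabs z₁ u - c) + b * (eabs z₂ u - c) := by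
      filter_upwards [hyG] with u hu
      rw [hu, tsub_le_iff_right]
      calc a * eabs z₁ u + b * eabs z₂ u
          ≤ a * (eabs z₁ u - c + c) + b * (eabs z₂ u - c + c) := by gcongr <;> exact le_tsub_add
        _ = a * (eabs z₁ u - c) + b * (eabs z₂ u - c) + (a + b) * c := by ring
        _ = _ := by rw [hab, one_mul]
    have heq := ae_eq_of_ae_le_of_lintegral_le hle hfin
      ((hm₁.const_mul a).add (hm₂.const_mul b)).aemeasurable (by
        rw [lintegral_add_left (hm₁.const_mul a), lintegral_const_mul _ hm₁,
          lintegral_const_mul _ hm₂]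
        calc a * excess (eabs z₁) c + b * excess (eabs z₂) c
            ≤ a * excess (eabs x) c + b * excess (eabs x) c := by
              gcongr
              · exact h1c c
              · exact h2c c
          _ = excess (eabs x) c := by rw [← add_mul, hab, one_mul]
          _ = excess (eabs y) c := (hc c hq).symm)
    filter_upwards [heq] with u hu _
    exact hu
  have hz : z₁ = z₂ := by
    refine AEEqFun.ext ?_
    filter_upwards [coeFn_eq_toReal_eabs h10, coeFn_eq_toReal_eabs h20, hyG, hlev, hv]
      with u e1 e2 e3 e4 e5
    rw [e1, e2]
    congr 1
    rw [e3] at e5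
    refine le_antisymm (not_lt.1 ?_) (not_lt.1 ?_)
    · refine not_lt_of_convex_levels (v := v) hb0 ha0 (by rw [add_comm, hab])
        (eabs_lt_top z₁ u) (by rwa [add_comm]) fun q hq => ?_
      rw [add_comm, ← e3, e4 q hq, add_comm]
    · refine not_lt_of_convex_levels (v := v) ha0 hb0 hab
        (eabs_lt_top z₂ u) e5 fun q hq => ?_
      rw [← e3, e4 q hq]
  rw [← hyz, ← hz, ← add_smul, hab', one_smul]

/-- The critical level is v = X(β): truncated X takes values that are 0 or at least v, and
truncation at β removes nothing above v. -/
theorem mem_extremePoints_of_map_eq {x y : L0Unit} (hx : 0 ≤ x)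
    (hxi : ∫⁻ u, eabs x u ∂lebUnit ≠ ⊤) (hy : 0 ≤ y) {β : ℝ}
    (hmap : lebUnit.map (eabs y) =
      lebUnit.map ((Set.Iio β).indicator (decRearr lebUnit (eabs x)))) :
    y ∈ (substochasticOrbit x).extremePoints ℝ := by
  set X := decRearr lebUnit (eabs x) with hX
  have hXm : Measurable X := measurable_decRearr _ _
  have hIm : Measurable ((Set.Iio β).indicator X) := hXm.indicator measurableSet_Iio
  have hexc : ∀ c, excess (eabs y) c = excess ((Set.Iio β).indicator X) c := by
    intro c
    have hcm : Measurable fun s : ℝ≥0∞ => s - c := measurable_id.sub_const c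
    rw [excess, excess, ← lintegral_map hcm (measurable_eabs y), hmap, lintegral_map hcm hIm]
  refine mem_extremePoints_of_levels hx hxi hy (fun c => ?_) (X β) ?_ fun c hc => ?_
  · rw [hexc, ← excess_decRearr (measurable_eabs x)]
    exact lintegral_mono fun u => tsub_le_tsub_right (Set.indicator_le_self _ _ _) c
  · have hs : MeasurableSet {s : ℝ≥0∞ | s = 0 ∨ X β ≤ s} :=
      (measurableSet_singleton 0).union measurableSet_Ici
    have h1 : ∀ᵐ s ∂lebUnit.map ((Set.Iio β).indicator X), s = 0 ∨ X β ≤ s := by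
      rw [ae_map_iff hIm.aemeasurable hs]
      refine Eventually.of_forall fun u => ?_
      by_cases hu : u < β
      · right
        rw [Set.indicator_of_mem (show u ∈ Set.Iio β from hu)]
        exact decRearr_antitone _ _ hu.le
      · left
        exact Set.indicator_of_notMem (show u ∉ Set.Iio β from hu) _
    rw [← hmap, ae_map_iff (measurable_eabs y).aemeasurable hs] at h1
    exact h1
  · rw [hexc, ← excess_decRearr (measurable_eabs x)]
    refine lintegral_congr fun u => ?_
    by_cases hu : u < β
    · rw [Set.indicator_of_mem (show u ∈ Set.Iio β from hu)]
    · rw [Set.indicator_of_notMem (show u ∉ Set.Iio β from hu), zero_tsub, eq_comm,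
        tsub_eq_zero_iff_le]
      exact (decRearr_antitone _ _ (not_lt.1 hu)).trans hc

/-! ### Approximating partial averages by averages of rearrangements -/

section glue

variable {ι : Type*}

/-- The function which equals `g j` on `A j`, for disjoint sets `A j`. -/
noncomputable def glue (A : ι → Set ℝ) (g : ι → ℝ → ℝ≥0∞) (s : ℝ) : ℝ≥0∞ :=
  ∑' j, (A j).indicator (g j) s

theorem glue_eq {A : ι → Set ℝ} (hA : Pairwise (Function.onFun Disjoint A))
    (g : ι → ℝ → ℝ≥0∞) {j : ι} {s : ℝ} (hs : s ∈ A j) : glue A g s = g j s := by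
  rw [glue, tsum_eq_single j, Set.indicator_of_mem hs]
  intro i hij
  exact Set.indicator_of_notMem (fun hi => Set.disjoint_left.1 (hA hij) hi hs) _

theorem measurable_glue [Countable ι] {A : ι → Set ℝ} (hA : ∀ j, MeasurableSet (A j))
    {g : ι → ℝ → ℝ≥0∞} (hg : ∀ j, Measurable (g j)) : Measurable (glue A g) :=
  Measurable.tsum fun j => (hg j).indicator (hA j)

theorem setLIntegral_eq_tsum [Countable ι] {μ : Measure ℝ} {A : ι → Set ℝ} {B : Set ℝ}
    (hA : ∀ j, MeasurableSet (A j)) (hd : Pairwise (Function.onFun Disjoint A))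
    (hB : B =ᵐ[μ] ⋃ j, A j) (F : ℝ → ℝ≥0∞) :
    ∫⁻ s in B, F s ∂μ = ∑' j, ∫⁻ s in A j, F s ∂μ := by
  rw [setLIntegral_congr hB, lintegral_iUnion hA hd]

theorem setLIntegral_glue [Countable ι] {μ : Measure ℝ} {A : ι → Set ℝ} {B : Set ℝ}
    (hA : ∀ j, MeasurableSet (A j)) (hd : Pairwise (Function.onFun Disjoint A))
    (hB : B =ᵐ[μ] ⋃ j, A j) (g : ι → ℝ → ℝ≥0∞) (Φ : ℝ≥0∞ → ℝ≥0∞) :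
    ∫⁻ s in B, Φ (glue A g s) ∂μ = ∑' j, ∫⁻ s in A j, Φ (g j s) ∂μ := by
  rw [setLIntegral_eq_tsum hA hd hB]
  exact tsum_congr fun j => setLIntegral_congr_fun (hA j) fun s hs => by
    simp only [glue_eq hd g hs]

end glue

theorem setLIntegral_Ioo_nat_mul {d : ℝ} (hd : 0 ≤ d) {H : ℝ → ℝ≥0∞} (hH : Measurable H) (n : ℕ) :
    ∫⁻ v in Set.Ioo 0 (n * d), H v = ∑ j : Fin n, ∫⁻ v in Set.Ioo 0 d, H (v + j * d) := by
  have hIoo : ∀ (b : ℝ) (F : ℝ → ℝ≥0∞), ∫⁻ v in Set.Ioo 0 b, F v = ∫⁻ v in Set.Ioc 0 b, F v :=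
    fun b F => setLIntegral_congr Ioo_ae_eq_Ioc
  simp only [hIoo]
  rw [Fin.sum_univ_eq_sum_range (fun j => ∫⁻ v in Set.Ioc 0 d, H (v + j * d)) n]
  induction n with
  | zero => simp
  | succ n ih =>
    have h1 : (0:ℝ) ≤ n * d := by positivity
    have h2 : (n:ℝ) * d ≤ (n + 1 : ℕ) * d := by push_cast; nlinarith
    rw [Finset.sum_range_succ, ← ih, ← Set.Ioc_union_Ioc_eq_Ioc h1 h2,
      lintegral_union measurableSet_Ioc (Set.Ioc_disjoint_Ioc_of_le le_rfl)]
    congr 1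
    rw [← (measurePreserving_add_right volume ((n:ℝ) * d)).setLIntegral_comp_preimage
      measurableSet_Ioc hH]
    congr 2
    ext v
    simp only [Set.mem_preimage, Set.mem_Ioc]
    push_cast
    constructor <;> rintro ⟨a, b⟩ <;> constructor <;> linarith

/-- Any set splits into `n` pieces of equal measure. -/
theorem exists_equal_partition {A : Set ℝ} (hA : MeasurableSet A) {n : ℕ} (hn : 0 < n) :
    ∃ B : Fin n → Set ℝ, (∀ q, MeasurableSet (B q)) ∧ Pairwise (Function.onFun Disjoint B) ∧
      (A =ᵐ[lebUnit] ⋃ q, B q) ∧ ∀ q, (lebUnit (B q)).toReal = (lebUnit A).toReal / n := by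
  set l := (lebUnit A).toReal with hl
  set d := l / n with hd
  have hn0 : (0:ℝ) < n := by exact_mod_cast hn
  have hd0 : 0 ≤ d := div_nonneg ENNReal.toReal_nonneg hn0.le
  have hnd : n * d = l := by rw [hd]; field_simp
  set G := cumul (lebUnit.restrict A) with hG
  have hGm : Measurable G := measurable_cumul _
  have hmap := map_cumul (μ := lebUnit.restrict A) (lebUnit_restrict_compl A)
  rw [Measure.restrict_apply_univ] at hmap
  -- The cumulative function of A is uniform on (0, |A|), so equal intervals pull back to equal
  -- pieces.
  let B : Fin n → Set ℝ := fun q => A ∩ G ⁻¹' Set.Ioc (q * d) ((q + 1) * d)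
  have hBm : ∀ q, MeasurableSet (B q) := fun q => hA.inter (hGm measurableSet_Ioc)
  have hBd : Pairwise (Function.onFun Disjoint B) := by
    have key : ∀ i j : Fin n, i < j → Disjoint (B i) (B j) := by
      intro i j hij
      refine Set.disjoint_left.2 fun s hi hj => ?_
      have h1 : G s ≤ (i + 1) * d := hi.2.2
      have h2 : j * d < G s := hj.2.1
      have h3 : ((i:ℕ):ℝ) + 1 ≤ ((j:ℕ):ℝ) := by exact_mod_cast hij
      nlinarith
    intro i j hij
    rcases lt_or_gt_of_ne hij with h | h
    · exact key i j h
    · exact (key j i h).symm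
  have hBv : ∀ q, lebUnit (B q) = ENNReal.ofReal d := by
    intro q
    have h1 : lebUnit (B q) = (lebUnit.restrict A) (G ⁻¹' Set.Ioc (q * d) ((q + 1) * d)) := by
      rw [Measure.restrict_apply (hGm measurableSet_Ioc), Set.inter_comm]
    have h2 : (0:ℝ) ≤ q * d := by positivity
    have h3 : ((q:ℕ):ℝ) + 1 ≤ n := by exact_mod_cast q.2
    have h4 : ((q:ℝ) + 1) * d ≤ l := by rw [← hnd]; exact mul_le_mul_of_nonneg_right h3 hd0
    rw [h1, ← Measure.map_apply hGm measurableSet_Ioc, hmap, Measure.restrict_congr_set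
      (Ioo_ae_eq_Ioc (μ := volume)), Measure.restrict_apply measurableSet_Ioc,
      Set.inter_eq_left.2 (Set.Ioc_subset_Ioc h2 h4), Real.volume_Ioc]
    congr 1; ring
  refine ⟨B, hBm, hBd, ?_, fun q => by rw [hBv, ENNReal.toReal_ofReal hd0]⟩
  refine (ae_eq_of_subset_of_measure_ge (Set.iUnion_subset fun q => Set.inter_subset_left) ?_
    (MeasurableSet.iUnion hBm).nullMeasurableSet (measure_ne_top _ _)).symm
  rw [measure_iUnion hBd hBm, tsum_fintype]
  simp only [hBv, Finset.sum_const, Finset.card_univ, Fintype.card_fin, nsmul_eq_mul]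
  rw [← ENNReal.ofReal_natCast, ← ENNReal.ofReal_mul hn0.le, hnd, hl,
    ENNReal.ofReal_toReal (measure_ne_top _ _)]

/-- The sum of the values of `f` along an arithmetic progression. -/
noncomputable def stepSum (f : ℝ → ℝ≥0∞) (n : ℕ) (d θ : ℝ) : ℝ≥0∞ :=
  ∑ j : Fin n, f (θ + j * d)

/-- Shift the progression by one step: θ + (j + 1)d lies to the right of θ' + jd, so only the first
term f(θ) is left over. -/
theorem stepSum_le {f : ℝ → ℝ≥0∞} (hf : Antitone f) {n : ℕ} (hn : 0 < n) {d θ θ' : ℝ}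
    (hθ : 0 ≤ θ) (hθ' : θ' ≤ d) : stepSum f n d θ ≤ f θ + stepSum f n d θ' := by
  obtain ⟨m, rfl⟩ := Nat.exists_eq_succ_of_ne_zero hn.ne'
  rw [stepSum, stepSum, Fin.sum_univ_succ, Fin.sum_univ_castSucc]
  refine add_le_add (by simp) (le_add_right (Finset.sum_le_sum fun j _ => hf ?_))
  simp only [Fin.val_succ, Fin.val_castSucc]
  push_cast
  linarith

/-- The mean of the step sum over one period (0, d) is nr. Averaging `stepSum_le` over θ' gives the
upper estimate with error f(θ); averaging over θ gives the lower one, with the mean of f on (0, d)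
as error. -/
theorem stepSum_bounds {f : ℝ → ℝ≥0∞} (hf : Antitone f) {n : ℕ} (hn : 0 < n) {d θ : ℝ}
    (hθ : θ ∈ Set.Ioo 0 d) {r : ℝ≥0∞}
    (hr : ∫⁻ v in Set.Ioo 0 (n * d), f v = r * ENNReal.ofReal (n * d)) :
    stepSum f n d θ ≤ n * r + f θ ∧
      n * r ≤ stepSum f n d θ + (∫⁻ v in Set.Ioo 0 d, f v) / ENNReal.ofReal d := by
  have hd : 0 < d := hθ.1.trans hθ.2
  have hD0 : ENNReal.ofReal d ≠ 0 := (ENNReal.ofReal_pos.2 hd).ne'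
  have hDt : ENNReal.ofReal d ≠ ⊤ := ENNReal.ofReal_ne_top
  have hfm := hf.measurable
  have hint : ∫⁻ v in Set.Ioo 0 d, stepSum f n d v = n * r * ENNReal.ofReal d := by
    simp only [stepSum]
    rw [lintegral_finsetSum (f := fun (j : Fin n) v => f (v + j * d)) _
      fun j _ => hfm.comp (measurable_id.add_const _),
      ← setLIntegral_Ioo_nat_mul hd.le hfm, hr, ENNReal.ofReal_mul (by positivity),
      ENNReal.ofReal_natCast]
    ring
  have hconst : ∀ c : ℝ≥0∞, ∫⁻ _ in Set.Ioo (0:ℝ) d, c = c * ENNReal.ofReal d := by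
    intro c; simp
  constructor
  · refine (ENNReal.mul_le_mul_iff_left hD0 hDt).1 ?_
    rw [← hconst, add_mul, ← hint, ← hconst (f θ), ← lintegral_add_right _ measurable_const]
    refine setLIntegral_mono' measurableSet_Ioo fun v hv => ?_
    rw [add_comm]
    exact stepSum_le hf hn hθ.1.le hv.2.le
  · refine (ENNReal.mul_le_mul_iff_left hD0 hDt).1 ?_
    rw [← hint, add_mul, ENNReal.div_mul_cancel hD0 hDt, ← hconst (stepSum f n d θ),
      ← lintegral_add_left measurable_const]
    refine setLIntegral_mono' measurableSet_Ioo fun v hv => ?_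
    rw [add_comm]
    exact stepSum_le hf hn hv.1.le hθ.2.le

/-- On a set `A`, the constant average of `X` under `ν` is approximated by the average of `n`
functions which have the distribution of `X` under `ν`. -/
theorem exists_shuffles_on {A : Set ℝ} (hA : MeasurableSet A) {ν : Measure ℝ}
    (hν : ν Set.univ = lebUnit A) {X : ℝ → ℝ≥0∞} (hX : Measurable X) {r : ℝ≥0∞}
    (hr : ∫⁻ u, X u ∂ν = r * lebUnit A) {n : ℕ} (hn : 0 < n) :
    ∃ (z : Fin n → ℝ → ℝ≥0∞) (e : ℝ → ℝ≥0∞) (e' : ℝ≥0∞), (∀ i, Measurable (z i)) ∧ Measurable e ∧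
      (∀ i, ∀ Φ : ℝ≥0∞ → ℝ≥0∞, Measurable Φ →
        ∫⁻ s in A, Φ (z i s) ∂lebUnit = ∫⁻ u, Φ (X u) ∂ν) ∧
      (∀ᵐ s ∂lebUnit, s ∈ A → ∑ i, z i s ≤ n * r + e s ∧ n * r ≤ ∑ i, z i s + e') ∧
      (∀ c, ∫⁻ _ in A, (e' - c) ∂lebUnit ≤ ∫⁻ s in A, (e s - c) ∂lebUnit) ∧
      ∀ Φ : ℝ≥0∞ → ℝ≥0∞, Measurable Φ →
        ∫⁻ s in A, Φ (e s) ∂lebUnit ≤ n * ∫⁻ u, Φ (X u) ∂ν := by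
  have hνf : IsFiniteMeasure ν := ⟨hν ▸ measure_lt_top _ _⟩
  have : NeZero n := ⟨hn.ne'⟩
  obtain ⟨B, hBm, hBd, hBA, hBv⟩ := exists_equal_partition hA hn
  set l := (lebUnit A).toReal with hl
  set d := l / n with hd
  have hn0 : (0:ℝ) < n := by exact_mod_cast hn
  have hd0 : 0 ≤ d := div_nonneg ENNReal.toReal_nonneg hn0.le
  have hnd : n * d = l := by rw [hd]; field_simp
  have hlA : lebUnit A = ENNReal.ofReal l := (ENNReal.ofReal_toReal (measure_ne_top _ _)).symm
  set f := decRearr ν X with hf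
  have hfa : Antitone f := decRearr_antitone _ _
  have hfm : Measurable f := hfa.measurable
  let θ : Fin n → ℝ → ℝ := fun q => cumul (lebUnit.restrict (B q))
  have hθm : ∀ q, Measurable (θ q) := fun q => measurable_cumul _
  have hθ : ∀ q, ∀ Φ : ℝ → ℝ≥0∞, Measurable Φ →
      ∫⁻ s in B q, Φ (θ q s) ∂lebUnit = ∫⁻ v in Set.Ioo 0 d, Φ v := by
    intro q Φ hΦ
    rw [setLIntegral_comp_cumul (B q) hΦ, hBv]
  have hlaw : ∀ Φ : ℝ≥0∞ → ℝ≥0∞, Measurable Φ →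
      ∫⁻ v in Set.Ioo 0 (n * d), Φ (f v) = ∫⁻ u, Φ (X u) ∂ν := by
    intro Φ hΦ
    rw [hnd]
    exact lintegral_comp_decRearr hX (hν.trans hlA) hΦ
  have hshift : ∀ j : Fin n, Measurable fun v : ℝ => f (v + j * d) := fun j =>
    hfm.comp (measurable_id.add_const _)
  -- Addition in `Fin n` is modulo n: the i-th shuffle places the (q + i)-th block of f on the piece
  -- B q. For fixed i every block occurs once, so the law is preserved; at a fixed point s the sum
  -- over i is a step sum.
  let z : Fin n → ℝ → ℝ≥0∞ := fun i => glue B fun q s => f (θ q s + (q + i : Fin n) * d)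
  let e : ℝ → ℝ≥0∞ := glue B fun q s => f (θ q s)
  have heΦ : ∀ Φ : ℝ≥0∞ → ℝ≥0∞, Measurable Φ →
      ∫⁻ s in A, Φ (e s) ∂lebUnit = n * ∫⁻ v in Set.Ioo 0 d, Φ (f v) := by
    intro Φ hΦ
    rw [setLIntegral_glue hBm hBd hBA, tsum_fintype]
    rw [Finset.sum_congr rfl fun q _ => hθ q (fun v => Φ (f v)) (hΦ.comp hfm)]
    simp
  refine ⟨z, e, (∫⁻ v in Set.Ioo 0 d, f v) / ENNReal.ofReal d,
    fun i => measurable_glue hBm fun q => (hshift _).comp (hθm q),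
    measurable_glue hBm fun q => hfm.comp (hθm q), fun i Φ hΦ => ?_, ?_, fun c => ?_,
    fun Φ hΦ => ?_⟩
  · rw [setLIntegral_glue hBm hBd hBA, tsum_fintype, ← hlaw Φ hΦ,
      setLIntegral_Ioo_nat_mul (H := fun v => Φ (f v)) hd0 (hΦ.comp hfm),
      ← Equiv.sum_comp (Equiv.addRight i) fun j : Fin n =>
        ∫⁻ v in Set.Ioo 0 d, Φ (f (v + j * d))]
    refine Finset.sum_congr rfl fun q _ => ?_
    exact hθ q (fun v => Φ (f (v + (q + i : Fin n) * d))) (hΦ.comp (hshift _))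
  · have h1 : ∀ q, ∀ᵐ s ∂lebUnit, s ∈ B q → θ q s ∈ Set.Ioo 0 d := by
      intro q
      have h2 := hθ q ((Set.Ioo 0 d)ᶜ.indicator 1) (measurable_one.indicator measurableSet_Ioo.compl)
      rw [setLIntegral_indicator measurableSet_Ioo.compl, Set.compl_inter_self] at h2
      have hm0 : Measurable fun s => ((Set.Ioo 0 d)ᶜ.indicator 1 (θ q s) : ℝ≥0∞) :=
        (measurable_one.indicator measurableSet_Ioo.compl).comp (hθm q)
      rw [Measure.restrict_empty, lintegral_zero_measure, lintegral_eq_zero_iff hm0,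
        Filter.EventuallyEq, ae_restrict_iff' (hBm q)] at h2
      filter_upwards [h2] with s hs hsB
      by_contra hcon
      have := hs hsB
      rw [Set.indicator_of_mem (show θ q s ∈ (Set.Ioo 0 d)ᶜ from hcon)] at this
      exact one_ne_zero this
    filter_upwards [ae_all_iff.2 h1, hBA.mem_iff] with s hs hs' hsA
    obtain ⟨q, hq⟩ := Set.mem_iUnion.1 (hs'.1 hsA)
    have hsum : ∑ i, z i s = stepSum f n d (θ q s) := by
      rw [stepSum, ← Equiv.sum_comp (Equiv.addLeft q) fun j : Fin n => f (θ q s + j * d)]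
      exact Finset.sum_congr rfl fun i _ => glue_eq hBd _ hq
    have he : e s = f (θ q s) := glue_eq hBd _ hq
    rw [hsum, he]
    refine stepSum_bounds hfa hn (hs q hq) ?_
    have := hlaw id measurable_id
    simp only [id] at this
    rw [this, hr, hnd, hlA]
  -- Jensen's inequality: the constant e' is the mean of e over A.
  · rw [heΦ (fun s => s - c) (measurable_id.sub_const c), lintegral_const,
      Measure.restrict_apply_univ, hlA, ← hnd, ENNReal.ofReal_mul hn0.le, ENNReal.ofReal_natCast,
      mul_left_comm]
    refine mul_le_mul_right ?_ _
    rw [ENNReal.sub_mul fun _ _ => ENNReal.ofReal_ne_top, tsub_le_iff_left]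
    refine (ennreal_div_mul_le _ _).trans ?_
    have : c * ENNReal.ofReal d = ∫⁻ _ in Set.Ioo (0:ℝ) d, c := by simp
    rw [this, ← lintegral_add_left measurable_const]
    exact lintegral_mono fun v => le_add_tsub
  · rw [heΦ Φ hΦ, ← hlaw Φ hΦ]
    refine mul_le_mul_right (lintegral_mono_set (Set.Ioo_subset_Ioo_right ?_)) _
    rw [hnd, hd]
    exact div_le_self ENNReal.toReal_nonneg (by exact_mod_cast hn)

/-- The level sets of the countably valued function `p` decompose Lebesgue measure into parts over
which `X` has the averages prescribed by `p`. -/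
theorem IsMajorizedPair.exists_level_measures {X p : ℝ → ℝ≥0∞} (hp : Measurable p)
    (h : IsMajorizedPair X (decRearr lebUnit p)) {r : ℕ → ℝ≥0∞} (hr : Function.Injective r)
    (hpr : ∀ᵐ u ∂lebUnit, p u ∈ Set.range r) :
    ∃ ν : ℕ → Measure ℝ, (∀ j, ν j Set.univ = lebUnit (p ⁻¹' {r j})) ∧
      (∀ Φ : ℝ → ℝ≥0∞, Measurable Φ → ∑' j, ∫⁻ u, Φ u ∂ν j = ∫⁻ u, Φ u ∂lebUnit) ∧
      ∀ j, ∫⁻ u, X u ∂ν j = r j * lebUnit (p ⁻¹' {r j}) := by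
  obtain ⟨π, hfst, hsnd, hXY⟩ := h.exists_coupling_eq
  set Y := decRearr lebUnit p with hY
  have hYm : Measurable Y := measurable_decRearr _ _
  have hXm := h.antitone_left.measurable
  have hmap : lebUnit.map Y = lebUnit.map p := map_decRearr hp lebUnit_univ_eq
  let I : ℕ → Set ℝ := fun j => Y ⁻¹' {r j}
  have hIm : ∀ j, MeasurableSet (I j) := fun j => hYm (measurableSet_singleton _)
  have hIp : ∀ j, lebUnit (I j) = lebUnit (p ⁻¹' {r j}) := by
    intro j
    rw [← Measure.map_apply hp (measurableSet_singleton _), ← hmap,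
      Measure.map_apply hYm (measurableSet_singleton _)]
  have hId : Pairwise (Function.onFun Disjoint I) := by
    intro i j hij
    refine Set.disjoint_left.2 fun s hi hj => hij (hr ?_)
    exact (show Y s = r i from hi).symm.trans hj
  have hran : MeasurableSet (Set.range r) := (Set.countable_range r).measurableSet
  have hYr : ∀ᵐ u ∂lebUnit, Y u ∈ Set.range r := by
    have h1 := (ae_map_iff (p := (· ∈ Set.range r)) hp.aemeasurable hran).2 hpr
    rw [← hmap] at h1
    exact (ae_map_iff hYm.aemeasurable hran).1 h1
  have hIs : ∀ j, MeasurableSet (Prod.snd ⁻¹' I j : Set (ℝ × ℝ)) := fun j => measurable_snd (hIm j)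
  -- The j-th measure collects the source points that the coupling sends into the j-th level set of
  -- p*. That set has the same measure as the corresponding level set of p.
  refine ⟨fun j => (π.restrict (Prod.snd ⁻¹' I j)).map Prod.fst, fun j => ?_, fun Φ hΦ => ?_,
    fun j => ?_⟩
  · rw [Measure.map_apply measurable_fst .univ, Set.preimage_univ, Measure.restrict_apply_univ,
      ← Measure.map_apply measurable_snd (hIm j), hsnd, hIp]
  · have hcov : (Set.univ : Set (ℝ × ℝ)) =ᵐ[π] ⋃ j, Prod.snd ⁻¹' I j := by
      rw [← hsnd] at hYr
      refine (eventuallyEq_univ.2 ?_).symm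
      filter_upwards [ae_of_ae_map measurable_snd.aemeasurable hYr] with q hq
      obtain ⟨j, hj⟩ := hq
      exact Set.mem_iUnion.2 ⟨j, hj.symm⟩
    rw [← hfst, lintegral_map hΦ measurable_fst, ← setLIntegral_univ, setLIntegral_congr hcov,
      lintegral_iUnion hIs (fun i j hij => (hId hij).preimage _)]
    exact tsum_congr fun j => lintegral_map hΦ measurable_fst
  · rw [lintegral_map hXm measurable_fst, hXY _ (hIm j), ← hIp,
      setLIntegral_congr_fun (hIm j) (fun s hs => show Y s = r j from hs), lintegral_const,
      Measure.restrict_apply_univ]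

/-- A countably valued function majorized by `X` is approximated by an average of functions
equimeasurable with `X`. -/
theorem IsMajorizedPair.exists_shuffles {X p : ℝ → ℝ≥0∞} (hp : Measurable p)
    (h : IsMajorizedPair X (decRearr lebUnit p)) {r : ℕ → ℝ≥0∞} (hr : Function.Injective r)
    (hpr : ∀ᵐ u ∂lebUnit, p u ∈ Set.range r) {n : ℕ} (hn : 0 < n) :
    ∃ (z : Fin n → ℝ → ℝ≥0∞) (e e' : ℝ → ℝ≥0∞), (∀ i, Measurable (z i)) ∧ Measurable e ∧
      Measurable e' ∧ (∀ i, lebUnit.map (z i) = lebUnit.map X) ∧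
      (∀ᵐ s ∂lebUnit, ∑ i, z i s ≤ n * p s + e s ∧ n * p s ≤ ∑ i, z i s + e' s) ∧
      (∀ c, excess e' c ≤ excess e c) ∧
      ∀ c, lebUnit {s | c < e s} ≤ n * lebUnit {u | c < X u} := by
  obtain ⟨ν, hν, hνsum, hνX⟩ := h.exists_level_measures hp hr hpr
  have hXm := h.antitone_left.measurable
  let A : ℕ → Set ℝ := fun j => p ⁻¹' {r j}
  have hAm : ∀ j, MeasurableSet (A j) := fun j => hp (measurableSet_singleton _)
  have hAd : Pairwise (Function.onFun Disjoint A) := by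
    intro i j hij
    refine Set.disjoint_left.2 fun s hi hj => hij (hr ?_)
    exact (show p s = r i from hi).symm.trans hj
  have hcov : (Set.univ : Set ℝ) =ᵐ[lebUnit] ⋃ j, A j := by
    refine (eventuallyEq_univ.2 ?_).symm
    filter_upwards [hpr] with s hs
    obtain ⟨j, hj⟩ := hs
    exact Set.mem_iUnion.2 ⟨j, hj.symm⟩
  choose z e e' hzm hem hzΦ hbd hex heΦ using fun j =>
    exists_shuffles_on (hAm j) (hν j) hXm (hνX j) hn
  have hglue : ∀ (g : ℕ → ℝ → ℝ≥0∞) (Φ : ℝ≥0∞ → ℝ≥0∞),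
      ∫⁻ s, Φ (glue A g s) ∂lebUnit = ∑' j, ∫⁻ s in A j, Φ (g j s) ∂lebUnit := by
    intro g Φ
    rw [← setLIntegral_univ]
    exact setLIntegral_glue hAm hAd hcov g Φ
  refine ⟨fun i => glue A fun j => z j i, glue A e, glue A fun j _ => e' j,
    fun i => measurable_glue hAm fun j => hzm j i, measurable_glue hAm hem,
    measurable_glue hAm fun j => measurable_const, fun i => ?_, ?_, fun c => ?_, fun c => ?_⟩
  · have hgm : Measurable (glue A fun j => z j i) := measurable_glue hAm fun j => hzm j i
    refine Measure.ext fun S hS => ?_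
    have hΦ : Measurable (S.indicator (1 : ℝ≥0∞ → ℝ≥0∞)) := measurable_one.indicator hS
    rw [← lintegral_indicator_one hS, ← lintegral_indicator_one hS, lintegral_map hΦ hgm,
      lintegral_map hΦ hXm, hglue,
      ← hνsum (fun u => S.indicator (1 : ℝ≥0∞ → ℝ≥0∞) (X u)) (hΦ.comp hXm)]
    exact tsum_congr fun j => hzΦ j i _ hΦ
  · filter_upwards [ae_all_iff.2 hbd, hpr] with s hs ⟨j, hj⟩
    have hsA : s ∈ A j := hj.symm
    have h1 := hs j hsA
    simp only [glue_eq hAd _ hsA, ← hj]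
    exact h1
  · rw [excess, excess, hglue _ fun s => s - c, hglue _ fun s => s - c]
    exact ENNReal.tsum_le_tsum fun j => hex j c
  · have hΦ : Measurable ((Set.Ioi c).indicator (1 : ℝ≥0∞ → ℝ≥0∞)) :=
      measurable_one.indicator measurableSet_Ioi
    have key : ∀ {g : ℝ → ℝ≥0∞}, Measurable g → lebUnit {s | c < g s} =
        ∫⁻ s, (Set.Ioi c).indicator (1 : ℝ≥0∞ → ℝ≥0∞) (g s) ∂lebUnit := by
      intro g hg
      rw [← lintegral_indicator_one (measurableSet_lt measurable_const hg)]
      rfl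
    rw [key (measurable_glue hAm hem), key hXm, hglue,
      ← hνsum (fun u => (Set.Ioi c).indicator (1 : ℝ≥0∞ → ℝ≥0∞) (X u)) (hΦ.comp hXm),
      ← ENNReal.tsum_mul_left]
    exact ENNReal.tsum_le_tsum fun j => heΦ j _ hΦ

/-! ### Norm estimates in fully symmetric spaces -/

theorem coeFn_sum {ι : Type*} (s : Finset ι) (f : ι → L0Unit) :
    (∑ i ∈ s, f i : L0Unit) =ᵐ[lebUnit] fun u => ∑ i ∈ s, f i u := by
  classical
  induction s using Finset.induction_on with
  | empty =>
    simp only [Finset.sum_empty]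
    exact AEEqFun.coeFn_zero
  | insert i s hi ih =>
    rw [Finset.sum_insert hi]
    filter_upwards [AEEqFun.coeFn_add (f i) (∑ i ∈ s, f i), ih] with u h1 h2
    rw [h1, Pi.add_apply, h2, Finset.sum_insert hi]

theorem excess_mono {f g : ℝ → ℝ≥0∞} (h : ∀ᵐ u ∂lebUnit, f u ≤ g u) (c : ℝ≥0∞) :
    excess f c ≤ excess g c :=
  lintegral_mono_ae (h.mono fun _ hu => tsub_le_tsub_right hu c)

theorem excess_const (k c : ℝ≥0∞) : excess (fun _ => k) c = k - c := by
  rw [excess, lintegral_const, measure_univ, mul_one]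

/-- Jensen's inequality on a probability space; it makes constants of at most the mean of |y|
submajorized by y. -/
theorem lintegral_sub_le_excess (g : ℝ → ℝ≥0∞) (c : ℝ≥0∞) :
    ∫⁻ u, g u ∂lebUnit - c ≤ excess g c := by
  rw [tsub_le_iff_left]
  calc ∫⁻ u, g u ∂lebUnit ≤ ∫⁻ u, (c + (g u - c)) ∂lebUnit := lintegral_mono fun u => le_add_tsub
    _ = c + excess g c := by
      rw [lintegral_add_left measurable_const, lintegral_const, measure_univ, mul_one]; rfl

theorem eabs_smul (a : ℝ) (y : L0Unit) :
    eabs (a • y) =ᵐ[lebUnit] fun u => ENNReal.ofReal |a| * eabs y u := by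
  filter_upwards [AEEqFun.coeFn_smul a y] with u h
  rw [eabs, h, Pi.smul_apply, smul_eq_mul, enorm_mul, eabs, Real.enorm_eq_ofReal_abs]

theorem eabs_add_le (y z : L0Unit) :
    ∀ᵐ u ∂lebUnit, eabs (y + z) u ≤ eabs y u + eabs z u := by
  filter_upwards [AEEqFun.coeFn_add y z] with u h
  rw [eabs, h]
  exact enorm_add_le _ _

theorem excess_convex {a b : ℝ} (ha : 0 ≤ a) (hb : 0 ≤ b) (hab : a + b = 1) (y z : L0Unit)
    (c : ℝ≥0∞) : excess (eabs (a • y + b • z)) c ≤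
      ENNReal.ofReal a * excess (eabs y) c + ENNReal.ofReal b * excess (eabs z) c := by
  have hm₁ : Measurable fun u => eabs y u - c := (measurable_eabs y).sub_const c
  have hm₂ : Measurable fun u => eabs z u - c := (measurable_eabs z).sub_const c
  have hAB : ENNReal.ofReal a + ENNReal.ofReal b = 1 := by
    rw [← ENNReal.ofReal_add ha hb, hab, ENNReal.ofReal_one]
  rw [excess, excess, excess, ← lintegral_const_mul _ hm₁, ← lintegral_const_mul _ hm₂,
    ← lintegral_add_left (hm₁.const_mul _)]
  refine lintegral_mono_ae ?_
  filter_upwards [eabs_add_le (a • y) (b • z), eabs_smul a y, eabs_smul b z] with u h1 h2 h3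
  rw [h2, h3, abs_of_nonneg ha, abs_of_nonneg hb] at h1
  rw [tsub_le_iff_right]
  refine h1.trans ?_
  calc ENNReal.ofReal a * eabs y u + ENNReal.ofReal b * eabs z u
      ≤ ENNReal.ofReal a * (eabs y u - c + c) + ENNReal.ofReal b * (eabs z u - c + c) := by
        gcongr <;> exact le_tsub_add
    _ = ENNReal.ofReal a * (eabs y u - c) + ENNReal.ofReal b * (eabs z u - c) +
        (ENNReal.ofReal a + ENNReal.ofReal b) * c := by ring
    _ = _ := by rw [hAB, one_mul]

theorem excess_le_add (y z : L0Unit) (c : ℝ≥0∞) :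
    excess (eabs y) c ≤ excess (eabs z) c + ∫⁻ u, eabs (y - z) u ∂lebUnit := by
  rw [excess, excess, ← lintegral_add_right _ (measurable_eabs _)]
  refine lintegral_mono_ae ?_
  filter_upwards [eabs_add_le z (y - z)] with u h
  rw [add_sub_cancel] at h
  rw [tsub_le_iff_right]
  refine h.trans ?_
  rw [add_right_comm]
  exact add_le_add le_tsub_add le_rfl

/-- The constant function `1`. -/
noncomputable def oneL0 : L0Unit := ofFun (fun _ => 1) measurable_const

theorem eabs_oneL0 : eabs oneL0 =ᵐ[lebUnit] fun _ => 1 :=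
  eabs_ofFun measurable_const (Eventually.of_forall fun _ => ENNReal.one_lt_top)

theorem eabs_smul_oneL0 {k : ℝ} (hk : 0 ≤ k) :
    eabs (k • oneL0) =ᵐ[lebUnit] fun _ => ENNReal.ofReal k := by
  filter_upwards [eabs_smul k oneL0, eabs_oneL0] with u h1 h2
  rw [h1, h2, mul_one, abs_of_nonneg hk]

theorem integrable_of_lintegral_eabs {y : L0Unit} (h : ∫⁻ u, eabs y u ∂lebUnit ≠ ⊤) :
    Integrable y lebUnit :=
  ⟨y.aestronglyMeasurable, lt_top_iff_ne_top.2 h⟩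

theorem eq_zero_of_lintegral_eabs {y : L0Unit} (h : ∫⁻ u, eabs y u ∂lebUnit = 0) : y = 0 := by
  rw [lintegral_eq_zero_iff (measurable_eabs y)] at h
  refine AEEqFun.ext ?_
  filter_upwards [h, AEEqFun.coeFn_zero (μ := lebUnit) (β := ℝ)] with u h1 h2
  rw [h2]
  exact enorm_eq_zero.1 h1

theorem excess_smul_oneL0_le {k : ℝ} (hk : 0 ≤ k) {y : L0Unit}
    (h : ENNReal.ofReal k ≤ ∫⁻ u, eabs y u ∂lebUnit) (c : ℝ≥0∞) :
    excess (eabs (k • oneL0)) c ≤ excess (eabs y) c := by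
  rw [excess_congr (eabs_smul_oneL0 hk), excess_const]
  exact (tsub_le_tsub_right h c).trans (lintegral_sub_le_excess _ _)

theorem integrable_smul_oneL0 {k : ℝ} (hk : 0 ≤ k) : Integrable (k • oneL0 : L0Unit) lebUnit := by
  refine integrable_of_lintegral_eabs ?_
  rw [lintegral_congr_ae (eabs_smul_oneL0 hk)]
  simp

namespace NormedFunctionSpace

variable {E : NormedFunctionSpace}

theorem toL0_injective {y z : E} (h : toL0 y = toL0 z) : y = z := Subtype.ext h

theorem toL0_add (y z : E) : toL0 (y + z) = toL0 y + toL0 z := rfl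

theorem toL0_sub (y z : E) : toL0 (y - z) = toL0 y - toL0 z := rfl

theorem toL0_smul (c : ℝ) (y : E) : toL0 (c • y) = c • toL0 y := rfl

theorem toL0_zero : toL0 (0 : E) = 0 := rfl

theorem norm_real_smul (c : ℝ) (y : E) : ‖c • y‖ = |c| * ‖y‖ := E.norm_smul c y

theorem toL0_sum {ι : Type*} (s : Finset ι) (f : ι → E) :
    toL0 (∑ i ∈ s, f i) = ∑ i ∈ s, toL0 (f i) := by
  classical
  induction s using Finset.induction_on with
  | empty => rfl
  | insert i s hi ih => rw [Finset.sum_insert hi, Finset.sum_insert hi, toL0_add, ih]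

theorem extNorm_toL0 (y : E) : E.extNorm (toL0 y) = ENNReal.ofReal ‖y‖ := by
  have : toL0 y ∈ E.toSubmodule := y.2
  rw [extNorm, iInf_pos this]
  rfl

theorem exists_of_extNorm_lt_top {y : L0Unit} (h : E.extNorm y < ⊤) : ∃ z : E, toL0 z = y := by
  by_contra! hcon
  have : y ∉ E.toSubmodule := fun hy => hcon (E.elem y hy) rfl
  rw [extNorm, iInf_neg this] at h
  exact lt_irrefl _ h

namespace IsFullySymmetric

theorem exists_of_submajorized (hE : E.IsFullySymmetric) (x : E) {y : L0Unit} (hyi : Integrable y lebUnit)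
    (h : Submajorized y (toL0 x)) : ∃ z : E, toL0 z = y ∧ ‖z‖ ≤ ‖x‖ := by
  obtain ⟨hy, hn⟩ := hE.submajorization x y hyi h
  exact ⟨E.elem y hy, rfl, hn⟩

/-- A positive constant not exceeding the mean of |x| is submajorized by x. The minimum with 1 is
taken because finiteness of that mean is only proved afterwards. -/
theorem exists_one (hE : E.IsFullySymmetric) {x : E} (hx : toL0 x ≠ 0) : ∃ e : E, toL0 e = oneL0 := by
  have h0 : ∫⁻ u, eabs (toL0 x) u ∂lebUnit ≠ 0 := fun h => hx (eq_zero_of_lintegral_eabs h)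
  set k : ℝ := (min (∫⁻ u, eabs (toL0 x) u ∂lebUnit) 1).toReal with hk
  have hmin : min (∫⁻ u, eabs (toL0 x) u ∂lebUnit) 1 ≠ ⊤ :=
    ne_top_of_le_ne_top ENNReal.one_ne_top (min_le_right _ _)
  have hk0 : 0 < k := ENNReal.toReal_pos
    (lt_min (pos_iff_ne_zero.2 h0) one_pos).ne' hmin
  have hkle : ENNReal.ofReal k ≤ ∫⁻ u, eabs (toL0 x) u ∂lebUnit := by
    rw [hk, ENNReal.ofReal_toReal hmin]; exact min_le_left _ _
  obtain ⟨z, hz, -⟩ := hE.exists_of_submajorized x (integrable_smul_oneL0 hk0.le)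
    (submajorized_of_excess_le (excess_smul_oneL0_le hk0.le hkle))
  refine ⟨k⁻¹ • z, ?_⟩
  rw [toL0_smul, hz, smul_smul, inv_mul_cancel₀ hk0.ne', one_smul]

/-- The source of the continuous embedding of E into L1. Allowing every k below the mean also lets
it prove that the mean is finite. -/
theorem mul_norm_one_le (hE : E.IsFullySymmetric) {e : E} (he : toL0 e = oneL0) (y : E) {k : ℝ} (hk : 0 ≤ k)
    (h : ENNReal.ofReal k ≤ ∫⁻ u, eabs (toL0 y) u ∂lebUnit) : k * ‖e‖ ≤ ‖y‖ := by
  obtain ⟨z, hz, hzn⟩ := hE.exists_of_submajorized y (integrable_smul_oneL0 hk)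
    (submajorized_of_excess_le (excess_smul_oneL0_le hk h))
  have : z = k • e := toL0_injective (by rw [hz, toL0_smul, he])
  rwa [this, norm_real_smul, abs_of_nonneg hk] at hzn

theorem norm_one_pos {e : E} (he : toL0 e = oneL0) : 0 < ‖e‖ := by
  rw [norm_pos_iff]
  rintro rfl
  have h1 := eabs_oneL0
  rw [← he, toL0_zero] at h1
  have h2 : ∀ᵐ u ∂lebUnit, False := by
    filter_upwards [h1, AEEqFun.coeFn_zero (μ := lebUnit) (β := ℝ)] with u h3 h4
    rw [eabs, h4] at h3
    simp at h3
  have h3 := ae_eq_bot.1 (eventually_false_iff_eq_bot.1 h2)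
  have h4 := measure_univ (μ := lebUnit)
  rw [h3] at h4
  simp at h4

theorem lintegral_ne_top (hE : E.IsFullySymmetric) {e : E} (he : toL0 e = oneL0) (y : E) :
    ∫⁻ u, eabs (toL0 y) u ∂lebUnit ≠ ⊤ := by
  intro htop
  have hpos := norm_one_pos he
  have h := hE.mul_norm_one_le he y (k := (‖y‖ + 1) / ‖e‖) (by positivity) (htop ▸ le_top)
  rw [div_mul_cancel₀ _ hpos.ne'] at h
  linarith

theorem lintegral_le (hE : E.IsFullySymmetric) {e : E} (he : toL0 e = oneL0) (y : E) :
    ∫⁻ u, eabs (toL0 y) u ∂lebUnit ≤ ENNReal.ofReal (‖y‖ / ‖e‖) := by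
  have htop := hE.lintegral_ne_top he y
  rw [← ENNReal.ofReal_toReal htop]
  refine ENNReal.ofReal_le_ofReal ?_
  rw [le_div_iff₀ (norm_one_pos he)]
  exact hE.mul_norm_one_le he y ENNReal.toReal_nonneg (ENNReal.ofReal_toReal htop).le

theorem exists_of_excess_le (hE : E.IsFullySymmetric) {e : E} (he : toL0 e = oneL0) (x : E) {y : L0Unit}
    (h : ∀ c, excess (eabs y) c ≤ excess (eabs (toL0 x)) c) :
    ∃ z : E, toL0 z = y ∧ ‖z‖ ≤ ‖x‖ := by
  refine hE.exists_of_submajorized x (integrable_of_lintegral_eabs ?_) (submajorized_of_excess_le h)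
  have := h 0
  rw [excess_zero, excess_zero] at this
  exact ne_top_of_le_ne_top (hE.lintegral_ne_top he x) this

theorem norm_le_of_excess_le (hE : E.IsFullySymmetric) {e : E} (he : toL0 e = oneL0) {x y : E}
    (h : ∀ c, excess (eabs (toL0 y)) c ≤ excess (eabs (toL0 x)) c) : ‖y‖ ≤ ‖x‖ := by
  obtain ⟨z, hz, hn⟩ := hE.exists_of_excess_le he x h
  rwa [toL0_injective hz] at hn

/-- The closed hull of the extreme points is contained in the orbit. -/
theorem closedHull_subset (hE : E.IsFullySymmetric) {e : E} (he : toL0 e = oneL0) {x : E} (hx : 0 ≤ toL0 x) :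
    toL0 '' closedHullExtremePoints E (toL0 x) ⊆ substochasticOrbit (toL0 x) := by
  rintro _ ⟨y, hy, rfl⟩
  have hxi := hE.lintegral_ne_top he x
  rw [mem_substochasticOrbit_iff hx hxi]
  -- This is the orbit seen inside E. It is convex, and both defining conditions survive L1 limits,
  -- hence limits in the norm of E.
  set S : Set E := {z | 0 ≤ toL0 z ∧ ∀ c, excess (eabs (toL0 z)) c ≤ excess (eabs (toL0 x)) c}
  have hS : Convex ℝ S := by
    intro z₁ h₁ z₂ h₂ a b ha hb hab
    refine ⟨?_, fun c => ?_⟩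
    · rw [toL0_add, toL0_smul, toL0_smul, ← AEEqFun.coeFn_le]
      filter_upwards [AEEqFun.coeFn_add (a • toL0 z₁) (b • toL0 z₂),
        AEEqFun.coeFn_smul a (toL0 z₁), AEEqFun.coeFn_smul b (toL0 z₂), ae_nonneg h₁.1,
        ae_nonneg h₂.1, AEEqFun.coeFn_zero (μ := lebUnit) (β := ℝ)] with u e1 e2 e3 e4 e5 e6
      rw [e1, Pi.add_apply, e2, e3, e6, Pi.smul_apply, Pi.smul_apply, smul_eq_mul, smul_eq_mul]
      simp only [Pi.zero_apply]
      positivity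
    · rw [toL0_add, toL0_smul, toL0_smul]
      refine (excess_convex ha hb hab _ _ c).trans ?_
      calc _ ≤ ENNReal.ofReal a * excess (eabs (toL0 x)) c +
            ENNReal.ofReal b * excess (eabs (toL0 x)) c := by
            gcongr
            · exact h₁.2 c
            · exact h₂.2 c
        _ = _ := by
          rw [← add_mul, ← ENNReal.ofReal_add ha hb, hab, ENNReal.ofReal_one, one_mul]
  have hsub : convexHull ℝ {z : E | toL0 z ∈ (substochasticOrbit (toL0 x)).extremePoints ℝ} ⊆ S :=
    convexHull_min (fun z hz => (mem_substochasticOrbit_iff hx hxi _).1 hz.1) hS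
  have happ : ∀ δ > 0, ∃ z ∈ S, ∫⁻ u, eabs (toL0 y - toL0 z) u ∂lebUnit ≤ ENNReal.ofReal δ := by
    intro δ hδ
    have hpos := norm_one_pos he
    obtain ⟨z, hz, hyz⟩ := Metric.mem_closure_iff.1 hy (δ * ‖e‖) (by positivity)
    refine ⟨z, hsub hz, (hE.lintegral_le he (y - z)).trans (ENNReal.ofReal_le_ofReal ?_)⟩
    rw [div_le_iff₀ hpos, ← dist_eq_norm]
    exact hyz.le
  constructor
  · have h0 : ∫⁻ u, ENNReal.ofReal (-(toL0 y u)) ∂lebUnit = 0 := by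
      refine le_antisymm (ENNReal.le_of_forall_pos_le_add fun δ hδ _ => ?_) bot_le
      obtain ⟨z, hz, hyz⟩ := happ δ hδ
      rw [zero_add]
      refine le_trans (lintegral_mono_ae ?_) (hyz.trans (by simp))
      filter_upwards [ae_nonneg hz.1, AEEqFun.coeFn_sub (toL0 y) (toL0 z)] with u h1 h2
      rw [eabs, h2, Real.enorm_eq_ofReal_abs]
      refine ENNReal.ofReal_le_ofReal (le_trans ?_ (neg_le_abs _))
      rw [Pi.sub_apply]
      linarith
    have hm : Measurable fun u => ENNReal.ofReal (-(toL0 y u)) :=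
      (toL0 y).measurable.neg.ennreal_ofReal
    rw [lintegral_eq_zero_iff hm] at h0
    rw [← AEEqFun.coeFn_le]
    filter_upwards [h0, AEEqFun.coeFn_zero (μ := lebUnit) (β := ℝ)] with u h1 h2
    rw [h2]
    have := ENNReal.ofReal_eq_zero.1 h1
    simpa using this
  · intro c
    refine ENNReal.le_of_forall_pos_le_add fun δ hδ _ => ?_
    obtain ⟨z, hz, hyz⟩ := happ δ hδ
    refine (excess_le_add _ (toL0 z) c).trans (add_le_add (hz.2 c) (hyz.trans (by simp)))

end IsFullySymmetric

end NormedFunctionSpace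

/-! ### Distribution of the dilated rearrangement -/

theorem eabs_dilatedRearrangement {x : L0Unit} {τ : ℝ} (hτ : 1 ≤ τ) :
    eabs (dilatedRearrangement τ x) =ᵐ[lebUnit] fun u => decRearr lebUnit (eabs x) (u / τ) := by
  have h1 : dilatedRearrangement τ x =ᵐ[lebUnit] dilatedRearrangementFun τ x :=
    AEEqFun.coeFn_mk _ _
  filter_upwards [h1, ae_restrict_mem measurableSet_Ioo] with u h2 h3
  rw [eabs, h2, dilatedRearrangementFun, if_pos (h3.2.le.trans hτ),
    Real.enorm_of_nonneg ENNReal.toReal_nonneg]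
  refine ENNReal.ofReal_toReal (ne_of_lt ?_)
  exact decRearr_lt_top (measurable_eabs x) (Eventually.of_forall (eabs_lt_top x))
    (div_pos h3.1 (by linarith))

/-- Dilation by n multiplies the measure of each superlevel set by n, up to truncation at the length
1 of the interval. -/
theorem min_le_measure_dilatedRearrangement (x : L0Unit) {n : ℕ} (hn : 0 < n) (c : ℝ≥0∞) :
    min 1 (n * lebUnit {u | c < eabs x u}) ≤
      lebUnit {u | c < eabs (dilatedRearrangement n x) u} := by
  have hn1 : (1:ℝ) ≤ n := by exact_mod_cast hn
  have h1 : lebUnit {u | c < eabs (dilatedRearrangement n x) u} =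
      lebUnit {u | c < decRearr lebUnit (eabs x) (u / n)} := by
    refine measure_congr ?_
    filter_upwards [eabs_dilatedRearrangement (x := x) hn1] with u hu
    exact propext (by
      change c < _ ↔ c < _
      rw [hu])
  rw [h1]
  set b := min 1 (n * lebUnit {u | c < eabs x u}) with hb
  have hb1 : b ≤ ENNReal.ofReal 1 := by rw [ENNReal.ofReal_one]; exact min_le_left _ _
  rw [← volume_restrict_ofReal_lt hb1]
  refine measure_mono fun u hu => ?_
  change c < decRearr lebUnit (eabs x) (u / n)
  rw [lt_decRearr_iff, ENNReal.ofReal_div_of_pos (by linarith), ENNReal.ofReal_natCast]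
  have h2 : ENNReal.ofReal u < n * lebUnit {u | c < eabs x u} :=
    lt_of_lt_of_le hu (min_le_right _ _)
  refine (ENNReal.div_lt_iff (Or.inl (by exact_mod_cast hn.ne'))
    (Or.inl (ENNReal.natCast_ne_top n))).2 ?_
  rwa [mul_comm]

theorem enorm_toReal_sub_le {a b : ℝ≥0∞} (ha : a ≠ ⊤) (hb : b ≠ ⊤) :
    ‖a.toReal - b.toReal‖ₑ ≤ max (a - b) (b - a) := by
  rcases le_total a b with h | h
  · rw [← enorm_neg, neg_sub, ← ENNReal.toReal_sub_of_le h hb,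
      Real.enorm_of_nonneg ENNReal.toReal_nonneg]
    exact ENNReal.ofReal_toReal_le.trans (le_max_right _ _)
  · rw [← ENNReal.toReal_sub_of_le h ha, Real.enorm_of_nonneg ENNReal.toReal_nonneg]
    exact ENNReal.ofReal_toReal_le.trans (le_max_left _ _)

/-! ### Approximation by averages of extreme points -/

theorem excess_eq_of_map_eq {f g : ℝ → ℝ≥0∞} (hf : Measurable f) (hg : Measurable g)
    (h : lebUnit.map f = lebUnit.map g) (c : ℝ≥0∞) : excess f c = excess g c := by
  have hm : Measurable fun v : ℝ≥0∞ => v - c := measurable_id.sub_const c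
  have h1 : excess f c = ∫⁻ v, (v - c) ∂(lebUnit.map f) := (lintegral_map hm hf).symm
  have h2 : excess g c = ∫⁻ v, (v - c) ∂(lebUnit.map g) := (lintegral_map hm hg).symm
  rw [h1, h2, h]

theorem excess_max_le {f g : ℝ → ℝ≥0∞} (hf : Measurable f) (c : ℝ≥0∞) :
    excess (fun u => max (f u) (g u)) c ≤ excess f c + excess g c := by
  have hm : Measurable fun u => f u - c := hf.sub_const c
  rw [excess, excess, excess, ← lintegral_add_left hm]
  refine lintegral_mono fun u => ?_
  rcases le_total (f u) (g u) with h | h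
  · simp only [max_eq_right h]
    exact le_add_self
  · simp only [max_eq_left h]
    exact le_self_add

/-- Pointwise 2(f - c)⁺ ≤ (2f - c)⁺. This absorbs the two error functions of the shuffles into twice
one dilation. -/
theorem two_mul_excess_le {f : ℝ → ℝ≥0∞} (hf : Measurable f) (c : ℝ≥0∞) :
    2 * excess f c ≤ excess (fun u => 2 * f u) c := by
  have hm : Measurable fun u => f u - c := hf.sub_const c
  rw [excess, excess, ← lintegral_const_mul _ hm]
  refine lintegral_mono fun u => ?_
  rcases le_total (f u) c with h | h
  · simp [tsub_eq_zero_of_le h]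
  · rcases eq_or_ne c ⊤ with rfl | hc
    · simp
    · refine ENNReal.le_sub_of_add_le_right hc ?_
      rw [two_mul, two_mul, add_assoc, tsub_add_cancel_of_le h]
      exact add_le_add tsub_le_self le_rfl

/-- Rounding down to a multiple of `η`. -/
theorem exists_step_approx {g : ℝ → ℝ≥0∞} (hg : Measurable g) (hfin : ∀ u, g u < ⊤) {η : ℝ}
    (hη : 0 < η) : ∃ (p : ℝ → ℝ≥0∞) (r : ℕ → ℝ≥0∞), Measurable p ∧ Function.Injective r ∧
      (∀ u, p u ∈ Set.range r) ∧ (∀ u, p u ≤ g u) ∧ ∀ u, g u ≤ p u + ENNReal.ofReal η := by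
  set r : ℕ → ℝ≥0∞ := fun j => ENNReal.ofReal (η * j) with hr
  have hnn : ∀ u, 0 ≤ (g u).toReal / η := fun u => div_nonneg ENNReal.toReal_nonneg hη.le
  refine ⟨fun u => r ⌊(g u).toReal / η⌋₊, r,
    (measurable_from_top (f := r)).comp (hg.ennreal_toReal.div_const η).nat_floor, ?_, fun u => ⟨_, rfl⟩,
    fun u => ?_, fun u => ?_⟩
  · intro i j hij
    have h1 : η * i = η * j :=
      (ENNReal.ofReal_eq_ofReal_iff (by positivity) (by positivity)).1 hij
    exact_mod_cast mul_left_cancel₀ hη.ne' h1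
  · have h1 := Nat.floor_le (hnn u)
    rw [le_div_iff₀ hη] at h1
    calc ENNReal.ofReal (η * ⌊(g u).toReal / η⌋₊) ≤ ENNReal.ofReal (g u).toReal :=
          ENNReal.ofReal_le_ofReal (by linarith)
      _ = g u := ENNReal.ofReal_toReal (hfin u).ne
  · have h1 := (Nat.lt_floor_add_one ((g u).toReal / η)).le
    rw [div_le_iff₀ hη] at h1
    calc g u = ENNReal.ofReal (g u).toReal := (ENNReal.ofReal_toReal (hfin u).ne).symm
      _ ≤ ENNReal.ofReal (η * ⌊(g u).toReal / η⌋₊ + η) :=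
        ENNReal.ofReal_le_ofReal (by linarith)
      _ = _ := ENNReal.ofReal_add (by positivity) hη.le

namespace NormedFunctionSpace.IsFullySymmetric

variable {E : NormedFunctionSpace}

/-- The first error comes from rounding y down to the countably valued p, the second from replacing
p by the mean of n shuffles. Each shuffle has the law of a truncation of X, so it is an extreme
point. -/
theorem exists_mem_convexHull_norm_sub_le (hE : E.IsFullySymmetric) {e : E}
    (he : toL0 e = oneL0) {x : E} (hx : 0 ≤ toL0 x) {n : ℕ} (hn : 0 < n) {w : E}
    (hw : toL0 w = dilatedRearrangement n (toL0 x)) {η : ℝ} (hη : 0 < η) {y : E}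
    (hy : toL0 y ∈ substochasticOrbit (toL0 x)) :
    ∃ z ∈ convexHull ℝ {z : E | toL0 z ∈ (substochasticOrbit (toL0 x)).extremePoints ℝ},
      ‖y - z‖ ≤ η * ‖e‖ + (n : ℝ)⁻¹ * (2 * ‖w‖) := by
  have hxi := hE.lintegral_ne_top he x
  obtain ⟨hy0, hyx⟩ := (mem_substochasticOrbit_iff hx hxi _).1 hy
  obtain ⟨p, r, hp, hr, hpr, hpy, hyp⟩ := exists_step_approx (measurable_eabs (toL0 y))
    (eabs_lt_top (toL0 y)) hη
  have hpfin : ∀ u, p u < ⊤ := fun u => (hpy u).trans_lt (eabs_lt_top _ u)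
  have hpE := eabs_ofFun hp (Eventually.of_forall hpfin)
  obtain ⟨pE, hpE', -⟩ := hE.exists_of_excess_le he y (y := ofFun p hp) fun c => by
    rw [excess_congr hpE]
    exact excess_mono (Eventually.of_forall hpy) c
  have hyp' : ‖y - pE‖ ≤ η * ‖e‖ := by
    rw [← abs_of_pos hη, ← norm_real_smul]
    refine hE.norm_le_of_excess_le he (excess_mono ?_)
    rw [toL0_sub, toL0_smul, he, hpE']
    filter_upwards [AEEqFun.coeFn_sub (toL0 y) (ofFun p hp), coeFn_ofFun p hp,
      coeFn_eq_toReal_eabs hy0, eabs_smul_oneL0 hη.le] with u h1 h2 h3 h4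
    rw [h4, eabs, h1, Pi.sub_apply, h2, h3]
    refine (enorm_toReal_sub_le (eabs_lt_top _ u).ne (hpfin u).ne).trans (max_le ?_ ?_)
    · exact tsub_le_iff_left.2 (hyp u)
    · rw [tsub_eq_zero_of_le (hpy u)]
      exact bot_le
  obtain ⟨β, -, hmaj⟩ := exists_majorizedPair hp (measurable_eabs (toL0 x)) hxi fun c =>
    (excess_mono (Eventually.of_forall hpy) c).trans (hyx c)
  set X := decRearr lebUnit (eabs (toL0 x)) with hX
  have hXβ : Measurable ((Set.Iio β).indicator X) :=
    (measurable_decRearr _ _).indicator measurableSet_Iio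
  obtain ⟨z, e₁, e₂, hz, he₁, -, hzmap, hsum, hexc, hmeas⟩ :=
    hmaj.exists_shuffles hp hr (Eventually.of_forall hpr) hn
  have hzexc : ∀ i c, excess (z i) c = excess ((Set.Iio β).indicator X) c := fun i c =>
    excess_eq_of_map_eq (hz i) hXβ (hzmap i) c
  have hzfin : ∀ i, ∀ᵐ u ∂lebUnit, z i u < ⊤ := fun i => by
    refine ae_lt_top (hz i) ?_
    have h1 := hzexc i 0
    rw [excess_zero, excess_zero] at h1
    rw [h1]
    exact hmaj.lintegral_ne_top
  have hzabs : ∀ i, eabs (ofFun (z i) (hz i)) =ᵐ[lebUnit] z i := fun i =>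
    eabs_ofFun (hz i) (hzfin i)
  have hzE : ∀ i, ∃ v : E, toL0 v = ofFun (z i) (hz i) ∧ ‖v‖ ≤ ‖x‖ := fun i =>
    hE.exists_of_excess_le he x fun c => by
      rw [excess_congr (hzabs i), hzexc, ← excess_decRearr (measurable_eabs (toL0 x))]
      exact excess_mono (Eventually.of_forall fun u => Set.indicator_le_self _ _ u) c
  choose v hv _ using hzE
  have hn0 : (n : ℝ) ≠ 0 := by exact_mod_cast hn.ne'
  refine ⟨∑ i, (n : ℝ)⁻¹ • v i, (convex_convexHull ℝ _).sum_mem (fun _ _ => by positivity) ?_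
    fun i _ => subset_convexHull ℝ _ ?_, ?_⟩
  · rw [Finset.sum_const, Finset.card_univ, Fintype.card_fin, nsmul_eq_mul, mul_inv_cancel₀ hn0]
  · change toL0 (v i) ∈ (substochasticOrbit (toL0 x)).extremePoints ℝ
    rw [hv i]
    refine mem_extremePoints_of_map_eq hx hxi (ofFun_nonneg _ _) (β := β) ?_
    rw [Measure.map_congr (hzabs i), hzmap i]
  set Z : E := ∑ i, (n : ℝ)⁻¹ • v i with hZ
  -- Pointwise |np - ∑ zᵢ| ≤ max(e₁, e₂). The superlevel sets of e₁ are at most n times those of X,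
  -- so e₁ is dominated by w, and the excesses of e₂ are at most those of e₁.
  have hD : ‖(n : ℝ) • (pE - Z)‖ ≤ 2 * ‖w‖ := by
    rw [show (2 : ℝ) = |2| by norm_num, ← norm_real_smul]
    refine hE.norm_le_of_excess_le he fun c => ?_
    have hle : excess (eabs (toL0 ((n : ℝ) • (pE - Z)))) c ≤
        excess (fun u => max (e₁ u) (e₂ u)) c := by
      refine excess_mono ?_ c
      rw [toL0_smul, toL0_sub, hpE', hZ, ← Finset.smul_sum, toL0_smul, toL0_sum]
      filter_upwards [AEEqFun.coeFn_smul (n : ℝ) (ofFun p hp - (n : ℝ)⁻¹ • ∑ i, toL0 (v i)),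
        AEEqFun.coeFn_sub (ofFun p hp) ((n : ℝ)⁻¹ • ∑ i, toL0 (v i)),
        AEEqFun.coeFn_smul (n : ℝ)⁻¹ (∑ i, toL0 (v i)), coeFn_sum Finset.univ fun i => toL0 (v i),
        coeFn_ofFun p hp, ae_all_iff.2 fun i => coeFn_ofFun (z i) (hz i), ae_all_iff.2 hzfin,
        hsum] with u h1 h2 h3 h4 h5 h6 h7 h8
      have h9 : ∑ i, toL0 (v i) u = (∑ i, z i u).toReal := by
        rw [ENNReal.toReal_sum fun i _ => (h7 i).ne]
        exact Finset.sum_congr rfl fun i _ => by rw [hv i, h6 i]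
      have h10 : (n : ℝ) * (p u).toReal = (n * p u).toReal := by simp
      have h11 : (n * p u : ℝ≥0∞) ≠ ⊤ := ENNReal.mul_ne_top (ENNReal.natCast_ne_top n) (hpfin u).ne
      have h12 : ∑ i, z i u ≠ ⊤ := (ENNReal.sum_lt_top.2 fun i _ => h7 i).ne
      rw [eabs, h1, Pi.smul_apply, h2, Pi.sub_apply, h3, Pi.smul_apply, h4, h5, h9, smul_eq_mul,
        smul_eq_mul, mul_sub, mul_inv_cancel_left₀ hn0, h10]
      refine (enorm_toReal_sub_le h11 h12).trans ?_
      rw [max_comm]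
      exact max_le_max (tsub_le_iff_left.2 h8.1) (tsub_le_iff_left.2 h8.2)
    have hdom : excess e₁ c ≤ excess (eabs (toL0 w)) c := by
      refine excess_le_of_measure_le he₁ (measurable_eabs _) (fun s => ?_) c
      rw [hw]
      refine le_trans (le_min prob_le_one ((hmeas s).trans ?_))
        (min_le_measure_dilatedRearrangement (toL0 x) hn s)
      refine mul_le_mul_right ?_ _
      have h1 := map_decRearr (measurable_eabs (toL0 x)) lebUnit_univ_eq
      have h2 : lebUnit {u | s < eabs (toL0 x) u} = lebUnit {u | s < X u} := by
        have := congrArg (fun μ => μ (Set.Ioi s)) h1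
        rw [Measure.map_apply (measurable_decRearr _ _) measurableSet_Ioi,
          Measure.map_apply (measurable_eabs _) measurableSet_Ioi] at this
        exact this.symm
      rw [h2]
      refine measure_mono fun u hu => ?_
      change s < X u
      exact lt_of_lt_of_le hu (Set.indicator_le_self (Set.Iio β) X u)
    have htwo : excess (eabs (toL0 ((2 : ℝ) • w))) c = excess (fun u => 2 * eabs (toL0 w) u) c := by
      refine excess_congr ?_ c
      filter_upwards [eabs_smul 2 (toL0 w)] with u hu
      rw [toL0_smul, hu]
      norm_num
    rw [htwo]
    refine hle.trans ((excess_max_le he₁ c).trans ?_)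
    refine le_trans ?_ (two_mul_excess_le (measurable_eabs _) c)
    rw [two_mul]
    exact add_le_add hdom ((hexc c).trans hdom)
  have hpZ : ‖pE - Z‖ ≤ (n : ℝ)⁻¹ * (2 * ‖w‖) := by
    rw [norm_real_smul, abs_of_nonneg (Nat.cast_nonneg n)] at hD
    rwa [le_inv_mul_iff₀ (by exact_mod_cast hn)]
  rw [← sub_add_sub_cancel y pE Z]
  exact (E.norm_triangle _ _).trans (add_le_add hyp' hpZ)

theorem orbit_subset_of_hasDilationLimit (hE : E.IsFullySymmetric) {e : E} (he : toL0 e = oneL0)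
    {x : E} (hx : 0 ≤ toL0 x) (hφ : E.HasDilationLimit (toL0 x) 0) :
    substochasticOrbit (toL0 x) ⊆ toL0 '' closedHullExtremePoints E (toL0 x) := by
  intro y₀ hy₀
  have hxi := hE.lintegral_ne_top he x
  obtain ⟨y, rfl, -⟩ := hE.exists_of_excess_le he x
    ((mem_substochasticOrbit_iff hx hxi _).1 hy₀).2
  refine ⟨y, Metric.mem_closure_iff.2 fun ε hε => ?_, rfl⟩
  have hpos := norm_one_pos he
  obtain ⟨n, hn, hlim⟩ : ∃ n : ℕ, 0 < n ∧
      E.extNorm (dilatedRearrangement n (toL0 x)) / n < ENNReal.ofReal (ε / 4) := by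
    have h1 := hφ.comp tendsto_natCast_atTop_atTop
    obtain ⟨n, h2, h3⟩ := (((tendsto_order.1 h1).2 (ENNReal.ofReal (ε / 4))
      (ENNReal.ofReal_pos.2 (by positivity))).and (eventually_gt_atTop 0)).exists
    refine ⟨n, h3, ?_⟩
    simpa [ENNReal.ofReal_natCast] using h2
  have hn' : (0 : ℝ) < n := by exact_mod_cast hn
  have hlt : E.extNorm (dilatedRearrangement n (toL0 x)) < ENNReal.ofReal (ε / 4 * n) := by
    rw [ENNReal.ofReal_mul (by positivity), ENNReal.ofReal_natCast]
    exact (ENNReal.div_lt_iff (Or.inl (by exact_mod_cast hn.ne'))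
      (Or.inl (ENNReal.natCast_ne_top n))).1 hlim
  obtain ⟨w, hw⟩ := exists_of_extNorm_lt_top (hlt.trans ENNReal.ofReal_lt_top)
  rw [← hw, extNorm_toL0, ENNReal.ofReal_lt_ofReal_iff (by positivity)] at hlt
  -- The rounding width makes the first error ε/2, and the choice of n makes the second less than
  -- ε/2.
  obtain ⟨z, hz, hyz⟩ := hE.exists_mem_convexHull_norm_sub_le he hx hn hw
    (η := ε / (2 * ‖e‖)) (by positivity) hy₀
  refine ⟨z, hz, ?_⟩
  rw [dist_eq_norm]
  have h1 : ε / (2 * ‖e‖) * ‖e‖ = ε / 2 := by field_simp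
  have h2 : (n : ℝ)⁻¹ * (2 * ‖w‖) < ε / 2 := by
    rw [inv_mul_lt_iff₀ hn']
    linarith
  rw [h1] at hyz
  exact hyz.trans_lt (by linarith)

end NormedFunctionSpace.IsFullySymmetric

/-! ### Convex combinations of extreme points concentrate on small sets -/

/-- The nonnegative function `z` captures a proportion `Λ` of the rearrangement of `x` on sets
of measure `O(t)` as `t → 0`, and its integral is at most `Λ ∫ |x|`. -/
def Concentrates (x z : L0Unit) (Λ : ℝ) (n : ℕ) (β : ℝ) : Prop :=
  0 ≤ Λ ∧ 0 < β ∧ ∫⁻ u, eabs z u ∂lebUnit ≤ ENNReal.ofReal Λ * ∫⁻ u, eabs x u ∂lebUnit ∧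
    ∀ t ∈ Set.Icc 0 β, ∃ A, MeasurableSet A ∧ lebUnit A ≤ n * ENNReal.ofReal t ∧
      ENNReal.ofReal Λ * ∫⁻ s in Set.Ioc 0 t, decRearr lebUnit (eabs x) s ≤
        ∫⁻ u in A, eabs z u ∂lebUnit

/-- With y* equal to X truncated at β > 0, the first part of y in sorted order carries exactly the
integral of X over (0, t), so Λ = n = 1. For β = 0 the function vanishes and Λ = 0. -/
theorem concentrates_of_mem_extremePoints {x y : L0Unit} (hx : 0 ≤ x)
    (hxi : ∫⁻ u, eabs x u ∂lebUnit ≠ ⊤) (hy : y ∈ (substochasticOrbit x).extremePoints ℝ) :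
    ∃ Λ n β, Concentrates x y Λ n β := by
  obtain ⟨β, hβ, h⟩ := decRearr_eq_of_mem_extremePoints hx hxi hy
  have hle : ∫⁻ u, eabs y u ∂lebUnit ≤ ∫⁻ u, eabs x u ∂lebUnit := by
    have := ((mem_substochasticOrbit_iff hx hxi y).1 hy.1).2 0
    rwa [excess_zero, excess_zero] at this
  rcases hβ.1.eq_or_lt with rfl | hβ0
  · refine ⟨0, 0, 1, le_rfl, one_pos, ?_, fun t ht => ⟨∅, MeasurableSet.empty, by simp, by simp⟩⟩
    rw [← lintegral_decRearr (measurable_eabs y), ← lintegral_congr_ae h,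
      lintegral_indicator measurableSet_Iio]
    have h0 : lebUnit.restrict (Set.Iio 0) = 0 := by
      rw [Measure.restrict_eq_zero, Measure.restrict_apply measurableSet_Iio,
        show Set.Iio (0 : ℝ) ∩ Set.Ioo 0 1 = ∅ from by
          ext u
          simp only [Set.mem_inter_iff, Set.mem_Iio, Set.mem_Ioo, Set.mem_empty_iff_false, iff_false]
          intro h
          linarith [h.1, h.2.1]]
      exact measure_empty
    rw [h0]
    simp
  -- Halving β keeps the closed range t ≤ β/2 strictly inside the truncation.
  · refine ⟨1, 1, β / 2, zero_le_one, by positivity, by simpa using hle, fun t ht => ?_⟩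
    have hτ := measurePreserving_ryffMap (measurable_eabs y)
    refine ⟨ryffMap (eabs y) ⁻¹' Set.Iic t, hτ.measurable measurableSet_Iic, ?_, ?_⟩
    · rw [hτ.measure_preimage measurableSet_Iic.nullMeasurableSet,
        lebUnit_Iic t ht.1 (by linarith [ht.2, hβ.2])]
      simp
    · rw [ENNReal.ofReal_one, one_mul, ← setLIntegral_Iic_decRearr]
      have h1 : ∫⁻ u in ryffMap (eabs y) ⁻¹' Set.Iic t, eabs y u ∂lebUnit =
          ∫⁻ u in Set.Iic t, decRearr lebUnit (eabs y) u ∂lebUnit := by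
        rw [← hτ.setLIntegral_comp_preimage measurableSet_Iic (measurable_decRearr _ _)]
        refine lintegral_congr_ae (ae_restrict_of_ae ?_)
        exact (decRearr_ryffMap (measurable_eabs y) (ne_top_of_le_ne_top hxi hle)).symm
      rw [h1, ← lintegral_congr_ae (ae_restrict_of_ae h)]
      refine (setLIntegral_congr_fun measurableSet_Iic fun u hu => ?_).le
      have hut : u ≤ t := hu
      have huβ : u ∈ Set.Iio β := by
        change u < β
        linarith [ht.2]
      rw [Set.indicator_of_mem huβ]

theorem eabs_convexCombination {a b : ℝ} (ha : 0 ≤ a) (hb : 0 ≤ b) {y z : L0Unit} (hy : 0 ≤ y)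
    (hz : 0 ≤ z) : 0 ≤ a • y + b • z ∧ eabs (a • y + b • z) =ᵐ[lebUnit]
      fun u => ENNReal.ofReal a * eabs y u + ENNReal.ofReal b * eabs z u := by
  have h : ∀ᵐ u ∂lebUnit, (a • y + b • z : L0Unit) u = a * y u + b * z u ∧
      0 ≤ a * y u ∧ 0 ≤ b * z u := by
    filter_upwards [AEEqFun.coeFn_add (a • y) (b • z), AEEqFun.coeFn_smul a y,
      AEEqFun.coeFn_smul b z, ae_nonneg hy, ae_nonneg hz] with u h1 h2 h3 h4 h5
    refine ⟨?_, mul_nonneg ha h4, mul_nonneg hb h5⟩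
    rw [h1, Pi.add_apply, h2, h3]
    rfl
  constructor
  · rw [← AEEqFun.coeFn_le]
    filter_upwards [h, AEEqFun.coeFn_zero (μ := lebUnit) (β := ℝ)] with u h1 h2
    rw [h1.1, h2]
    exact add_nonneg h1.2.1 h1.2.2
  · filter_upwards [h, ae_nonneg hy, ae_nonneg hz] with u h1 h2 h3
    rw [eabs, h1.1, Real.enorm_of_nonneg (add_nonneg h1.2.1 h1.2.2),
      ENNReal.ofReal_add h1.2.1 h1.2.2, ENNReal.ofReal_mul ha, ENNReal.ofReal_mul hb, eabs, eabs,
      Real.enorm_of_nonneg h2, Real.enorm_of_nonneg h3]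

/-- Take the union of the two sets. The proportion Λ combines linearly while n adds up; the growth
of n is harmless because z is fixed before s tends to infinity. -/
theorem Concentrates.convexCombination {x y z : L0Unit} {Λ₁ Λ₂ : ℝ} {n₁ n₂ : ℕ} {β₁ β₂ : ℝ}
    (h₁ : Concentrates x y Λ₁ n₁ β₁) (h₂ : Concentrates x z Λ₂ n₂ β₂) {a b : ℝ} (ha : 0 ≤ a)
    (hb : 0 ≤ b) (hy : 0 ≤ y) (hz : 0 ≤ z) :
    Concentrates x (a • y + b • z) (a * Λ₁ + b * Λ₂) (n₁ + n₂) (min β₁ β₂) := by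
  obtain ⟨hΛ₁, hβ₁, hi₁, hA₁⟩ := h₁
  obtain ⟨hΛ₂, hβ₂, hi₂, hA₂⟩ := h₂
  have hab := (eabs_convexCombination ha hb hy hz).2
  have hΛ : ENNReal.ofReal (a * Λ₁ + b * Λ₂) = ENNReal.ofReal a * ENNReal.ofReal Λ₁ +
      ENNReal.ofReal b * ENNReal.ofReal Λ₂ := by
    rw [ENNReal.ofReal_add (by positivity) (by positivity), ENNReal.ofReal_mul ha,
      ENNReal.ofReal_mul hb]
  have hint : ∀ μ ≤ lebUnit, ∫⁻ u, eabs (a • y + b • z) u ∂μ =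
      ENNReal.ofReal a * ∫⁻ u, eabs y u ∂μ + ENNReal.ofReal b * ∫⁻ u, eabs z u ∂μ := by
    intro μ hμ
    rw [lintegral_congr_ae (hμ.absolutelyContinuous.ae_le hab),
      lintegral_add_left ((measurable_eabs y).const_mul _),
      lintegral_const_mul _ (measurable_eabs y), lintegral_const_mul _ (measurable_eabs z)]
  refine ⟨by positivity, lt_min hβ₁ hβ₂, ?_, fun t ht => ?_⟩
  · rw [hint _ le_rfl, hΛ, add_mul, mul_assoc, mul_assoc]
    gcongr
  · obtain ⟨A₁, hm₁, hl₁, hs₁⟩ := hA₁ t ⟨ht.1, ht.2.trans (min_le_left _ _)⟩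
    obtain ⟨A₂, hm₂, hl₂, hs₂⟩ := hA₂ t ⟨ht.1, ht.2.trans (min_le_right _ _)⟩
    refine ⟨A₁ ∪ A₂, hm₁.union hm₂, ?_, ?_⟩
    · rw [Nat.cast_add, add_mul]
      exact (measure_union_le _ _).trans (add_le_add hl₁ hl₂)
    · rw [hint _ Measure.restrict_le_self, hΛ, add_mul, mul_assoc, mul_assoc]
      gcongr
      · exact hs₁.trans (lintegral_mono_set Set.subset_union_left)
      · exact hs₂.trans (lintegral_mono_set Set.subset_union_right)

theorem setLIntegral_Ioc_comp_div {f : ℝ → ℝ≥0∞} (hf : Measurable f) {s : ℝ} (hs : 0 < s)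
    (t : ℝ) : ∫⁻ u in Set.Ioc 0 t, f (u / s) =
      ENNReal.ofReal s * ∫⁻ u in Set.Ioc 0 (t / s), f u := by
  have hm : Measurable ((Set.Ioc 0 (t / s)).indicator f) := hf.indicator measurableSet_Ioc
  have h1 : ∀ u, (Set.Ioc 0 t).indicator (fun u => f (u / s)) u =
      (Set.Ioc 0 (t / s)).indicator f (s⁻¹ * u) := by
    intro u
    have h2 : u ∈ Set.Ioc 0 t ↔ s⁻¹ * u ∈ Set.Ioc 0 (t / s) := by
      rw [Set.mem_Ioc, Set.mem_Ioc, ← div_eq_inv_mul, div_le_div_iff_of_pos_right hs,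
        div_pos_iff_of_pos_right hs]
    by_cases h : u ∈ Set.Ioc 0 t
    · rw [Set.indicator_of_mem h, Set.indicator_of_mem (h2.1 h), div_eq_inv_mul]
    · rw [Set.indicator_of_notMem h, Set.indicator_of_notMem fun h' => h (h2.2 h')]
  rw [← lintegral_indicator measurableSet_Ioc, ← lintegral_indicator measurableSet_Ioc]
  simp_rw [h1]
  rw [← lintegral_map hm (measurable_const_mul s⁻¹), Real.map_volume_mul_left (by positivity),
    lintegral_smul_measure, inv_inv, abs_of_pos hs, smul_eq_mul]

/-- The excess of a function which is antitone on `(0, 1)`. -/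
theorem Antitone.exists_excess_add_le {f : ℝ → ℝ≥0∞} (hf : Antitone f) (c : ℝ≥0∞) :
    ∃ t ∈ Set.Icc (0 : ℝ) 1,
      excess f c + c * ENNReal.ofReal t ≤ ∫⁻ u in Set.Ioc 0 t, f u := by
  set S : Set ℝ := {u | c < f u} with hS
  have hSm : MeasurableSet S := measurableSet_lt measurable_const hf.measurable
  have hS1 : lebUnit S ≤ 1 := prob_le_one
  have htop : lebUnit S ≠ ⊤ := ne_top_of_le_ne_top ENNReal.one_ne_top hS1
  have ht : ENNReal.ofReal (lebUnit S).toReal = lebUnit S := ENNReal.ofReal_toReal htop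
  have ht1 : (lebUnit S).toReal ≤ 1 := ENNReal.toReal_mono ENNReal.one_ne_top hS1
  -- For an antitone f the set {f > c} is, inside the unit interval, an initial interval, and t is
  -- its length.
  refine ⟨(lebUnit S).toReal, ⟨ENNReal.toReal_nonneg, ht1⟩, ?_⟩
  have hm : Measurable fun u => f u - c := hf.measurable.sub_const c
  have h1 : excess f c = ∫⁻ u in S, (f u - c) ∂lebUnit := by
    rw [← lintegral_indicator hSm, excess]
    refine lintegral_congr fun u => ?_
    by_cases h : u ∈ S
    · rw [Set.indicator_of_mem h]
    · rw [Set.indicator_of_notMem h]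
      exact tsub_eq_zero_of_le (not_lt.1 h)
  have h2 : excess f c + c * lebUnit S = ∫⁻ u in S, f u ∂lebUnit := by
    rw [h1, ← setLIntegral_const, ← lintegral_add_left hm]
    exact setLIntegral_congr_fun hSm fun u hu => tsub_add_cancel_of_le (le_of_lt hu)
  have h3 : S ∩ Set.Ioo 0 1 ⊆ Set.Ioc 0 (lebUnit S).toReal := by
    rintro u ⟨huS, hu⟩
    refine ⟨hu.1, ?_⟩
    rw [← ENNReal.ofReal_le_iff_le_toReal htop, ← lebUnit_Iic u hu.1.le hu.2.le]
    exact measure_mono fun v hv => lt_of_lt_of_le huS (hf hv)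
  rw [ht, h2, Measure.restrict_restrict hSm]
  exact lintegral_mono_set h3

/-- Morally, integrate w + κ ≤ c + (w + κ - c)⁺ over a set of measure t containing A. Separating the
cases κ ≤ c and c ≤ κ avoids constructing that set. -/
theorem setLIntegral_add_le_excess (w : ℝ → ℝ≥0∞) {A : Set ℝ} {t : ℝ}
    (ht : t ∈ Set.Icc (0 : ℝ) 1) (hA : lebUnit A ≤ ENNReal.ofReal t) (κ c : ℝ≥0∞) (hκ : κ ≠ ⊤) :
    ∫⁻ u in A, w u ∂lebUnit + κ * ENNReal.ofReal t ≤
      excess (fun u => w u + κ) c + c * ENNReal.ofReal t := by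
  have ht1 : ENNReal.ofReal t ≤ 1 := by
    rw [← ENNReal.ofReal_one]
    exact ENNReal.ofReal_le_ofReal ht.2
  rcases le_total κ c with h | h
  · obtain ⟨d, rfl⟩ := exists_add_of_le h
    have h1 : ∫⁻ u in A, w u ∂lebUnit ≤ excess (fun u => w u + κ) (κ + d) + d * lebUnit A := by
      calc ∫⁻ u in A, w u ∂lebUnit ≤ ∫⁻ u in A, ((w u + κ - (κ + d)) + d) ∂lebUnit := by
            refine lintegral_mono fun u => ?_
            change w u ≤ (w u + κ - (κ + d)) + d
            rw [← tsub_tsub, ENNReal.add_sub_cancel_right hκ]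
            exact le_tsub_add
        _ = ∫⁻ u in A, (w u + κ - (κ + d)) ∂lebUnit + d * lebUnit A := by
            rw [lintegral_add_right _ measurable_const, setLIntegral_const]
        _ ≤ _ := add_le_add (lintegral_mono' Measure.restrict_le_self le_rfl) le_rfl
    calc _ ≤ excess (fun u => w u + κ) (κ + d) + d * ENNReal.ofReal t + κ * ENNReal.ofReal t := by
          gcongr
          exact h1.trans (by gcongr)
      _ = _ := by ring
  · obtain ⟨d, rfl⟩ := exists_add_of_le h
    have hc : c ≠ ⊤ := ne_top_of_le_ne_top hκ h
    have h1 : excess (fun u => w u + (c + d)) c = ∫⁻ u, w u ∂lebUnit + d := by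
      have : ∀ u, w u + (c + d) - c = w u + d := fun u => by
        rw [add_left_comm, ENNReal.add_sub_cancel_left hc]
      rw [excess]
      simp_rw [this]
      rw [lintegral_add_right _ measurable_const, lintegral_const, measure_univ, mul_one]
    rw [h1]
    calc _ = ∫⁻ u in A, w u ∂lebUnit + d * ENNReal.ofReal t + c * ENNReal.ofReal t := by ring
      _ ≤ ∫⁻ u, w u ∂lebUnit + d * 1 + c * ENNReal.ofReal t := by
          gcongr
          exact Measure.restrict_le_self
      _ = _ := by rw [mul_one]

/-- A concentrating function close to a constant controls the dilations of `x`. -/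
theorem Concentrates.excess_dilation_le {x z : L0Unit} {Λ : ℝ} {n : ℕ} {β : ℝ}
    (h : Concentrates x z Λ n β) {w : ℝ → ℝ≥0∞} {M : ℝ≥0∞} (hM : M ≠ ⊤)
    (hz : ∀ᵐ u ∂lebUnit, eabs z u ≤ w u + M) {s : ℝ} (hs : 1 ≤ s) (hns : n ≤ s)
    (hβs : β⁻¹ ≤ s) (c : ℝ≥0∞) :
    excess (fun u => ENNReal.ofReal (Λ / s) * decRearr lebUnit (eabs x) (u / s)) c ≤
      excess (fun u => w u + ENNReal.ofReal (n / s) * M) c := by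
  obtain ⟨hΛ, hβ, -, hA⟩ := h
  have hs0 : 0 < s := by linarith
  have hanti : Antitone fun u => ENNReal.ofReal (Λ / s) * decRearr lebUnit (eabs x) (u / s) :=
    fun u v huv => mul_le_mul_right
      (decRearr_antitone _ _ (div_le_div_of_nonneg_right huv hs0.le)) _
  obtain ⟨t, ht, hle⟩ := hanti.exists_excess_add_le c
  have htβ : t / s ∈ Set.Icc 0 β := by
    refine ⟨div_nonneg ht.1 hs0.le, ?_⟩
    rw [div_le_iff₀ hs0]
    have := (inv_le_iff_one_le_mul₀' hβ).1 hβs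
    linarith [ht.2]
  -- Concentration is used at t/s: the integral of the dilation over (0, t) is an integral of X over
  -- (0, t/s), and A has measure at most (n/s)t. The bound M on A thus contributes only (n/s)Mt.
  obtain ⟨A, hAm, hAl, hAi⟩ := hA _ htβ
  have hAl' : lebUnit A ≤ ENNReal.ofReal (n / s) * ENNReal.ofReal t := by
    refine hAl.trans_eq ?_
    rw [← ENNReal.ofReal_natCast, ← ENNReal.ofReal_mul (by positivity),
      ← ENNReal.ofReal_mul (by positivity)]
    congr 1
    ring
  have hns1 : ENNReal.ofReal (n / s) ≤ 1 := by
    rw [← ENNReal.ofReal_one]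
    exact ENNReal.ofReal_le_ofReal ((div_le_one hs0).2 hns)
  have hdil : ∫⁻ u in Set.Ioc 0 t, ENNReal.ofReal (Λ / s) * decRearr lebUnit (eabs x) (u / s) =
      ENNReal.ofReal Λ * ∫⁻ u in Set.Ioc 0 (t / s), decRearr lebUnit (eabs x) u := by
    have hm : Measurable fun u => decRearr lebUnit (eabs x) (u / s) :=
      (measurable_decRearr _ _).comp (measurable_id.div_const s)
    rw [lintegral_const_mul _ hm, setLIntegral_Ioc_comp_div (measurable_decRearr _ _) hs0,
      ← mul_assoc, ← ENNReal.ofReal_mul (by positivity), div_mul_cancel₀ _ hs0.ne']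
  have hAz : ∫⁻ u in A, eabs z u ∂lebUnit ≤
      ∫⁻ u in A, w u ∂lebUnit + ENNReal.ofReal (n / s) * M * ENNReal.ofReal t := by
    calc ∫⁻ u in A, eabs z u ∂lebUnit ≤ ∫⁻ u in A, (w u + M) ∂lebUnit :=
          lintegral_mono_ae (ae_restrict_of_ae hz)
      _ = ∫⁻ u in A, w u ∂lebUnit + M * lebUnit A := by
          rw [lintegral_add_right _ measurable_const, setLIntegral_const]
      _ ≤ ∫⁻ u in A, w u ∂lebUnit + M * (ENNReal.ofReal (n / s) * ENNReal.ofReal t) := by gcongr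
      _ = _ := by ring
  have hkey := setLIntegral_add_le_excess w ht
    (hAl'.trans (mul_le_of_le_one_left bot_le hns1)) (ENNReal.ofReal (n / s) * M) c
    (ENNReal.mul_ne_top ENNReal.ofReal_ne_top hM)
  rw [hdil] at hle
  rcases eq_or_ne c ⊤ with rfl | hc
  · rw [excess_top]
    exact bot_le
  · exact (ENNReal.add_le_add_iff_right (ENNReal.mul_ne_top hc ENNReal.ofReal_ne_top)).1
      (hle.trans (hAi.trans (hAz.trans hkey)))

/-! ### The dilation limit -/

namespace NormedFunctionSpace

variable {E : NormedFunctionSpace}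

theorem exists_concentrates_of_mem_convexHull {x : L0Unit} (hx : 0 ≤ x)
    (hxi : ∫⁻ u, eabs x u ∂lebUnit ≠ ⊤) {z : E}
    (hz : z ∈ convexHull ℝ {z : E | toL0 z ∈ (substochasticOrbit x).extremePoints ℝ}) :
    ∃ Λ n β, Concentrates x (toL0 z) Λ n β := by
  have hconv : Convex ℝ {z : E | 0 ≤ toL0 z ∧ ∃ Λ n β, Concentrates x (toL0 z) Λ n β} := by
    rintro z₁ ⟨h₁, Λ₁, n₁, β₁, hc₁⟩ z₂ ⟨h₂, Λ₂, n₂, β₂, hc₂⟩ a b ha hb -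
    exact ⟨(eabs_convexCombination ha hb h₁ h₂).1, _, _, _,
      hc₁.convexCombination hc₂ ha hb h₁ h₂⟩
  refine (convexHull_min (fun y hy => ?_) hconv hz).2
  exact ⟨((mem_substochasticOrbit_iff hx hxi _).1 hy.1).1,
    concentrates_of_mem_extremePoints hx hxi hy⟩

namespace IsFullySymmetric

/-- Full symmetry turns the excess comparison of (Λ/s) σ_s X with |w| + nM/s into a norm inequality.
It also shows that the dilation belongs to E, so its extended norm is finite. -/
theorem extNorm_dilatedRearrangement_le (hE : E.IsFullySymmetric) {e : E}
    (he : toL0 e = oneL0) {x z w : E} {M : ℝ} (hM : 0 ≤ M) (hw : toL0 w = M • oneL0 - toL0 z)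
    {Λ : ℝ} (hΛ : 0 < Λ) {n : ℕ} {β : ℝ} (hz : Concentrates (toL0 x) (toL0 z) Λ n β) {s : ℝ}
    (hs : 1 ≤ s) (hns : n ≤ s) (hβs : β⁻¹ ≤ s) :
    E.extNorm (dilatedRearrangement s (toL0 x)) / ENNReal.ofReal s ≤
      ENNReal.ofReal ((‖w‖ + n / s * M * ‖e‖) / Λ) := by
  have hs0 : 0 < s := by linarith
  have hκ : 0 ≤ n / s * M := by positivity
  have hwabs := eabs_ofFun (measurable_eabs (toL0 w)) (Eventually.of_forall (eabs_lt_top (toL0 w)))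
  obtain ⟨v, hv, hvn⟩ := hE.exists_of_excess_le he w
    (y := ofFun (eabs (toL0 w)) (measurable_eabs _)) fun c => (excess_congr hwabs c).le
  have hzw : ∀ᵐ u ∂lebUnit, eabs (toL0 z) u ≤ eabs (toL0 w) u + ENNReal.ofReal M := by
    filter_upwards [eabs_smul_oneL0 hM, AEEqFun.coeFn_sub (M • oneL0) (toL0 z)] with u h1 h2
    have h3 : toL0 z u = (M • oneL0 : L0Unit) u - toL0 w u := by
      rw [hw, h2, Pi.sub_apply, sub_sub_cancel]
    rw [← h1, add_comm]
    change ‖toL0 z u‖ₑ ≤ _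
    rw [h3]
    exact enorm_sub_le
  have hV : eabs (toL0 (v + (n / s * M) • e)) =ᵐ[lebUnit]
      fun u => eabs (toL0 w) u + ENNReal.ofReal (n / s) * ENNReal.ofReal M := by
    have h0 : 0 ≤ oneL0 := ofFun_nonneg _ measurable_const
    have h1 := (eabs_convexCombination zero_le_one hκ (ofFun_nonneg _ (measurable_eabs (toL0 w)))
      h0).2
    rw [toL0_add, toL0_smul, he, hv, ← one_smul ℝ (ofFun (eabs (toL0 w)) _)]
    filter_upwards [h1, hwabs, eabs_oneL0] with u h2 h3 h4
    rw [h2, h3, h4, ENNReal.ofReal_one, one_mul, mul_one, ENNReal.ofReal_mul (by positivity)]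
  have hdil : eabs ((Λ / s) • dilatedRearrangement s (toL0 x)) =ᵐ[lebUnit]
      fun u => ENNReal.ofReal (Λ / s) * decRearr lebUnit (eabs (toL0 x)) (u / s) := by
    filter_upwards [eabs_smul (Λ / s) (dilatedRearrangement s (toL0 x)),
      eabs_dilatedRearrangement (x := toL0 x) hs] with u h1 h2
    rw [h1, h2, abs_of_nonneg (by positivity)]
  obtain ⟨g, hg, hgn⟩ := hE.exists_of_excess_le he (v + (n / s * M) • e)
    (y := (Λ / s) • dilatedRearrangement s (toL0 x)) fun c => by
      rw [excess_congr hdil, excess_congr hV]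
      exact hz.excess_dilation_le ENNReal.ofReal_ne_top hzw hs hns hβs c
  have hgd : dilatedRearrangement s (toL0 x) = toL0 ((s / Λ) • g) := by
    rw [toL0_smul, hg, smul_smul, div_mul_div_cancel₀ hΛ.ne', div_self hs0.ne', one_smul]
  have hgn' : ‖g‖ ≤ ‖w‖ + n / s * M * ‖e‖ := by
    refine hgn.trans ((E.norm_triangle _ _).trans (add_le_add hvn ?_))
    refine (E.norm_smul _ _).le.trans_eq ?_
    rw [abs_of_nonneg hκ]
    rfl
  rw [hgd, extNorm_toL0, norm_real_smul, abs_of_nonneg (by positivity),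
    ← ENNReal.ofReal_div_of_pos hs0]
  refine ENNReal.ofReal_le_ofReal ?_
  calc s / Λ * ‖g‖ / s = ‖g‖ / Λ := by field_simp
    _ ≤ _ := div_le_div_of_nonneg_right hgn' hΛ.le

theorem hasDilationLimit_of_orbit_subset (hE : E.IsFullySymmetric) {e : E}
    (he : toL0 e = oneL0) {x : E} (hx : 0 ≤ toL0 x) (hx0 : toL0 x ≠ 0)
    (h : substochasticOrbit (toL0 x) ⊆ toL0 '' closedHullExtremePoints E (toL0 x)) :
    E.HasDilationLimit (toL0 x) 0 := by
  have hxi := hE.lintegral_ne_top he x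
  have hpos := norm_one_pos he
  set M : ℝ := (∫⁻ u, eabs (toL0 x) u ∂lebUnit).toReal with hM
  have hMx : ENNReal.ofReal M = ∫⁻ u, eabs (toL0 x) u ∂lebUnit := ENNReal.ofReal_toReal hxi
  have hM0 : 0 < M := ENNReal.toReal_pos (fun h => hx0 (eq_zero_of_lintegral_eabs h)) hxi
  -- The test element is the constant equal to the mean of x: a bounded function, whereas
  -- combinations of extreme points inherit the peak of X.
  have hYmem : toL0 (M • e) ∈ substochasticOrbit (toL0 x) := by
    rw [mem_substochasticOrbit_iff hx hxi, toL0_smul, he]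
    refine ⟨?_, excess_smul_oneL0_le hM0.le hMx.le⟩
    have h0 : 0 ≤ oneL0 := ofFun_nonneg _ measurable_const
    simpa using (eabs_convexCombination hM0.le le_rfl h0 h0).1
  obtain ⟨Y, hY, hYe⟩ := h hYmem
  obtain rfl := toL0_injective hYe
  refine ENNReal.tendsto_nhds_zero.2 fun ε hε => ?_
  have hε1 : min ε 1 ≠ ⊤ := ne_top_of_le_ne_top ENNReal.one_ne_top (min_le_right _ _)
  set ε' : ℝ := (min ε 1).toReal with hε'
  have hε'0 : 0 < ε' := ENNReal.toReal_pos (lt_min hε one_pos).ne' hε1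
  have hε'le : ENNReal.ofReal ε' ≤ ε := by
    rw [hε', ENNReal.ofReal_toReal hε1]
    exact min_le_left _ _
  -- The first threshold keeps the mean of z at least M/2, hence Λ ≥ 1/2. The second, together with
  -- an equal bound on nM‖e‖/s for large s, gives a total of at most ε'/2 ≤ Λε'.
  obtain ⟨z, hz, hYz⟩ := Metric.mem_closure_iff.1 hY (min (M * ‖e‖ / 2) (ε' / 4))
    (lt_min (by positivity) (by positivity))
  rw [dist_eq_norm] at hYz
  set w : E := M • e - z with hw
  obtain ⟨hw1, hw2⟩ := lt_min_iff.1 hYz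
  obtain ⟨Λ, n, β, hc⟩ := exists_concentrates_of_mem_convexHull hx hxi hz
  have hwn : 0 ≤ ‖w‖ / ‖e‖ := div_nonneg (_root_.norm_nonneg w) hpos.le
  have hwL : toL0 w = M • oneL0 - toL0 z := by rw [hw, toL0_sub, toL0_smul, he]
  have hΛ : 1 / 2 ≤ Λ := by
    have h1 : ENNReal.ofReal M ≤ ENNReal.ofReal (Λ * M + ‖w‖ / ‖e‖) := by
      calc ENNReal.ofReal M = ∫⁻ u, eabs (M • oneL0) u ∂lebUnit := by
            rw [lintegral_congr_ae (eabs_smul_oneL0 hM0.le), lintegral_const, measure_univ,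
              mul_one]
        _ ≤ ∫⁻ u, (eabs (toL0 z) u + eabs (toL0 w) u) ∂lebUnit := by
            refine lintegral_mono_ae ?_
            have h2 := eabs_add_le (toL0 z) (toL0 w)
            rwa [hwL, add_sub_cancel, ← hwL] at h2
        _ = ∫⁻ u, eabs (toL0 z) u ∂lebUnit + ∫⁻ u, eabs (toL0 w) u ∂lebUnit :=
            lintegral_add_left (measurable_eabs _) _
        _ ≤ ENNReal.ofReal Λ * ENNReal.ofReal M + ENNReal.ofReal (‖w‖ / ‖e‖) := by
            rw [hMx]
            exact add_le_add hc.2.2.1 (hE.lintegral_le he w)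
        _ = _ := by
            rw [← ENNReal.ofReal_mul hc.1, ← ENNReal.ofReal_add (mul_nonneg hc.1 hM0.le) hwn]
    have h2 := (ENNReal.ofReal_le_ofReal_iff (add_nonneg (mul_nonneg hc.1 hM0.le)
      hwn)).1 h1
    have h3 : ‖w‖ / ‖e‖ < M / 2 := by
      rw [div_lt_iff₀ hpos]
      calc ‖w‖ < M * ‖e‖ / 2 := hw1
        _ = _ := by ring
    by_contra! h4
    nlinarith
  have hΛ0 : 0 < Λ := by linarith
  filter_upwards [eventually_ge_atTop (1 : ℝ), eventually_ge_atTop (n : ℝ),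
    eventually_ge_atTop β⁻¹, eventually_ge_atTop (4 * n * M * ‖e‖ / ε')] with s h1 h2 h3 h4
  refine (hE.extNorm_dilatedRearrangement_le he hM0.le hwL hΛ0 hc h1 h2 h3).trans
    ((ENNReal.ofReal_le_ofReal ?_).trans hε'le)
  have hs0 : 0 < s := by linarith
  have h5 : n / s * M * ‖e‖ ≤ ε' / 4 := by
    rw [div_le_iff₀ hε'0] at h4
    rw [show n / s * M * ‖e‖ = n * M * ‖e‖ / s by ring, div_le_iff₀ hs0]
    linarith
  rw [div_le_iff₀ hΛ0]
  have h6 : ‖w‖ < ε' / 4 := hw2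
  nlinarith

end IsFullySymmetric

/-! ### The zero function and the conclusion -/

theorem closedHullExtremePoints_zero :
    substochasticOrbit 0 = toL0 '' closedHullExtremePoints E 0 := by
  have h0 : ∫⁻ u, eabs 0 u ∂lebUnit = 0 := by
    rw [lintegral_eq_zero_iff (measurable_eabs 0)]
    filter_upwards [AEEqFun.coeFn_zero (μ := lebUnit) (β := ℝ)] with u hu
    rw [eabs, hu]
    simp
  have horb : substochasticOrbit 0 = {0} := by
    ext y
    rw [mem_substochasticOrbit_iff le_rfl (by rw [h0]; exact ENNReal.zero_ne_top),
      Set.mem_singleton_iff]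
    constructor
    · rintro ⟨-, h⟩
      have h1 := h 0
      rw [excess_zero, excess_zero, h0] at h1
      exact eq_zero_of_lintegral_eabs (le_antisymm h1 bot_le)
    · rintro rfl
      exact ⟨le_rfl, fun _ => le_rfl⟩
  have hset : {y : E | toL0 y ∈ (substochasticOrbit 0).extremePoints ℝ} = {0} := by
    rw [horb, extremePoints_singleton]
    ext y
    exact ⟨fun h => toL0_injective h, fun h => congrArg toL0 h⟩
  rw [closedHullExtremePoints, hset, convexHull_singleton, closure_singleton,
    Set.image_singleton, horb, toL0_zero]

theorem hasDilationLimit_zero : E.HasDilationLimit 0 0 := by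
  refine tendsto_const_nhds.congr' ?_
  filter_upwards [eventually_ge_atTop (1 : ℝ)] with s hs
  have hz : ∀ t, decRearr lebUnit (eabs 0) t = 0 := fun t => by
    refine le_antisymm ((decRearr_le_iff _ _ _ _).2 (le_of_eq_of_le ?_ bot_le)) bot_le
    refine measure_mono_null (t := {u | (0 : L0Unit) u ≠ 0}) (fun u hu hu0 => ?_)
      (AEEqFun.coeFn_zero (μ := lebUnit) (β := ℝ))
    have h1 : 0 < ‖(0 : L0Unit) u‖ₑ := hu
    rw [hu0, enorm_zero] at h1
    exact lt_irrefl _ h1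
  have h0 : dilatedRearrangement s 0 = 0 := by
    refine eq_zero_of_lintegral_eabs ?_
    rw [lintegral_congr_ae (eabs_dilatedRearrangement hs)]
    simp_rw [hz]
    exact lintegral_zero
  have h1 : ‖(0 : E)‖ = 0 := (E.norm_eq_zero_iff 0).2 rfl
  rw [h0, ← toL0_zero (E := E), extNorm_toL0, h1, ENNReal.ofReal_zero, ENNReal.zero_div]

end NormedFunctionSpace

theorem mainTheorem2 (E : NormedFunctionSpace) (hE : E.IsFullySymmetric) (x : E)
    (hx : 0 ≤ NormedFunctionSpace.toL0 x) :
    (E.HasDilationLimit (NormedFunctionSpace.toL0 x) 0 →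
      substochasticOrbit (NormedFunctionSpace.toL0 x) =
        NormedFunctionSpace.toL0 ''
          closedHullExtremePoints E (NormedFunctionSpace.toL0 x)) ∧
    (E.IsFatou →
      substochasticOrbit (NormedFunctionSpace.toL0 x) =
        NormedFunctionSpace.toL0 ''
          closedHullExtremePoints E (NormedFunctionSpace.toL0 x) →
      E.HasDilationLimit (NormedFunctionSpace.toL0 x) 0) := by
  -- For x = 0 the space may be trivial and contain no constants, so this case is treated directly;
  -- both assertions then hold.
  by_cases hx0 : NormedFunctionSpace.toL0 x = 0
  · rw [hx0]
    exact ⟨fun _ => NormedFunctionSpace.closedHullExtremePoints_zero,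
      fun _ _ => NormedFunctionSpace.hasDilationLimit_zero⟩
  · obtain ⟨e, he⟩ := hE.exists_one hx0
    exact ⟨fun hφ => (hE.orbit_subset_of_hasDilationLimit he hx hφ).antisymm
        (hE.closedHull_subset he hx),
      fun _ h => hE.hasDilationLimit_of_orbit_subset he hx hx0 h.subset⟩
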